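/- Let $N\in\{2,3\}$, let $\Omega\subset\mathbb R^N$ be a nonempty bounded convex polygonal/polyhedral open set, and let $\mathcal T_h$ be a conforming (face-to-face) triangulation of $\Omega$ into finitely many closed nondegenerate simplices $K$, with $\overline\Omega=\bigcup_{K\in\mathcal T_h}K$; $\mathcal F_h$ is the set of all $(N-1)$-dimensional faces $\tau$ of the elements, and $h_K,h_\tau$ are the diameters. The minimum angle of $\mathcal T_h$ is the smallest angle (solid angle if $N=3$) of an element at one of its vertices. Let $H^2_E(\Omega)=\{\psi\in H^2(\Omega):\partial\psi/\partial n=0\text{ on }\partial\Omega\}$, and let $S_h\subset H^2_E(\Omega)$ be a finite-dimensional ($C^1$-conforming) finite element space of functions whose restriction to each $K\in\mathcal T_h$ is a polynomial. Assume the local approximation property: there is a map $\Pi_h:H^2_E(\Omega)\to S_h$ such that for all $\psi\in H^2_E(\Omega)$, $K\in\mathcal T_h$, $\tau\in\mathcal F_h$, $$\|\psi-\Pi_h\psi\|_{L^2(K)}\le c\,h_K^2\|\psi\|_{H^2(\widetilde K)},\quad \|\psi-\Pi_h\psi\|_{L^2(\tau)}\le c\,h_\tau^{3/2}\|\psi\|_{H^2(\tilde\tau)},\quad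 \Big\|\frac{\partial(\psi-\Pi_h\psi)}{\partial n}\Big\|_{L^2(\tau)}\le c\,h_\tau^{1/2}\|\psi\|_{H^2(\tilde\tau)},$$ where $\widetilde K,\tilde\tau$ are the unions of all elements meeting $K$, respectively $\tau$, and the constant $c$ depends only on the minimum angle of $\mathcal T_h$. Let $f=F'$, where $F\in C^\infty(\mathbb R)$ takes its global minimum value $0$ at $\pm1$, let $0<\varepsilon\le 1$ and $T>0$, and let $u_h:[0,T]\to S_h$ be differentiable in time and satisfy, for all $t\in[0,T]$ and $\psi_h\in S_h$, $$\Big\langle\frac{\partial u_h}{\partial t},\psi_h\Big\rangle+\varepsilon(\Delta u_h,\Delta\psi_h)+\frac1\varepsilon(\nabla f(u_h),\nabla\psi_h)=0 .$$ Define the residual $r_h(t)$ by $$\langle r_h(t),\psi\rangle=\Big\langle\frac{\partial u_h}{\partial t},\psi\Big\rangle+\varepsilon(\Delta u_h,\Delta\psi)+\frac1\varepsilon(\nabla f(u_h),\nabla\psi)\quad\forall\psi\in H^2_E(\Omega),\qquad \|r_h(t)\|_{\widetilde H^{-2}(\Omega)}=\sup_{0\ne\psi\in H^2_E(\Omega)}\frac{\langle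 r_h(t),\psi\rangle}{\|\psi\|_{H^2(\Omega)}} .$$ For $K\in\mathcal T_h$ let $R_K(t)=\frac{\partial u_h(t)|_K}{\partial t}+\Delta\big(\varepsilon\Delta u_h(t)|_K-\frac1\varepsilon f(u_h(t)|_K)\big)$. For a face $\tau$ of $K$ let $n$ be the unit normal to $\tau$ outward from $K$. If $\tau$ is the common face of $K$ and another element $K'$, put $$J_\tau(t)=\big(\nabla\Delta u_h(t)|_{K'}-\nabla\Delta u_h(t)|_K\big)\cdot n,\qquad \hat J_\tau(t)=\Delta u_h(t)|_K-\Delta u_h(t)|_{K'},$$ and if $\tau\subset\partial\Omega$ put $J_\tau(t)=-2\nabla\Delta u_h(t)|_K\cdot n$ and $\hat J_\tau(t)=2\Delta u_h(t)|_K$. Let $$\eta_K(t)=h_K^2\|R_K(t)\|_{L^2(K)}+\sum_{\tau\subset\partial K}\Big(\frac{h_\tau^3}{2}\|J_\tau(t)\|_{L^2(\tau)}^2+\frac{h_\tau}{2}\|\hat J_\tau(t)\|_{L^2(\tau)}^2\Big)^{1/2}.$$ Then there is a constant $C$, depending only on the minimum angle of $\mathcal T_h$ (given the dependence of $c$ on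 that angle), such that for every $t\in(0,T]$ $$\|r_h(t)\|_{\widetilde H^{-2}(\Omega)}^2\le C\sum_{K\in\mathcal T_h}\eta_K(t)^2 .$$ -/

import Mathlib

open Set Filter Topology MeasureTheory
open scoped ENNReal ContDiff RealInnerProductSpace

noncomputable section

namespace CahnHilliardFE

/-- Euclidean space `ℝᴺ`. -/
abbrev E (N : ℕ) := EuclideanSpace ℝ (Fin N)

variable {N : ℕ}

/-! ### Classical and weak derivatives, Sobolev spaces -/

/-- The classical partial derivative `∂ᵢ φ`. -/
def classicalPartial (i : Fin N) (φ : E N → ℝ) (x : E N) : ℝ :=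
  fderiv ℝ φ x (EuclideanSpace.single i 1)

/-- `g ∈ L²(Ω)` is the weak partial derivative `∂ᵢ w` in the open set `Ω`. -/
def IsWeakPartial (Ω : Set (E N)) (i : Fin N) (w g : E N → ℝ) : Prop :=
  MemLp g 2 (volume.restrict Ω) ∧
    ∀ φ : E N → ℝ, ContDiff ℝ ∞ φ → HasCompactSupport φ → tsupport φ ⊆ Ω →
      ∫ x in Ω, w x * classicalPartial i φ x = -∫ x in Ω, g x * φ x

open Classical in
/-- The weak partial derivative `∂ᵢ w` in `Ω` (a representative of the almost everywhere unique
`L²` function; `0` if there is none). -/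
def weakPartial (Ω : Set (E N)) (i : Fin N) (w : E N → ℝ) : E N → ℝ :=
  if h : ∃ g, IsWeakPartial Ω i w g then h.choose else 0

lemma isWeakPartial_weakPartial {Ω : Set (E N)} {i : Fin N} {w : E N → ℝ}
    (h : ∃ g, IsWeakPartial Ω i w g) : IsWeakPartial Ω i w (weakPartial Ω i w) := by
  rw [weakPartial, dif_pos h]
  exact h.choose_spec

/-- `w ∈ H¹(Ω)`. -/
def MemH1 (Ω : Set (E N)) (w : E N → ℝ) : Prop :=
  MemLp w 2 (volume.restrict Ω) ∧ ∀ i, ∃ g, IsWeakPartial Ω i w g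

/-- `w ∈ H²(Ω)`. -/
def MemH2 (Ω : Set (E N)) (w : E N → ℝ) : Prop :=
  MemH1 Ω w ∧ ∀ i, MemH1 Ω (weakPartial Ω i w)

/-- The weak Laplacian. -/
def weakLaplacian (Ω : Set (E N)) (w : E N → ℝ) (x : E N) : ℝ :=
  ∑ i, weakPartial Ω i (weakPartial Ω i w) x

/-- `w ∈ H²_E(Ω)`: `w ∈ H²(Ω)` and `∂w/∂n = 0` on `∂Ω`. The normal trace of `∇w` vanishes on `∂Ω`
in the usual sense of Green's formula, `(∇w, ∇η) + (Δw, η) = ∫_{∂Ω} (∂w/∂n) η = 0` for all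
`η ∈ H¹(Ω)`. -/
def MemH2E (Ω : Set (E N)) (w : E N → ℝ) : Prop :=
  MemH2 Ω w ∧ ∀ η : E N → ℝ, MemH1 Ω η →
    (∫ x in Ω, ∑ i, weakPartial Ω i w x * weakPartial Ω i η x)
      + ∫ x in Ω, weakLaplacian Ω w x * η x = 0

/-- The `L²(μ)` norm, for functions in `L²(μ)`. -/
def l2Norm (μ : Measure (E N)) (w : E N → ℝ) : ℝ := (eLpNorm w 2 μ).toReal

/-- The norm of `H²(A)` of the restriction of `w ∈ H²(Ω)`: the square root of the sum of
`‖∂^α w‖²_{L²(A)}` over the multi-indices `|α| ≤ 2`. The set `A` is understood as `A ∩ Ω`; in the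
use below `A` is a subset of `closure Ω`. -/
def h2Norm (Ω A : Set (E N)) (w : E N → ℝ) : ℝ :=
  √(l2Norm (volume.restrict (A ∩ Ω)) w ^ 2
    + (∑ i, l2Norm (volume.restrict (A ∩ Ω)) (weakPartial Ω i w) ^ 2)
    + ∑ i, ∑ j with i ≤ j,
        l2Norm (volume.restrict (A ∩ Ω)) (weakPartial Ω i (weakPartial Ω j w)) ^ 2)

/-! ### Simplicial meshes -/

/-- The closed simplex spanned by a finite set of vertices. -/
def simplex (s : Finset (E N)) : Set (E N) := convexHull ℝ (s : Set (E N))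

/-- A conforming (face-to-face) finite simplicial triangulation of `Ω`: a finite simplicial complex
all of whose simplices are faces of `N`-dimensional ones, and which covers `closure Ω`. -/
structure Triangulation (Ω : Set (E N)) where
  complex : Geometry.SimplicialComplex ℝ (E N)
  finite_faces : complex.faces.Finite
  pure : ∀ s ∈ complex.faces, ∃ K ∈ complex.faces, K.card = N + 1 ∧ s ⊆ K
  space_eq : complex.space = closure Ω

/-- The elements of the mesh (`N`-dimensional simplices, given by their vertices). -/
def Triangulation.elements {Ω : Set (E N)} (𝒯 : Triangulation Ω) : Finset (Finset (E N)) :=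
  𝒯.finite_faces.toFinset.filter (fun K => K.card = N + 1)

/-- The `(N-1)`-dimensional faces of an element `K`. -/
def facesOf (K : Finset (E N)) : Finset (Finset (E N)) := K.powersetCard N

/-- The diameter `h_K` or `h_τ`. -/
def meshSize (s : Finset (E N)) : ℝ := Metric.diam (simplex s)

/-- The cone with apex `v` generated by the simplex `K`. -/
def coneAt (K : Finset (E N)) (v : E N) : Set (E N) :=
  {x | ∃ r : ℝ, 0 ≤ r ∧ ∃ y ∈ simplex K, x = v + r • (y - v)}

/-- The angle of the simplex `K` at its vertex `v`, i.e. the measure of the part of the unit sphere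
cut out by the cone of `K` at `v`, computed as `N` times the volume of the part of the unit ball
in that cone: the ordinary angle in radians for `N = 2`, the solid angle for `N = 3`. -/
def angleAt (K : Finset (E N)) (v : E N) : ℝ :=
  N * volume.real (coneAt K v ∩ Metric.ball v 1)

/-- The minimum angle of the mesh. -/
def Triangulation.minAngle {Ω : Set (E N)} (𝒯 : Triangulation Ω) : ℝ :=
  sInf {θ | ∃ K ∈ 𝒯.elements, ∃ v ∈ K, θ = angleAt K v}

/-- `K̃` or `τ̃`: the union of all elements having non-empty intersection with the simplex `s`. -/
def Triangulation.patch {Ω : Set (E N)} (𝒯 : Triangulation Ω) (s : Finset (E N)) : Set (E N) :=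
  ⋃ K ∈ {K | K ∈ 𝒯.elements ∧ (simplex K ∩ simplex s).Nonempty}, simplex K

/-- The surface (`(N-1)`-dimensional) measure on the face `τ`. -/
def faceMeasure (τ : Finset (E N)) : Measure (E N) :=
  (Measure.euclideanHausdorffMeasure (N - 1)).restrict (simplex τ)

/-- `n` is the unit normal to the face `τ` of `K` pointing out of `K`. -/
def IsOuterNormal (K τ : Finset (E N)) (n : E N) : Prop :=
  ‖n‖ = 1 ∧ (∀ x ∈ τ, ∀ y ∈ τ, ⟪n, x - y⟫ = 0) ∧ ∀ x ∈ K, ∀ y ∈ τ, ⟪n, x - y⟫ ≤ 0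

open Classical in
/-- The outer unit normal of `K` on its face `τ`. -/
def outerNormal (K τ : Finset (E N)) : E N :=
  if h : ∃ n, IsOuterNormal K τ n then h.choose else 0

/-- `g ∈ L²(τ)` is the trace on the face `τ ⊆ closure Ω` of `w ∈ H¹(Ω)`: it is the `L²(τ)`-limit of
the restrictions of functions in `C^∞(closure Ω)` that converge to `w` in `H¹(Ω)`. -/
def HasTrace (Ω : Set (E N)) (τ : Finset (E N)) (w g : E N → ℝ) : Prop :=
  MemLp g 2 (faceMeasure τ) ∧
    ∃ φ : ℕ → E N → ℝ, (∀ k, ContDiff ℝ ∞ (φ k)) ∧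
      Tendsto (fun k => eLpNorm (φ k - w) 2 (volume.restrict Ω)) atTop (𝓝 0) ∧
      (∀ i, Tendsto (fun k => eLpNorm (classicalPartial i (φ k) - weakPartial Ω i w) 2
        (volume.restrict Ω)) atTop (𝓝 0)) ∧
      Tendsto (fun k => eLpNorm (φ k - g) 2 (faceMeasure τ)) atTop (𝓝 0)

/-- `n · ∇w`, with the weak gradient of `w ∈ H¹(Ω)`. -/
def normalDeriv (Ω : Set (E N)) (n : E N) (w : E N → ℝ) (x : E N) : ℝ :=
  ∑ i, n i * weakPartial Ω i w x

/-! ### The finite element space and the semi-discrete scheme -/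

/-- `v` coincides on the closed simplex `K` with the polynomial `p`. -/
def IsPolyOn (K : Finset (E N)) (v : E N → ℝ) (p : MvPolynomial (Fin N) ℝ) : Prop :=
  ∀ x ∈ simplex K, v x = MvPolynomial.eval (fun i => x i) p

/-- `S` is a conforming finite element space: a finite-dimensional space of functions in `H²_E(Ω)`
that are polynomials on each (closed) element. -/
def IsConformingSpace {Ω : Set (E N)} (𝒯 : Triangulation Ω) (S : Submodule ℝ (E N → ℝ)) : Prop :=
  FiniteDimensional ℝ S ∧
    ∀ v ∈ S, MemH2E Ω v ∧ ∀ K ∈ 𝒯.elements, ∃ p, IsPolyOn K v p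

/-- The local approximation property of the finite element space, with constant `c`. -/
def HasLocalInterpolant {Ω : Set (E N)} (𝒯 : Triangulation Ω) (S : Submodule ℝ (E N → ℝ))
    (c : ℝ) : Prop :=
  ∃ P : (E N → ℝ) → (E N → ℝ), ∀ ψ, MemH2E Ω ψ →
    P ψ ∈ S ∧
    ∀ K ∈ 𝒯.elements,
      l2Norm (volume.restrict (simplex K)) (ψ - P ψ)
        ≤ c * meshSize K ^ 2 * h2Norm Ω (𝒯.patch K) ψ ∧
      ∀ τ ∈ facesOf K,
        (∃ g, HasTrace Ω τ (ψ - P ψ) g ∧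
          l2Norm (faceMeasure τ) g
            ≤ c * meshSize τ ^ (3 / 2 : ℝ) * h2Norm Ω (𝒯.patch τ) ψ) ∧
        (∃ g, HasTrace Ω τ (normalDeriv Ω (outerNormal K τ) (ψ - P ψ)) g ∧
          l2Norm (faceMeasure τ) g
            ≤ c * meshSize τ ^ (1 / 2 : ℝ) * h2Norm Ω (𝒯.patch τ) ψ)

/-- `F` is a smooth double equal well potential taking its global minimum value `0` at `±1`. -/
def IsDoubleWell (F : ℝ → ℝ) : Prop :=
  ContDiff ℝ ∞ F ∧ (∀ s, 0 ≤ F s) ∧ F 1 = 0 ∧ F (-1) = 0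

/-- The time derivative `∂u/∂t` at time `t ∈ [0,T]`. -/
def timeDeriv (T : ℝ) (u : ℝ → E N → ℝ) (t : ℝ) (x : E N) : ℝ :=
  derivWithin (fun s => u s x) (Icc 0 T) t

/-- The residual `⟨r(t), ψ⟩ = ⟨∂u/∂t, ψ⟩ + ε (Δu, Δψ) + ε⁻¹ (∇f(u), ∇ψ)` with `f = F'`. -/
def feResidual (Ω : Set (E N)) (F : ℝ → ℝ) (ε T : ℝ) (u : ℝ → E N → ℝ) (t : ℝ)
    (ψ : E N → ℝ) : ℝ :=
  (∫ x in Ω, timeDeriv T u t x * ψ x)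
    + ε * (∫ x in Ω, weakLaplacian Ω (u t) x * weakLaplacian Ω ψ x)
    + ε⁻¹ * ∫ x in Ω, ∑ i, weakPartial Ω i (fun y => deriv F (u t y)) x * weakPartial Ω i ψ x

/-- `u : [0,T] → S` is a solution of the semi-discrete finite element scheme. -/
def IsSemidiscreteSolution (Ω : Set (E N)) (S : Submodule ℝ (E N → ℝ)) (F : ℝ → ℝ) (ε T : ℝ)
    (u : ℝ → E N → ℝ) : Prop :=
  (∀ t ∈ Icc 0 T, u t ∈ S) ∧
  (∀ t ∈ Icc 0 T, ∀ x ∈ closure Ω, DifferentiableWithinAt ℝ (fun s => u s x) (Icc 0 T) t) ∧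
  ∀ t ∈ Icc 0 T, ∀ ψ ∈ S, feResidual Ω F ε T u t ψ = 0

/-- The norm of a functional `r` on `H²_E(Ω)`:
`sup ⟨r, ψ⟩ / ‖ψ‖_{H²(Ω)}` over all `0 ≠ ψ ∈ H²_E(Ω)`, as an extended real. -/
def dualNorm (Ω : Set (E N)) (r : (E N → ℝ) → ℝ) : ℝ≥0∞ :=
  ⨆ ψ ∈ {ψ : E N → ℝ | MemH2E Ω ψ ∧ h2Norm Ω Ω ψ ≠ 0}, ENNReal.ofReal (r ψ / h2Norm Ω Ω ψ)

/-! ### The error estimator -/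

open Classical in
/-- The restriction `v|_K` of a piecewise polynomial `v` to the element `K`, as a polynomial
function on the whole space. -/
def restrictTo (K : Finset (E N)) (v : E N → ℝ) : E N → ℝ :=
  if h : ∃ p, IsPolyOn K v p then fun x => MvPolynomial.eval (fun i => x i) h.choose else 0

/-- The Laplacian of `v|_K`, up to the boundary of `K`. -/
def elementLaplacian (K : Finset (E N)) (v : E N → ℝ) : E N → ℝ :=
  Laplacian.laplacian (restrictTo K v)

/-- The element residual `R_K = ∂u/∂t + Δ(ε Δu - ε⁻¹ f(u))` on `K`. -/
def elementResidual (F : ℝ → ℝ) (ε T : ℝ) (u : ℝ → E N → ℝ) (t : ℝ) (K : Finset (E N))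
    (x : E N) : ℝ :=
  timeDeriv T u t x
    + Laplacian.laplacian
        (fun y => ε * elementLaplacian K (u t) y - ε⁻¹ * deriv F (restrictTo K (u t) y)) x

/-- `K'` is the neighbour of the element `K` across its face `τ`. -/
def IsNeighbour {Ω : Set (E N)} (𝒯 : Triangulation Ω) (K τ K' : Finset (E N)) : Prop :=
  K' ∈ 𝒯.elements ∧ K' ≠ K ∧ τ ⊆ K'

open Classical in
/-- The jump `J_τ` of `∇Δv · n` across the face `τ` of `K`: `(∇Δv|_{K'} - ∇Δv|_K) · n` on an
interior face `τ = K ∩ K'`, and `-2 ∇Δv|_K · n` on a boundary face. -/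
def jumpNormal {Ω : Set (E N)} (𝒯 : Triangulation Ω) (v : E N → ℝ) (K τ : Finset (E N))
    (x : E N) : ℝ :=
  if h : ∃ K', IsNeighbour 𝒯 K τ K' then
    fderiv ℝ (elementLaplacian h.choose v) x (outerNormal K τ)
      - fderiv ℝ (elementLaplacian K v) x (outerNormal K τ)
  else -2 * fderiv ℝ (elementLaplacian K v) x (outerNormal K τ)

open Classical in
/-- The jump `Ĵ_τ` of `Δv` across the face `τ` of `K`: `Δv|_K - Δv|_{K'}` on an interior face
`τ = K ∩ K'`, and `2 Δv|_K` on a boundary face. -/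
def jumpLaplacian {Ω : Set (E N)} (𝒯 : Triangulation Ω) (v : E N → ℝ) (K τ : Finset (E N))
    (x : E N) : ℝ :=
  if h : ∃ K', IsNeighbour 𝒯 K τ K' then
    elementLaplacian K v x - elementLaplacian h.choose v x
  else 2 * elementLaplacian K v x

/-- The local error estimator `η_K(t)`. -/
def estimator {Ω : Set (E N)} (𝒯 : Triangulation Ω) (F : ℝ → ℝ) (ε T : ℝ) (u : ℝ → E N → ℝ)
    (t : ℝ) (K : Finset (E N)) : ℝ :=
  meshSize K ^ 2 * l2Norm (volume.restrict (simplex K)) (elementResidual F ε T u t K)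
    + ∑ τ ∈ facesOf K,
        √(meshSize τ ^ 3 / 2 * l2Norm (faceMeasure τ) (jumpNormal 𝒯 (u t) K τ) ^ 2
          + meshSize τ / 2 * l2Norm (faceMeasure τ) (jumpLaplacian 𝒯 (u t) K τ) ^ 2)

end CahnHilliardFE

end

open CahnHilliardFE

open Set Filter Topology MeasureTheory
open scoped ENNReal ContDiff RealInnerProductSpace

noncomputable section

namespace CahnHilliardFE

variable {N : ℕ}

/-! The residual vanishes on the finite element space (Galerkin orthogonality), so `ψ` may be
replaced by the interpolation error `w = ψ - P ψ`. Two elementwise integrations by parts turn `ε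
(Δu, Δw)` into integrals of `Δ²u * w` over elements and integrals of the traces of `w` and of its
normal derivative over faces. An interior face is seen from both sides with opposite normals;
sharing the two contributions equally leaves half the jumps `J` and `Ĵ` on each side. On a boundary
face the factor 2 in the definition of the jump plays the role of the missing neighbour
(`Triangulation.sum_integral_green`). The nonlinear term leaves no face integrals: the Green
identity that encodes `∂u/∂n = 0`, applied to the test function `f'(u) φ`, already gives `(∇f(u),
∇φ) = -∑ ∫ Δf(u) φ` (`Triangulation.integral_comp`). Hence `feResidual_eq_sum`.

Cauchy-Schwarz and the interpolation estimates bound the contribution of `K` by `|c| ‖ψ‖_{H²(K̃)}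
η_K` (`abs_element_term_le`). A second Cauchy-Schwarz over `K` leaves `∑ ‖ψ‖²_{H²(K̃)}`, which
finite overlap of the patches controls: the angles at a vertex add up to at most the measure of the
unit sphere and each is at least the minimum angle, so boundedly many elements share a vertex
(`Triangulation.sum_h2Norm_patch_le`).

The analytic input is elementary. The divergence theorem on a simplex comes from integrating by
parts against smooth cutoffs of the barycentric coordinates (`integral_fderiv_simplex`). It yields a
trace inequality, so a trace does not depend on the approximating smooth sequence
(`H1Tendsto.tendsto_trace`), and Green's formulas pass from smooth functions to `w`. No density
theorem is involved: the smooth approximations of `w` and `∇w` are those contained in the trace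
hypotheses. Continuous piecewise smooth functions are Lipschitz, hence in `H¹`
(`IsPiecewiseSmooth.memH1`), which makes `f'(u) φ` admissible. -/

/-! ### Barycentric coordinates and their gradients -/

section Coordinates

variable {ι : Type*} (b : AffineBasis ι ℝ (E N))

/-- The gradient of a barycentric coordinate. -/
def coordGrad (i : ι) : E N :=
  (InnerProductSpace.toDual ℝ (E N)).symm (LinearMap.toContinuousLinearMap (b.coord i).linear)

lemma inner_coordGrad (i : ι) (v : E N) : ⟪coordGrad b i, v⟫ = (b.coord i).linear v := by
  simp [coordGrad, InnerProductSpace.toDual_symm_apply]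

lemma coord_add (i : ι) (x v : E N) : b.coord i (x + v) = b.coord i x + ⟪coordGrad b i, v⟫ := by
  rw [inner_coordGrad, add_comm x v, ← vadd_eq_add v x, AffineMap.map_vadd, vadd_eq_add, add_comm]

lemma inner_coordGrad_sub (i : ι) (x y : E N) :
    ⟪coordGrad b i, x - y⟫ = b.coord i x - b.coord i y := by
  have := coord_add b i y (x - y)
  rw [add_sub_cancel] at this
  linarith

lemma continuous_coord (i : ι) : Continuous (b.coord i) :=
  AffineMap.continuous_of_finiteDimensional _

lemma hasFDerivAt_coord (i : ι) (x : E N) :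
    HasFDerivAt (b.coord i) (innerSL ℝ (coordGrad b i)) x := by
  have h : (b.coord i : E N → ℝ) = fun y => b.coord i 0 + innerSL ℝ (coordGrad b i) y := by
    ext y
    simpa using coord_add b i 0 y
  rw [h]
  exact (innerSL ℝ (coordGrad b i)).hasFDerivAt.const_add _

lemma coordGrad_ne_zero {i j : ι} (h : i ≠ j) : coordGrad b i ≠ 0 := by
  intro h0
  have := inner_coordGrad_sub b i (b i) (b j)
  rw [h0, inner_zero_left, b.coord_apply_eq, b.coord_apply_ne h] at this
  norm_num at this

end Coordinates

/-! ### Fubini's theorem along a direction -/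

/-- Coordinates with respect to a unit vector `n` and its orthogonal complement. -/
lemma measurePreserving_layers (n p : E N) (hn : ‖n‖ = 1) :
    MeasurePreserving (fun q : ℝ × (ℝ ∙ n)ᗮ => p + q.1 • n + (q.2 : E N))
      (volume : Measure (ℝ × (ℝ ∙ n)ᗮ)) volume := by
  have h1 := ((ℝ ∙ n).measurePreserving_measurableEquivProd p).symm
  rw [InnerProductSpace.euclideanHausdorffMeasure_eq_volume] at h1
  have h2 := ((LinearIsometryEquiv.toSpanUnitSingleton (𝕜 := ℝ) n hn).measurePreserving).prod
    (MeasurePreserving.id (volume : Measure (ℝ ∙ n)ᗮ))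
  have h3 : (fun q : ℝ × (ℝ ∙ n)ᗮ => p + q.1 • n + (q.2 : E N)) =
      ((ℝ ∙ n).measurableEquivProd p).symm ∘
        Prod.map (LinearIsometryEquiv.toSpanUnitSingleton (𝕜 := ℝ) n hn) id := by
    ext1 q
    rw [Function.comp_apply, Submodule.measurableEquivProd_symm_apply]
    simp [add_comm, add_left_comm]
  rw [h3]
  exact h1.comp h2

lemma measurableEmbedding_layers (n p : E N) (hn : ‖n‖ = 1) :
    MeasurableEmbedding (fun q : ℝ × (ℝ ∙ n)ᗮ => p + q.1 • n + (q.2 : E N)) := by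
  have h2 : MeasurableEmbedding (Prod.map (LinearIsometryEquiv.toSpanUnitSingleton (𝕜 := ℝ) n hn)
      (id : (ℝ ∙ n)ᗮ → (ℝ ∙ n)ᗮ)) :=
    ((LinearIsometryEquiv.toSpanUnitSingleton (𝕜 := ℝ) n hn).toHomeomorph.prodCongr
      (Homeomorph.refl _)).measurableEmbedding
  have h3 := ((ℝ ∙ n).measurableEquivProd p).symm.measurableEmbedding.comp h2
  convert h3 using 1
  ext1 q
  rw [Function.comp_apply, Submodule.measurableEquivProd_symm_apply]
  simp [add_comm, add_left_comm]

lemma integral_layers (n p : E N) (hn : ‖n‖ = 1) {g : E N → ℝ} (hg : Integrable g) :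
    ∫ x, g x = ∫ s : ℝ, ∫ z : (ℝ ∙ n)ᗮ, g (p + s • n + z) := by
  have h := measurePreserving_layers n p hn
  rw [← h.integral_comp (measurableEmbedding_layers n p hn)]
  exact integral_prod _ ((h.integrable_comp_emb (measurableEmbedding_layers n p hn)).2 hg)

lemma finrank_orthogonal_span (n : E N) (hn : ‖n‖ = 1) :
    Module.finrank ℝ (ℝ ∙ n)ᗮ = N - 1 := by
  have h := (ℝ ∙ n).finrank_add_finrank_orthogonal
  rw [finrank_span_singleton (by rintro rfl; simp at hn), finrank_euclideanSpace_fin] at h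
  omega

/-- Isometries carry Hausdorff measure to Hausdorff measure on their range, and in the orthogonal
complement, of dimension `N - 1`, it is Lebesgue measure. This links the slices in Fubini's theorem
to `faceMeasure`. -/
lemma map_volume_hyperplane (n p : E N) (hn : ‖n‖ = 1) :
    Measure.map (fun z : (ℝ ∙ n)ᗮ => p + (z : E N)) volume =
      (Measure.euclideanHausdorffMeasure (N - 1)).restrict
        (range fun z : (ℝ ∙ n)ᗮ => p + (z : E N)) := by
  have hiso : Isometry (fun z : (ℝ ∙ n)ᗮ => p + (z : E N)) :=
    (IsometryEquiv.addLeft p).isometry.comp isometry_subtype_coe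
  rw [← hiso.map_euclideanHausdorffMeasure, ← finrank_orthogonal_span n hn,
    InnerProductSpace.euclideanHausdorffMeasure_eq_volume]

lemma measurableEmbedding_hyperplane (n p : E N) :
    MeasurableEmbedding (fun z : (ℝ ∙ n)ᗮ => p + (z : E N)) :=
  (MeasurableEquiv.addLeft p).measurableEmbedding.comp
    (MeasurableEmbedding.subtype_coe (Submodule.closed_of_finiteDimensional _).measurableSet)

lemma setIntegral_hyperplane (n p : E N) (hn : ‖n‖ = 1) (g : E N → ℝ) {A : Set (E N)}
    (hA : A ⊆ range fun z : (ℝ ∙ n)ᗮ => p + (z : E N)) :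
    ∫ x in A, g x ∂(Measure.euclideanHausdorffMeasure (N - 1)) =
      ∫ z in {z : (ℝ ∙ n)ᗮ | p + (z : E N) ∈ A}, g (p + z) := by
  have hem := measurableEmbedding_hyperplane n p
  have h := hem.setIntegral_map (μ := volume) g A
  rw [map_volume_hyperplane n p hn, Measure.restrict_restrict_of_subset hA] at h
  exact h

lemma mem_range_hyperplane (n p x : E N) :
    x ∈ range (fun z : (ℝ ∙ n)ᗮ => p + (z : E N)) ↔ ⟪n, x - p⟫ = 0 := by
  constructor
  · rintro ⟨z, rfl⟩
    simpa using (Submodule.mem_orthogonal_singleton_iff_inner_right).1 z.2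
  · intro h
    exact ⟨⟨x - p, Submodule.mem_orthogonal_singleton_iff_inner_right.2 h⟩, by simp⟩

/-! ### The divergence theorem on a simplex -/

/-- The point `z` shows that the zero set is a proper affine subspace, and those are null. -/
lemma volume_affineMap_zero {V : Type*} [NormedAddCommGroup V] [NormedSpace ℝ V]
    [FiniteDimensional ℝ V] [MeasurableSpace V] [BorelSpace V] (μ : Measure V) [μ.IsAddHaarMeasure]
    (f : V →ᵃ[ℝ] ℝ) {z : V} (hz : f z ≠ 0) : μ {x | f x = 0} = 0 := by
  have h := Measure.addHaar_affineSubspace μ ((affineSpan ℝ {(0 : ℝ)}).comap f) (by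
    intro h
    have : z ∈ (affineSpan ℝ {(0 : ℝ)}).comap f := h ▸ AffineSubspace.mem_top ℝ V z
    rw [AffineSubspace.mem_comap, AffineSubspace.mem_affineSpan_singleton] at this
    exact hz this)
  convert h using 2
  ext x
  simp

/-- The derivative of `Real.smoothTransition`, a bump of integral one on `(0, 1)`. -/
def bump (s : ℝ) : ℝ := deriv Real.smoothTransition s

lemma contDiff_smoothTransition : ContDiff ℝ ∞ Real.smoothTransition :=
  Real.smoothTransition.contDiff

lemma continuous_bump : Continuous bump :=
  contDiff_smoothTransition.continuous_deriv (by simp)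

lemma hasDerivAt_smoothTransition (s : ℝ) : HasDerivAt Real.smoothTransition (bump s) s :=
  (contDiff_smoothTransition.differentiable (by simp) s).hasDerivAt

/-- Such a point is a global minimum of the transition function, so Fermat's rule applies, at the
endpoint `0` as well. -/
lemma bump_of_nonpos {s : ℝ} (h : s ≤ 0) : bump s = 0 := by
  refine IsLocalMin.deriv_eq_zero (Filter.Eventually.of_forall fun t => ?_)
  rw [Real.smoothTransition.zero_of_nonpos h]
  exact Real.smoothTransition.nonneg t

lemma bump_of_one_le {s : ℝ} (h : 1 ≤ s) : bump s = 0 := by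
  refine IsLocalMax.deriv_eq_zero (Filter.Eventually.of_forall fun t => ?_)
  rw [Real.smoothTransition.one_of_one_le h]
  exact Real.smoothTransition.le_one t

lemma hasCompactSupport_bump : HasCompactSupport bump := by
  refine HasCompactSupport.of_support_subset_isCompact (K := Icc 0 1) isCompact_Icc fun s hs => ?_
  by_contra h
  rw [mem_Icc, not_and_or, not_le, not_le] at h
  rcases h with h | h
  · exact hs (bump_of_nonpos h.le)
  · exact hs (bump_of_one_le h.le)

lemma integral_bump : ∫ s, bump s = 1 := by
  have h1 : ∫ s, bump s = ∫ s in Ioc 0 1, bump s := by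
    refine (setIntegral_eq_integral_of_forall_compl_eq_zero fun s hs => ?_).symm
    rw [mem_Ioc, not_and_or, not_lt, not_le] at hs
    rcases hs with h | h
    · exact bump_of_nonpos h
    · exact bump_of_one_le h.le
  rw [h1, ← intervalIntegral.integral_of_le zero_le_one,
    intervalIntegral.integral_eq_sub_of_hasDerivAt (f := Real.smoothTransition)
      (fun s _ => hasDerivAt_smoothTransition s) (continuous_bump.intervalIntegrable _ _)]
  simp

section Divergence

variable {ι : Type*} [Fintype ι] (b : AffineBasis ι ℝ (E N))

/-- The face of a simplex on which the barycentric coordinate `i` vanishes. -/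
def coordFace (i : ι) : Set (E N) := {x | b.coord i x = 0 ∧ ∀ j, 0 ≤ b.coord j x}

lemma isCompact_nonneg_coord : IsCompact {x : E N | ∀ i, 0 ≤ b.coord i x} := by
  rw [← b.convexHull_eq_nonneg_coord]
  exact (finite_range b).isCompact_convexHull ℝ

variable [DecidableEq ι]

/-- Product of the cutoffs of all barycentric coordinates other than `i`. -/
def sideCutoff (i : ι) (r : ℝ) (x : E N) : ℝ :=
  ∏ j ∈ Finset.univ.erase i, Real.smoothTransition (r * b.coord j x)

lemma sideCutoff_nonneg (i : ι) (r : ℝ) (x : E N) : 0 ≤ sideCutoff b i r x :=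
  Finset.prod_nonneg fun _ _ => Real.smoothTransition.nonneg _

lemma sideCutoff_le_one (i : ι) (r : ℝ) (x : E N) : sideCutoff b i r x ≤ 1 :=
  Finset.prod_le_one (fun _ _ => Real.smoothTransition.nonneg _)
    fun _ _ => Real.smoothTransition.le_one _

omit [Fintype ι] [DecidableEq ι] in
lemma continuous_smoothTransition_coord (r : ℝ) (j : ι) :
    Continuous fun x => Real.smoothTransition (r * b.coord j x) :=
  contDiff_smoothTransition.continuous.comp (continuous_const.mul (continuous_coord b j))

lemma continuous_sideCutoff (i : ι) (r : ℝ) : Continuous (sideCutoff b i r) :=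
  continuous_finsetProd _ fun j _ => continuous_smoothTransition_coord b r j

lemma pos_of_smoothTransition_ne_zero {r y : ℝ} (hr : 0 < r)
    (h : Real.smoothTransition (r * y) ≠ 0) : 0 < y := by
  by_contra hy
  exact h (Real.smoothTransition.zero_of_nonpos
    (mul_nonpos_of_nonneg_of_nonpos hr.le (not_lt.1 hy)))

lemma coord_pos_of_sideCutoff_ne_zero {i : ι} {r : ℝ} (hr : 0 < r) {x : E N}
    (h : sideCutoff b i r x ≠ 0) {j : ι} (hj : j ≠ i) : 0 < b.coord j x :=
  pos_of_smoothTransition_ne_zero hr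
    (Finset.prod_ne_zero_iff.1 h j (Finset.mem_erase.2 ⟨hj, Finset.mem_univ j⟩))

/-- A positive coordinate is eventually scaled past `1`, where the transition is constant; a
negative one makes the product vanish. Only a zero coordinate is undecided, and `hy` excludes it. -/
lemma tendsto_sideCutoff {i : ι} {x : ℕ → E N} {y : E N} (hx : Tendsto x atTop (𝓝 y))
    (hy : ∀ j ≠ i, b.coord j y ≠ 0) :
    Tendsto (fun k : ℕ => sideCutoff b i (k + 1) (x k)) atTop
      (𝓝 ({x | ∀ j ≠ i, 0 < b.coord j x}.indicator (fun _ => 1) y)) := by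
  have hc : ∀ j, Tendsto (fun k => b.coord j (x k)) atTop (𝓝 (b.coord j y)) := fun j =>
    ((continuous_coord b j).tendsto y).comp hx
  have hk : Tendsto (fun k : ℕ => (k : ℝ) + 1) atTop atTop :=
    tendsto_atTop_add_const_right _ _ tendsto_natCast_atTop_atTop
  by_cases h : ∀ j ≠ i, 0 < b.coord j y
  · rw [indicator_of_mem (show y ∈ {x | ∀ j ≠ i, 0 < b.coord j x} from h)]
    have h1 : ∀ j ∈ Finset.univ.erase i, ∀ᶠ k : ℕ in atTop,
        Real.smoothTransition ((k + 1) * b.coord j (x k)) = 1 := by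
      intro j hj
      filter_upwards [(hk.atTop_mul_pos (h j (Finset.ne_of_mem_erase hj)) (hc j)).eventually_ge_atTop 1]
        with k hk using Real.smoothTransition.one_of_one_le hk
    refine tendsto_const_nhds.congr' ?_
    filter_upwards [(Filter.eventually_all_finset _).2 h1] with k hk
    exact (Finset.prod_eq_one fun j hj => hk j hj).symm
  · rw [indicator_of_notMem (show y ∉ {x | ∀ j ≠ i, 0 < b.coord j x} from h)]
    push Not at h
    obtain ⟨j, hj, hjy⟩ := h
    have hneg := lt_of_le_of_ne hjy (hy j hj)
    refine tendsto_const_nhds.congr' ?_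
    filter_upwards [(hc j).eventually_lt_const hneg] with k hk
    by_contra h0
    exact absurd (coord_pos_of_sideCutoff_ne_zero b (by positivity) (Ne.symm h0) hj) hk.not_gt

/-- On the slice at height `σ / ((k + 1) γ)` the `i`-th coordinate equals `σ / (k + 1)`, so the
slices approach the face as `k` grows. Where the cutoff is nonzero the point lies in the simplex,
which gives a bound uniform in `k` and `σ`. That bound serves dominated convergence twice: here in
`z`, and later in `σ`. -/
lemma tendsto_integral_sideCutoff (i : ι) {n p : E N} {γ : ℝ} (hγ : 0 < γ)
    (hn : ‖n‖ = 1) (hG : coordGrad b i = γ • n) (hp : b.coord i p = 0)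
    {φ : E N → ℝ} (hφ : Continuous φ) {M R : ℝ}
    (hM : ∀ x, (∀ j, 0 ≤ b.coord j x) → ‖φ x‖ ≤ M)
    (hR : ∀ x, (∀ j, 0 ≤ b.coord j x) → ‖x - p‖ ≤ R) {σ : ℝ} (hσ : 0 < σ) :
    (∀ k : ℕ, ‖∫ z : (ℝ ∙ n)ᗮ, φ (p + (((k + 1) * γ)⁻¹ * σ) • n + z) *
        sideCutoff b i (k + 1) (p + (((k + 1) * γ)⁻¹ * σ) • n + z)‖
          ≤ M * volume.real (Metric.closedBall (0 : (ℝ ∙ n)ᗮ) R)) ∧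
    Tendsto (fun k : ℕ => ∫ z : (ℝ ∙ n)ᗮ, φ (p + (((k + 1) * γ)⁻¹ * σ) • n + z) *
        sideCutoff b i (k + 1) (p + (((k + 1) * γ)⁻¹ * σ) • n + z)) atTop
      (𝓝 (∫ x in coordFace b i, φ x ∂(Measure.euclideanHausdorffMeasure (N - 1)))) := by
  have horth : ∀ z : (ℝ ∙ n)ᗮ, ⟪n, (z : E N)⟫ = 0 := fun z =>
    Submodule.mem_orthogonal_singleton_iff_inner_right.1 z.2
  have hci : ∀ (s : ℝ) (z : (ℝ ∙ n)ᗮ), b.coord i (p + s • n + z) = γ * s := by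
    intro s z
    rw [coord_add, coord_add, hp, hG, inner_smul_left, inner_smul_left, horth, inner_smul_right,
      real_inner_self_eq_norm_sq, hn]
    simp
  have hM0 : 0 ≤ M := (norm_nonneg _).trans (hM (b i) fun j => by
    by_cases h : j = i
    · rw [h, b.coord_apply_eq]; norm_num
    · rw [b.coord_apply_ne h])
  have hbound : ∀ (k : ℕ) (z : (ℝ ∙ n)ᗮ), ‖φ (p + (((k + 1) * γ)⁻¹ * σ) • n + z) *
        sideCutoff b i (k + 1) (p + (((k + 1) * γ)⁻¹ * σ) • n + z)‖ ≤
      (Metric.closedBall (0 : (ℝ ∙ n)ᗮ) R).indicator (fun _ => M) z := by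
    intro k z
    set s := ((k + 1) * γ)⁻¹ * σ with hs
    have hspos : 0 < s := by positivity
    by_cases h0 : sideCutoff b i (k + 1) (p + s • n + z) = 0
    · rw [h0, mul_zero, norm_zero]
      exact indicator_nonneg (fun _ _ => hM0) _
    · have hmem : ∀ j, 0 ≤ b.coord j (p + s • n + z) := by
        intro j
        by_cases hj : j = i
        · rw [hj, hci]; positivity
        · exact (coord_pos_of_sideCutoff_ne_zero b (by positivity) h0 hj).le
      have hz : ‖(z : E N)‖ ≤ R := by
        refine le_trans ?_ (hR _ hmem)
        have h1 : p + s • n + (z : E N) - p = s • n + z := by abel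
        have h2 := norm_add_sq_eq_norm_sq_add_norm_sq_of_inner_eq_zero (s • n) (z : E N)
          (by rw [inner_smul_left, horth]; simp)
        rw [h1]
        nlinarith [norm_nonneg (s • n + (z : E N)), norm_nonneg (z : E N), norm_nonneg (s • n)]
      rw [indicator_of_mem (by simpa using hz), norm_mul]
      have h3 : ‖sideCutoff b i (k + 1) (p + s • n + z)‖ ≤ 1 := by
        rw [Real.norm_of_nonneg (sideCutoff_nonneg b i _ _)]
        exact sideCutoff_le_one b i _ _
      calc _ ≤ M * 1 := by gcongr; exact hM _ hmem
        _ = M := mul_one M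
  have hbint : Integrable ((Metric.closedBall (0 : (ℝ ∙ n)ᗮ) R).indicator fun _ => M) volume :=
    (integrable_indicator_iff Metric.isClosed_closedBall.measurableSet).2
      (integrableOn_const (isCompact_closedBall (0 : (ℝ ∙ n)ᗮ) R).measure_lt_top.ne)
  refine ⟨fun k => ?_, ?_⟩
  · refine (norm_integral_le_of_norm_le hbint (Filter.Eventually.of_forall (hbound k))).trans ?_
    rw [integral_indicator Metric.isClosed_closedBall.measurableSet, setIntegral_const,
      smul_eq_mul, mul_comm]
  · have hsub : coordFace b i ⊆ range fun z : (ℝ ∙ n)ᗮ => p + (z : E N) := by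
      intro x hx
      rw [mem_range_hyperplane]
      have h1 := inner_coordGrad_sub b i x p
      rw [hx.1, hp, hG, inner_smul_left, sub_zero] at h1
      exact (mul_eq_zero.1 h1).resolve_left (by simpa using hγ.ne')
    rw [setIntegral_hyperplane n p hn φ hsub]
    -- The coordinate `j` equals `1` at the vertex `b j`, which lies in the hyperplane, so its zero
    -- set there is null. Boundary points of the face may therefore be ignored.
    have hnull : ∀ᵐ z : (ℝ ∙ n)ᗮ, ∀ j ≠ i, b.coord j (p + z) ≠ 0 := by
      rw [ae_all_iff]
      intro j
      by_cases hj : j = i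
      · simp [hj]
      have hmem : b j - p ∈ (ℝ ∙ n)ᗮ := by
        rw [Submodule.mem_orthogonal_singleton_iff_inner_right]
        have h1 := inner_coordGrad_sub b i (b j) p
        rw [b.coord_apply_ne (Ne.symm hj), hp, hG, inner_smul_left, sub_zero] at h1
        exact (mul_eq_zero.1 h1).resolve_left (by simpa using hγ.ne')
      let f : (ℝ ∙ n)ᗮ →ᵃ[ℝ] ℝ := (b.coord j).comp
        (AffineMap.const ℝ _ p + (ℝ ∙ n)ᗮ.subtype.toAffineMap)
      have hf : ∀ z : (ℝ ∙ n)ᗮ, f z = b.coord j (p + z) := fun z => rfl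
      have h2 : volume {z : (ℝ ∙ n)ᗮ | f z = 0} = 0 :=
        volume_affineMap_zero volume f (z := ⟨b j - p, hmem⟩) (by simp [hf])
      have h3 : ∀ᵐ z : (ℝ ∙ n)ᗮ, f z ≠ 0 := by
        rw [ae_iff]
        simpa using h2
      filter_upwards [h3] with z hz _ using hz
    have hmeas : MeasurableSet {z : (ℝ ∙ n)ᗮ | ∀ j ≠ i, 0 < b.coord j (p + z)} := by
      have : {z : (ℝ ∙ n)ᗮ | ∀ j ≠ i, 0 < b.coord j (p + z)} =
          ⋂ j, ⋂ (_ : j ≠ i), {z : (ℝ ∙ n)ᗮ | 0 < b.coord j (p + z)} := by ext; simp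
      rw [this]
      exact MeasurableSet.iInter fun j => MeasurableSet.iInter fun _ =>
        (isOpen_lt continuous_const ((continuous_coord b j).comp (by fun_prop))).measurableSet
    have hset : ({z : (ℝ ∙ n)ᗮ | p + (z : E N) ∈ coordFace b i} : Set (ℝ ∙ n)ᗮ) =ᵐ[volume]
        {z : (ℝ ∙ n)ᗮ | ∀ j ≠ i, 0 < b.coord j (p + z)} := by
      filter_upwards [hnull] with z hz
      refine propext ⟨fun h j hj => lt_of_le_of_ne (h.2 j) (hz j hj).symm, fun h => ?_⟩
      have h0 : b.coord i (p + z) = 0 := by simpa using hci 0 z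
      refine ⟨h0, fun j => ?_⟩
      by_cases hj : j = i
      · rw [hj, h0]
      · exact (h j hj).le
    rw [setIntegral_congr_set hset, ← integral_indicator hmeas]
    refine tendsto_integral_of_dominated_convergence _ (fun k => ?_) hbint
      (fun k => Filter.Eventually.of_forall (hbound k)) ?_
    · refine Continuous.aestronglyMeasurable ?_
      have hc : Continuous fun z : (ℝ ∙ n)ᗮ => p + (((k + 1 : ℝ) * γ)⁻¹ * σ) • n + (z : E N) := by
        fun_prop
      exact (hφ.comp hc).mul ((continuous_sideCutoff b i _).comp hc)
    · filter_upwards [hnull] with z hz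
      have hk : Tendsto (fun k : ℕ => (((k + 1 : ℝ) * γ)⁻¹ * σ)) atTop (𝓝 0) := by
        have h1 : Tendsto (fun k : ℕ => (k : ℝ) + 1) atTop atTop :=
          tendsto_atTop_add_const_right _ _ tendsto_natCast_atTop_atTop
        simpa using (tendsto_inv_atTop_zero.comp (h1.atTop_mul_const hγ)).mul_const σ
      have hx : Tendsto (fun k : ℕ => p + (((k + 1 : ℝ) * γ)⁻¹ * σ) • n + (z : E N)) atTop
          (𝓝 (p + z)) := by
        simpa using ((hk.smul_const n).const_add p).add_const (z : E N)
      have h1 := ((hφ.tendsto _).comp hx).mul (tendsto_sideCutoff b hx hz)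
      have heq : {z : (ℝ ∙ n)ᗮ | ∀ j ≠ i, 0 < b.coord j (p + z)}.indicator
          (fun z => φ (p + z)) z = φ (p + z) *
            {x | ∀ j ≠ i, 0 < b.coord j x}.indicator (fun _ => 1) (p + (z : E N)) := by
        by_cases h : ∀ j ≠ i, 0 < b.coord j (p + z)
        · rw [indicator_of_mem (by exact h), indicator_of_mem (by exact h), mul_one]
        · rw [indicator_of_notMem (by exact h), indicator_of_notMem (by exact h), mul_zero]
      rw [heq]
      exact h1

end Divergence

section DivergenceTheorem

variable {ι : Type*} [Fintype ι] (b : AffineBasis ι ℝ (E N)) [DecidableEq ι]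

lemma hasCompactSupport_bump_sideCutoff (i : ι) {r : ℝ} (hr : 0 < r) (φ : E N → ℝ) :
    HasCompactSupport fun x => φ x * (r * bump (r * b.coord i x) * sideCutoff b i r x) := by
  refine HasCompactSupport.of_support_subset_isCompact (isCompact_nonneg_coord b) fun x hx j => ?_
  have h1 := right_ne_zero_of_mul (Function.mem_support.1 hx)
  by_cases hj : j = i
  · have h2 := right_ne_zero_of_mul (left_ne_zero_of_mul h1)
    by_contra h
    rw [hj, not_le] at h
    exact h2 (bump_of_nonpos (mul_nonpos_of_nonneg_of_nonpos hr.le h.le))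
  · exact (coord_pos_of_sideCutoff_ne_zero b hr (right_ne_zero_of_mul h1) hj).le

lemma continuous_bump_sideCutoff (i : ι) (r : ℝ) {φ : E N → ℝ} (hφ : Continuous φ) :
    Continuous fun x => φ x * (r * bump (r * b.coord i x) * sideCutoff b i r x) :=
  hφ.mul ((continuous_const.mul (continuous_bump.comp
    (continuous_const.mul (continuous_coord b i)))).mul (continuous_sideCutoff b i r))

/-- The factor `r * bump (r * λᵢ)` is an approximate identity across the face `λᵢ = 0`. In the
normal direction `λᵢ` has slope `γ = ‖coordGrad b i‖`, so the substitution `σ = r γ s` leaves `γ⁻¹ *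
bump σ`, of mass `γ⁻¹`, times the slice integrals. -/
lemma tendsto_integral_bump_sideCutoff [Nontrivial ι] (i : ι) {φ : E N → ℝ} (hφ : Continuous φ) :
    Tendsto (fun k : ℕ => ∫ x, φ x * ((k + 1) * bump ((k + 1) * b.coord i x)
        * sideCutoff b i (k + 1) x)) atTop
      (𝓝 (‖coordGrad b i‖⁻¹ *
        ∫ x in coordFace b i, φ x ∂(Measure.euclideanHausdorffMeasure (N - 1)))) := by
  obtain ⟨j₀, hj₀⟩ := exists_ne i
  set γ := ‖coordGrad b i‖ with hγdef
  have hγ : 0 < γ := norm_pos_iff.2 (coordGrad_ne_zero b (Ne.symm hj₀))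
  obtain ⟨n, hndef⟩ : ∃ n, n = γ⁻¹ • coordGrad b i := ⟨_, rfl⟩
  have hn : ‖n‖ = 1 := by
    rw [hndef, norm_smul, norm_inv, Real.norm_of_nonneg hγ.le, ← hγdef, inv_mul_cancel₀ hγ.ne']
  have hG : coordGrad b i = γ • n := by rw [hndef, smul_inv_smul₀ hγ.ne']
  set p := b j₀ with hpdef
  have hp : b.coord i p = 0 := b.coord_apply_ne (Ne.symm hj₀)
  obtain ⟨M, hM⟩ := (isCompact_nonneg_coord b).exists_bound_of_continuousOn hφ.continuousOn
  obtain ⟨R, hR⟩ := (isCompact_nonneg_coord b).exists_bound_of_continuousOn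
    (f := fun x => x - p) (by fun_prop)
  set A := ∫ x in coordFace b i, φ x ∂(Measure.euclideanHausdorffMeasure (N - 1))
  set B := M * volume.real (Metric.closedBall (0 : (ℝ ∙ n)ᗮ) R)
  set J : ℕ → ℝ → ℝ := fun k σ => ∫ z : (ℝ ∙ n)ᗮ, φ (p + (((k + 1) * γ)⁻¹ * σ) • n + z) *
        sideCutoff b i (k + 1) (p + (((k + 1) * γ)⁻¹ * σ) • n + z) with hJ
  have hlim := fun {σ : ℝ} (hσ : 0 < σ) =>
    tendsto_integral_sideCutoff b i hγ hn hG hp hφ hM hR hσ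
  have hrepr : ∀ k : ℕ, ∫ x, φ x * ((k + 1) * bump ((k + 1) * b.coord i x)
        * sideCutoff b i (k + 1) x) = γ⁻¹ * ∫ σ, bump σ * J k σ := by
    intro k
    have hk : (0 : ℝ) < k + 1 := by positivity
    have ha : 0 < ((k + 1) * γ)⁻¹ := by positivity
    rw [integral_layers n p hn ((continuous_bump_sideCutoff b i _ hφ).integrable_of_hasCompactSupport
      (hasCompactSupport_bump_sideCutoff b i hk φ))]
    have h1 := Measure.integral_comp_mul_left (fun s : ℝ => ∫ z : (ℝ ∙ n)ᗮ,
      φ (p + s • n + z) * ((k + 1) * bump ((k + 1) * b.coord i (p + s • n + z))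
        * sideCutoff b i (k + 1) (p + s • n + z))) (((k + 1) * γ)⁻¹)
    rw [smul_eq_mul, inv_inv, abs_of_pos (by positivity)] at h1
    rw [eq_comm, ← mul_right_inj' (by positivity : ((k + 1) * γ) ≠ 0), ← h1, ← integral_const_mul,
      ← integral_const_mul]
    refine integral_congr_ae (Filter.Eventually.of_forall fun σ => ?_)
    simp only [hJ]
    rw [← integral_const_mul, ← integral_const_mul, ← integral_const_mul]
    refine integral_congr_ae (Filter.Eventually.of_forall fun z => ?_)
    simp only
    have hci : b.coord i (p + (((k + 1) * γ)⁻¹ * σ) • n + z) = γ * (((k + 1) * γ)⁻¹ * σ) := by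
      rw [coord_add, coord_add, hp, hG, inner_smul_left, inner_smul_left,
        Submodule.mem_orthogonal_singleton_iff_inner_right.1 z.2, inner_smul_right,
        real_inner_self_eq_norm_sq, hn]
      simp
    have h2 : (k + 1) * (γ * (((k + 1) * γ)⁻¹ * σ)) = σ := by field_simp
    rw [hci, h2]
    field_simp
  simp_rw [hrepr]
  refine Tendsto.const_mul _ ?_
  have hA : A = ∫ σ, bump σ * A := by rw [integral_mul_const, integral_bump, one_mul]
  rw [hA]
  refine tendsto_integral_of_dominated_convergence (fun σ => ‖bump σ‖ * B) (fun k => ?_) ?_ ?_ ?_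
  · refine continuous_bump.aestronglyMeasurable.mul (StronglyMeasurable.aestronglyMeasurable ?_)
    refine StronglyMeasurable.integral_prod_right (f := fun (σ : ℝ) (z : (ℝ ∙ n)ᗮ) =>
      φ (p + (((k + 1) * γ)⁻¹ * σ) • n + z) *
        sideCutoff b i (k + 1) (p + (((k + 1) * γ)⁻¹ * σ) • n + z)) ?_
    refine Continuous.stronglyMeasurable ?_
    have hc : Continuous fun q : ℝ × (ℝ ∙ n)ᗮ =>
      p + (((k + 1 : ℝ) * γ)⁻¹ * q.1) • n + (q.2 : E N) := by fun_prop
    exact (hφ.comp hc).mul ((continuous_sideCutoff b i _).comp hc)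
  · exact (continuous_bump.integrable_of_hasCompactSupport hasCompactSupport_bump).norm.mul_const _
  · refine fun k => Filter.Eventually.of_forall fun σ => ?_
    by_cases hσ : 0 < σ
    · rw [norm_mul]
      gcongr
      exact (hlim hσ).1 k
    · simp [bump_of_nonpos (not_lt.1 hσ)]
  · refine Filter.Eventually.of_forall fun σ => ?_
    by_cases hσ : 0 < σ
    · exact (hlim hσ).2.const_mul _
    · simp [bump_of_nonpos (not_lt.1 hσ)]

/-- Product of the cutoffs of all barycentric coordinates. -/
def fullCutoff (r : ℝ) (x : E N) : ℝ := ∏ j, Real.smoothTransition (r * b.coord j x)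

lemma hasFDerivAt_fullCutoff (r : ℝ) (x : E N) :
    HasFDerivAt (fullCutoff b r)
      (∑ i, sideCutoff b i r x • (r * bump (r * b.coord i x)) • innerSL ℝ (coordGrad b i)) x := by
  refine HasFDerivAt.finsetProd fun i _ => ?_
  have h1 := (hasDerivAt_smoothTransition (r * b.coord i x)).comp_hasFDerivAt x
    ((hasFDerivAt_coord b i x).const_mul r)
  rw [mul_smul, smul_comm]
  exact h1

lemma fderiv_fullCutoff (r : ℝ) (x v : E N) :
    fderiv ℝ (fullCutoff b r) x v =
      ∑ i, ⟪coordGrad b i, v⟫ * (r * bump (r * b.coord i x) * sideCutoff b i r x) := by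
  rw [(hasFDerivAt_fullCutoff b r x).fderiv, sum_apply]
  refine Finset.sum_congr rfl fun i _ => ?_
  simp only [smul_apply, innerSL_apply_apply, smul_eq_mul]
  ring

omit [DecidableEq ι] in
lemma coord_pos_of_fullCutoff_ne_zero {r : ℝ} (hr : 0 < r) {x : E N}
    (h : fullCutoff b r x ≠ 0) (j : ι) : 0 < b.coord j x :=
  pos_of_smoothTransition_ne_zero hr (Finset.prod_ne_zero_iff.1 h j (Finset.mem_univ j))

omit [Fintype ι] [DecidableEq ι] in
lemma volume_coord_eq_zero (i : ι) : volume {x : E N | b.coord i x = 0} = 0 :=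
  volume_affineMap_zero volume (b.coord i) (z := b i) (by simp)

omit [DecidableEq ι] in
lemma ae_coord_ne_zero : ∀ᵐ x : E N, ∀ i, b.coord i x ≠ 0 := by
  rw [ae_all_iff]
  intro i
  rw [ae_iff]
  simpa using volume_coord_eq_zero b i

-- The cutoffs converge to the indicator of the simplex off the zero sets of the coordinates, and
-- they are dominated by that indicator.
omit [DecidableEq ι] in
lemma tendsto_integral_fullCutoff {g : E N → ℝ} (hg : Continuous g) :
    Tendsto (fun k : ℕ => ∫ x, fullCutoff b (k + 1) x * g x) atTop
      (𝓝 (∫ x in {x | ∀ i, 0 ≤ b.coord i x}, g x)) := by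
  have hK := isCompact_nonneg_coord b
  rw [← integral_indicator hK.measurableSet]
  refine tendsto_integral_of_dominated_convergence
    ({x | ∀ i, 0 ≤ b.coord i x}.indicator fun x => ‖g x‖) (fun k => ?_) ?_ (fun k => ?_) ?_
  · refine Continuous.aestronglyMeasurable (Continuous.mul ?_ hg)
    exact continuous_finsetProd _ fun j _ => continuous_smoothTransition_coord b _ j
  · rw [integrable_indicator_iff hK.measurableSet]
    exact hg.norm.continuousOn.integrableOn_compact hK
  · refine Filter.Eventually.of_forall fun x => ?_
    by_cases h : fullCutoff b (k + 1) x = 0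
    · rw [h, zero_mul, norm_zero]
      exact indicator_nonneg (fun _ _ => norm_nonneg _) _
    · rw [indicator_of_mem (show x ∈ {x | ∀ i, 0 ≤ b.coord i x} from fun j =>
        (coord_pos_of_fullCutoff_ne_zero b (by positivity) h j).le), norm_mul]
      refine mul_le_of_le_one_left (norm_nonneg _) ?_
      rw [fullCutoff, Real.norm_of_nonneg
        (Finset.prod_nonneg fun _ _ => Real.smoothTransition.nonneg _)]
      exact Finset.prod_le_one (fun _ _ => Real.smoothTransition.nonneg _)
        fun _ _ => Real.smoothTransition.le_one _
  · filter_upwards [ae_coord_ne_zero b] with x hx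
    by_cases h : ∀ i, 0 ≤ b.coord i x
    · rw [indicator_of_mem (by exact h)]
      have hk : Tendsto (fun k : ℕ => (k : ℝ) + 1) atTop atTop :=
        tendsto_atTop_add_const_right _ _ tendsto_natCast_atTop_atTop
      have h1 : ∀ j ∈ (Finset.univ : Finset ι), ∀ᶠ k : ℕ in atTop,
          Real.smoothTransition ((k + 1) * b.coord j x) = 1 := by
        intro j _
        filter_upwards [(hk.atTop_mul_const (lt_of_le_of_ne (h j) (hx j).symm)).eventually_ge_atTop 1]
          with k hk using Real.smoothTransition.one_of_one_le hk
      refine tendsto_const_nhds.congr' ?_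
      filter_upwards [(Filter.eventually_all_finset _).2 h1] with k hk
      rw [fullCutoff, Finset.prod_eq_one fun j hj => hk j hj, one_mul]
    · rw [indicator_of_notMem (by exact h)]
      refine tendsto_const_nhds.congr fun k => ?_
      by_contra h0
      exact h fun j => (coord_pos_of_fullCutoff_ne_zero b (by positivity)
        (left_ne_zero_of_mul (Ne.symm h0)) j).le

/-- The divergence theorem on a simplex, for a constant direction `v`. -/
theorem integral_fderiv_simplex [Nontrivial ι] {φ : E N → ℝ} (hφ : ContDiff ℝ 1 φ) (v : E N) :
    ∫ x in {x | ∀ i, 0 ≤ b.coord i x}, fderiv ℝ φ x v =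
      -∑ i, ⟪coordGrad b i, v⟫ * (‖coordGrad b i‖⁻¹ *
        ∫ x in coordFace b i, φ x ∂(Measure.euclideanHausdorffMeasure (N - 1))) := by
  have hφ' : Continuous fun x => fderiv ℝ φ x v := (hφ.continuous_fderiv (by simp)).clm_apply
    continuous_const
  -- The integral of `fullCutoff * ∂φ` is evaluated in the limit twice: directly, and after moving
  -- the derivative onto the cutoff, whose gradient concentrates on the faces.
  have h1 := tendsto_integral_fullCutoff b hφ'
  have h2 : Tendsto (fun k : ℕ => -∑ i, ⟪coordGrad b i, v⟫ * ∫ x, φ x * ((k + 1) *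
      bump ((k + 1) * b.coord i x) * sideCutoff b i (k + 1) x)) atTop
      (𝓝 (-∑ i, ⟪coordGrad b i, v⟫ * (‖coordGrad b i‖⁻¹ *
        ∫ x in coordFace b i, φ x ∂(Measure.euclideanHausdorffMeasure (N - 1))))) :=
    (tendsto_finsetSum _ fun i _ => (tendsto_integral_bump_sideCutoff b i hφ.continuous).const_mul _).neg
  refine tendsto_nhds_unique h1 (h2.congr fun k => ?_)
  have hk : (0 : ℝ) < k + 1 := by positivity
  have hint : ∀ i, Integrable fun x => φ x * ((k + 1) *
      bump ((k + 1) * b.coord i x) * sideCutoff b i (k + 1) x) := fun i =>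
    (continuous_bump_sideCutoff b i _ hφ.continuous).integrable_of_hasCompactSupport
      (hasCompactSupport_bump_sideCutoff b i hk φ)
  have hχs : HasCompactSupport (fullCutoff b (k + 1 : ℝ)) :=
    HasCompactSupport.of_support_subset_isCompact (isCompact_nonneg_coord b) fun x hx j =>
      (coord_pos_of_fullCutoff_ne_zero b hk hx j).le
  have hχ : Continuous (fullCutoff b (k + 1 : ℝ)) :=
    continuous_finsetProd _ fun j _ => continuous_smoothTransition_coord b _ j
  have hexp : ∀ x, fderiv ℝ (fullCutoff b (k + 1 : ℝ)) x v * φ x = ∑ i, ⟪coordGrad b i, v⟫ *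
      (φ x * ((k + 1) * bump ((k + 1) * b.coord i x) * sideCutoff b i (k + 1) x)) := by
    intro x
    rw [fderiv_fullCutoff, Finset.sum_mul]
    exact Finset.sum_congr rfl fun i _ => by ring
  rw [integral_mul_fderiv_eq_neg_fderiv_mul_of_integrable]
  · simp_rw [hexp]
    rw [integral_finsetSum _ fun i _ => (hint i).const_mul _]
    simp_rw [integral_const_mul]
  · simp_rw [hexp]
    exact integrable_finsetSum _ fun i _ => (hint i).const_mul _
  · exact (hχ.mul hφ').integrable_of_hasCompactSupport hχs.mul_right
  · exact (hχ.mul hφ.continuous).integrable_of_hasCompactSupport hχs.mul_right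
  · exact fun x _ => (hasFDerivAt_fullCutoff b _ x).differentiableAt
  · exact fun x _ => hφ.differentiable (by simp) x

end DivergenceTheorem

/-! ### Elements of a mesh -/

/-- `K` is the vertex set of a nondegenerate `N`-dimensional simplex. -/
def IsElement (K : Finset (E N)) : Prop :=
  AffineIndependent ℝ ((↑) : K → E N) ∧ K.card = N + 1

lemma Triangulation.isElement {Ω : Set (E N)} (𝒯 : Triangulation Ω) {K : Finset (E N)}
    (hK : K ∈ 𝒯.elements) : IsElement K := by
  rw [Triangulation.elements, Finset.mem_filter, Set.Finite.mem_toFinset] at hK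
  exact ⟨𝒯.complex.indep hK.1, hK.2⟩

section Element

variable {K : Finset (E N)}

/-- The vertices of an element as an affine basis. -/
def IsElement.basis (h : IsElement K) : AffineBasis K ℝ (E N) :=
  ⟨(↑), h.1, h.1.affineSpan_eq_top_iff_card_eq_finrank_add_one.2 (by simp [h.2])⟩

@[simp] lemma IsElement.basis_apply (h : IsElement K) (a : K) : h.basis a = a := rfl

lemma IsElement.nontrivial (h : IsElement K) (hN : 0 < N) : Nontrivial K := by
  have : 1 < K.card := by rw [h.2]; omega
  obtain ⟨a, ha, c, hc, hac⟩ := Finset.one_lt_card.1 this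
  exact ⟨⟨a, ha⟩, ⟨c, hc⟩, fun h => hac (congrArg Subtype.val h)⟩

lemma IsElement.simplex_eq (h : IsElement K) :
    simplex K = {x | ∀ a, 0 ≤ h.basis.coord a x} := by
  rw [← h.basis.convexHull_eq_nonneg_coord, simplex]
  congr 1
  ext x
  simp

lemma isCompact_simplex (s : Finset (E N)) : IsCompact (simplex s) :=
  s.finite_toSet.isCompact_convexHull ℝ

lemma measurableSet_simplex (s : Finset (E N)) : MeasurableSet (simplex s) :=
  (isCompact_simplex s).measurableSet

lemma convex_simplex (s : Finset (E N)) : Convex ℝ (simplex s) := convex_convexHull ℝ _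

lemma simplex_mono {s t : Finset (E N)} (h : s ⊆ t) : simplex s ⊆ simplex t :=
  convexHull_mono (by exact_mod_cast h)

lemma subset_simplex {s : Finset (E N)} {x : E N} (h : x ∈ s) : x ∈ simplex s :=
  subset_convexHull ℝ _ h

lemma IsElement.sum_coord_smul (h : IsElement K) (x : E N) :
    ∑ a, h.basis.coord a x • (a : E N) = x :=
  h.basis.linear_combination_coord_eq_self x

lemma IsElement.coord_vertex (h : IsElement K) (a : K) {x : E N} (hx : x ∈ K) :
    h.basis.coord a x = if x = a then 1 else 0 := by
  have h1 := h.basis.coord_apply a ⟨x, hx⟩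
  rw [h.basis_apply] at h1
  rw [h1]
  simp [Subtype.ext_iff, eq_comm]

lemma IsElement.simplex_erase (h : IsElement K) (a : K) :
    simplex (K.erase a) = coordFace h.basis a := by
  apply subset_antisymm
  · refine convexHull_min (fun x hx => ?_) ?_
    · have hx' : x ∈ K.erase a := hx
      rw [Finset.mem_erase] at hx'
      refine ⟨by rw [h.coord_vertex a hx'.2, if_neg hx'.1], fun j => ?_⟩
      rw [h.coord_vertex j hx'.2]
      split_ifs <;> norm_num
    · have h1 : coordFace h.basis a = simplex K ∩ {x | h.basis.coord a x = 0} := by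
        rw [h.simplex_eq]; ext x; exact and_comm
      rw [h1]
      refine (convex_simplex K).inter ?_
      exact (convex_singleton (0 : ℝ)).affine_preimage (h.basis.coord a)
  · rintro x ⟨hx0, hx⟩
    rw [← h.sum_coord_smul x]
    have h2 : ∀ s : Finset K, a ∈ s → ∑ c ∈ s, h.basis.coord c x • (c : E N) =
        ∑ c ∈ s.erase a, h.basis.coord c x • (c : E N) := fun s hs => by
      rw [← Finset.add_sum_erase _ _ hs, hx0, zero_smul, zero_add]
    rw [h2 _ (Finset.mem_univ a)]
    refine (convex_convexHull ℝ _).sum_mem (fun c _ => hx c) ?_ fun c hc => ?_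
    · have h3 := h.basis.sum_coord_apply_eq_one x
      rw [← Finset.add_sum_erase _ _ (Finset.mem_univ a), hx0, zero_add] at h3
      exact h3
    · refine subset_convexHull ℝ _ ?_
      simp only [Finset.coe_erase, Set.mem_sdiff, Set.mem_singleton_iff, Finset.mem_coe]
      exact ⟨c.2, fun hca => Finset.ne_of_mem_erase hc (Subtype.ext hca)⟩

lemma IsElement.erase_mem_facesOf (h : IsElement K) (a : K) : K.erase a ∈ facesOf K := by
  rw [facesOf, Finset.mem_powersetCard, Finset.card_erase_of_mem a.2, h.2]
  exact ⟨Finset.erase_subset _ _, rfl⟩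

lemma IsElement.exists_eq_erase (h : IsElement K) {τ : Finset (E N)} (hτ : τ ∈ facesOf K) :
    ∃ a : K, τ = K.erase a := by
  rw [facesOf, Finset.mem_powersetCard] at hτ
  have h1 : (K \ τ).card = 1 := by
    rw [Finset.card_sdiff_of_subset hτ.1, h.2, hτ.2]; omega
  obtain ⟨a, ha⟩ := Finset.card_eq_one.1 h1
  have haK : a ∈ K ∧ a ∉ τ := by
    rw [← Finset.mem_sdiff, ha]; exact Finset.mem_singleton_self a
  refine ⟨⟨a, haK.1⟩, ?_⟩
  rw [Finset.erase_eq, ← ha, Finset.sdiff_sdiff_eq_self hτ.1]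

lemma IsElement.sum_facesOf (h : IsElement K) (g : Finset (E N) → ℝ) :
    ∑ τ ∈ facesOf K, g τ = ∑ a : K, g (K.erase a) := by
  refine (Finset.sum_bij (fun (a : K) _ => K.erase a) (fun a _ => h.erase_mem_facesOf a)
    (fun a _ c _ hac => ?_) (fun τ hτ => ?_) fun _ _ => rfl).symm
  · by_contra hne
    have h1 : (a : E N) ∈ K.erase c :=
      Finset.mem_erase.2 ⟨fun h => hne (Subtype.ext h), a.2⟩
    rw [← hac] at h1
    exact Finset.notMem_erase _ _ h1
  · obtain ⟨a, rfl⟩ := h.exists_eq_erase hτ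
    exact ⟨a, Finset.mem_univ a, rfl⟩

/-- The vertices span affinely, so `d` is orthogonal to every `x - y`, in particular to itself. -/
lemma IsElement.eq_zero_of_inner_eq_zero (h : IsElement K) {d y : E N}
    (hd : ∀ x ∈ K, ⟪d, x - y⟫ = 0) : d = 0 := by
  have h1 : ∀ x, ⟪d, x - y⟫ = 0 := by
    intro x
    have h2 : x - y = ∑ a : K, h.basis.coord a x • ((a : E N) - y) := by
      simp_rw [smul_sub]
      rw [Finset.sum_sub_distrib, h.sum_coord_smul, ← Finset.sum_smul,
        h.basis.sum_coord_apply_eq_one, one_smul]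
    rw [h2, inner_sum]
    exact Finset.sum_eq_zero fun a _ => by rw [inner_smul_right, hd a a.2, mul_zero]
  have h2 := h1 (y + d)
  rw [add_sub_cancel_left] at h2
  exact inner_self_eq_zero.1 h2

/-- A normal to the face pairs to zero with all differences of vertices except those involving `a`,
just as `coordGrad` does, so the two are proportional. Norm and sign fix the factor. This makes the
choice in `outerNormal` harmless and gives it in closed form. -/
lemma IsElement.isOuterNormal_iff (h : IsElement K) (hN : 0 < N) (a : K) {n : E N} :
    IsOuterNormal K (K.erase a) n ↔
      n = -(‖coordGrad h.basis a‖⁻¹ • coordGrad h.basis a) := by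
  have := h.nontrivial hN
  obtain ⟨c, hca⟩ := exists_ne a
  have hG : 0 < ‖coordGrad h.basis a‖ := norm_pos_iff.2 (coordGrad_ne_zero h.basis (Ne.symm hca))
  have hcτ : (c : E N) ∈ K.erase a :=
    Finset.mem_erase.2 ⟨fun h => hca (Subtype.ext h), c.2⟩
  constructor
  · rintro ⟨hn, hn0, hle⟩
    set s := ⟪n, (a : E N) - c⟫ with hs
    have hs0 : s ≤ 0 := hle a a.2 c hcτ
    have hns : n = s • coordGrad h.basis a := by
      rw [← sub_eq_zero]
      refine h.eq_zero_of_inner_eq_zero (y := c) fun x hx => ?_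
      rw [inner_sub_left, inner_smul_left, inner_coordGrad_sub, h.coord_vertex a hx,
        h.coord_vertex a c.2, if_neg (fun h => hca (Subtype.ext h))]
      by_cases hxa : x = a
      · rw [if_pos hxa, hxa, ← hs]; simp
      · rw [if_neg hxa, hn0 x (Finset.mem_erase.2 ⟨hxa, hx⟩) c hcτ]; simp
    have h1 : -s * ‖coordGrad h.basis a‖ = 1 := by
      rw [← hn]
      conv_rhs => rw [hns]
      rw [norm_smul, Real.norm_of_nonpos hs0]
    have h2 : s = -‖coordGrad h.basis a‖⁻¹ := by
      field_simp
      linarith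
    rw [hns, h2, neg_smul]
  · rintro rfl
    have hin : ∀ x y : E N, ⟪-(‖coordGrad h.basis a‖⁻¹ • coordGrad h.basis a), x - y⟫ =
        -(‖coordGrad h.basis a‖⁻¹ * (h.basis.coord a x - h.basis.coord a y)) := by
      intro x y
      rw [inner_neg_left, inner_smul_left, inner_coordGrad_sub]
      simp
    refine ⟨?_, fun x hx y hy => ?_, fun x hx y hy => ?_⟩
    · rw [norm_neg, norm_smul, norm_inv, norm_norm, inv_mul_cancel₀ hG.ne']
    · rw [Finset.mem_erase] at hx hy
      rw [hin, h.coord_vertex a hx.2, h.coord_vertex a hy.2, if_neg hx.1, if_neg hy.1]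
      simp
    · rw [Finset.mem_erase] at hy
      rw [hin, h.coord_vertex a hx, h.coord_vertex a hy.2, if_neg hy.1]
      split_ifs <;> simp

lemma IsElement.outerNormal_eq (h : IsElement K) (hN : 0 < N) (a : K) :
    outerNormal K (K.erase a) = -(‖coordGrad h.basis a‖⁻¹ • coordGrad h.basis a) := by
  have h1 : ∃ n, IsOuterNormal K (K.erase a) n := ⟨_, (h.isOuterNormal_iff hN a).2 rfl⟩
  rw [outerNormal, dif_pos h1]
  exact (h.isOuterNormal_iff hN a).1 h1.choose_spec

lemma IsElement.eq_outerNormal (h : IsElement K) (hN : 0 < N) {τ : Finset (E N)}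
    (hτ : τ ∈ facesOf K) {n : E N} (hn : IsOuterNormal K τ n) : n = outerNormal K τ := by
  obtain ⟨a, rfl⟩ := h.exists_eq_erase hτ
  rw [h.outerNormal_eq hN, (h.isOuterNormal_iff hN a).1 hn]

/-- The divergence theorem on an element. -/
theorem IsElement.integral_fderiv (h : IsElement K) (hN : 0 < N) {φ : E N → ℝ}
    (hφ : ContDiff ℝ 1 φ) (v : E N) :
    ∫ x in simplex K, fderiv ℝ φ x v =
      ∑ τ ∈ facesOf K, ⟪outerNormal K τ, v⟫ * ∫ x, φ x ∂(faceMeasure τ) := by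
  classical
  have := h.nontrivial hN
  rw [h.simplex_eq, integral_fderiv_simplex h.basis hφ v, h.sum_facesOf, ← Finset.sum_neg_distrib]
  refine Finset.sum_congr rfl fun a _ => ?_
  rw [h.outerNormal_eq hN, faceMeasure, h.simplex_erase, inner_neg_left, inner_smul_left]
  simp
  ring

/-- The face sits isometrically in a hyperplane as a compact set, and its measure is the Lebesgue
measure there. -/
lemma IsElement.isFiniteMeasure_faceMeasure (h : IsElement K) (hN : 0 < N) {τ : Finset (E N)}
    (hτ : τ ∈ facesOf K) : IsFiniteMeasure (faceMeasure τ) := by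
  have := h.nontrivial hN
  obtain ⟨a, rfl⟩ := h.exists_eq_erase hτ
  obtain ⟨c, hca⟩ := exists_ne a
  have hG : 0 < ‖coordGrad h.basis a‖ := norm_pos_iff.2 (coordGrad_ne_zero h.basis (Ne.symm hca))
  set G := coordGrad h.basis a
  obtain ⟨n, hn⟩ : ∃ n, n = ‖G‖⁻¹ • G := ⟨_, rfl⟩
  have hn1 : ‖n‖ = 1 := by rw [hn, norm_smul, norm_inv, norm_norm, inv_mul_cancel₀ hG.ne']
  have hsub : simplex (K.erase a) ⊆ range fun z : (ℝ ∙ n)ᗮ => (c : E N) + (z : E N) := by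
    intro x hx
    rw [h.simplex_erase] at hx
    rw [mem_range_hyperplane, hn, inner_smul_left, inner_coordGrad_sub, hx.1,
      h.coord_vertex a c.2, if_neg (fun h => hca (Subtype.ext h))]
    simp
  refine ⟨?_⟩
  rw [faceMeasure, Measure.restrict_apply_univ, ← Measure.restrict_apply_self,
    ← Measure.restrict_restrict_of_subset hsub, ← map_volume_hyperplane n c hn1,
    Measure.restrict_apply_self, (measurableEmbedding_hyperplane n c).map_apply]
  refine IsCompact.measure_lt_top ?_
  have hiso : Isometry (fun z : (ℝ ∙ n)ᗮ => (c : E N) + (z : E N)) :=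
    (IsometryEquiv.addLeft (c : E N)).isometry.comp isometry_subtype_coe
  exact hiso.isClosedEmbedding.isCompact_preimage (isCompact_simplex _)

lemma volume_simplex_diff_interior (K : Finset (E N)) :
    volume (simplex K \ interior (simplex K)) = 0 := by
  refine measure_mono_null ?_ ((convex_simplex K).addHaar_frontier volume)
  exact fun x hx => ⟨subset_closure hx.1, hx.2⟩

lemma IsElement.nonempty_interior (h : IsElement K) : (interior (simplex K)).Nonempty := by
  rw [simplex, interior_convexHull_nonempty_iff_affineSpan_eq_top]
  have hr : range h.basis = (K : Set (E N)) := by ext x; simp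
  rw [← hr]
  exact h.basis.tot

end Element

/-! ### `L²` tools -/

section L2

variable {α : Type*} [MeasurableSpace α] {μ : Measure α}

lemma eLpNorm_two_sq_eq {f : α → ℝ} (hf : MemLp f 2 μ) :
    eLpNorm f 2 μ ^ 2 = ENNReal.ofReal (∫ x, f x ^ 2 ∂μ) := by
  rw [ofReal_integral_eq_lintegral_ofReal hf.integrable_sq
    (Filter.Eventually.of_forall fun x => sq_nonneg _)]
  have h := eLpNorm_nnreal_pow_eq_lintegral (f := f) (μ := μ) (p := 2) (by norm_num)
  have h2 : ((2 : NNReal) : ℝ≥0∞) = 2 := rfl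
  rw [h2] at h
  have h3 : eLpNorm f 2 μ ^ 2 = eLpNorm f 2 μ ^ ((2 : NNReal) : ℝ) := by
    rw [← ENNReal.rpow_natCast]; norm_num
  rw [h3, h]
  refine lintegral_congr fun x => ?_
  have h4 : ‖f x‖ₑ ^ ((2 : NNReal) : ℝ) = ‖f x‖ₑ ^ 2 := by
    rw [← ENNReal.rpow_natCast]; norm_num
  rw [h4, Real.enorm_eq_ofReal_abs, ← ENNReal.ofReal_pow (abs_nonneg _), sq_abs]

lemma abs_integral_mul_le {f g : α → ℝ} (hf : MemLp f 2 μ) (hg : MemLp g 2 μ) :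
    |∫ x, f x * g x ∂μ| ≤ (eLpNorm f 2 μ).toReal * (eLpNorm g 2 μ).toReal := by
  rw [← ENNReal.toReal_mul, ← Real.norm_eq_abs, ← toReal_enorm]
  refine ENNReal.toReal_mono (ENNReal.mul_ne_top hf.2.ne hg.2.ne) ?_
  calc ‖∫ x, f x * g x ∂μ‖ₑ ≤ ∫⁻ x, ‖f x * g x‖ₑ ∂μ := enorm_integral_le_lintegral_enorm _
    _ = eLpNorm (f • g) 1 μ := by rw [eLpNorm_one_eq_lintegral_enorm]; rfl
    _ ≤ eLpNorm f 2 μ * eLpNorm g 2 μ := eLpNorm_smul_le_mul_eLpNorm hg.1 hf.1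

lemma tendsto_integral_mul_of_eLpNorm {q f : α → ℝ} {F : ℕ → α → ℝ} (hq : MemLp q 2 μ)
    (hf : MemLp f 2 μ) (hF : ∀ k, MemLp (F k) 2 μ)
    (h : Tendsto (fun k => eLpNorm (F k - f) 2 μ) atTop (𝓝 0)) :
    Tendsto (fun k => ∫ x, q x * F k x ∂μ) atTop (𝓝 (∫ x, q x * f x ∂μ)) := by
  rw [tendsto_iff_dist_tendsto_zero]
  have h1 : Tendsto (fun k => (eLpNorm q 2 μ).toReal * (eLpNorm (F k - f) 2 μ).toReal) atTop
      (𝓝 0) := by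
    simpa using ((ENNReal.tendsto_toReal ENNReal.zero_ne_top).comp h).const_mul
      (eLpNorm q 2 μ).toReal
  refine squeeze_zero (fun _ => dist_nonneg) (fun k => ?_) h1
  refine le_trans (le_of_eq ?_) (abs_integral_mul_le hq ((hF k).sub hf))
  have h2 : ∫ x, q x * F k x ∂μ - ∫ x, q x * f x ∂μ = ∫ x, (q x * F k x - q x * f x) ∂μ :=
    (integral_sub (hq.integrable_mul (hF k)) (hq.integrable_mul hf)).symm
  rw [Real.dist_eq, h2]
  congr 1
  exact integral_congr_ae (Filter.Eventually.of_forall fun x => by simp [mul_sub])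

lemma eLpNorm_tendsto_zero_add {F G : ℕ → α → ℝ} (hF : ∀ k, AEStronglyMeasurable (F k) μ)
    (hG : ∀ k, AEStronglyMeasurable (G k) μ)
    (h1 : Tendsto (fun k => eLpNorm (F k) 2 μ) atTop (𝓝 0))
    (h2 : Tendsto (fun k => eLpNorm (G k) 2 μ) atTop (𝓝 0)) :
    Tendsto (fun k => eLpNorm (F k + G k) 2 μ) atTop (𝓝 0) := by
  refine tendsto_of_tendsto_of_tendsto_of_le_of_le tendsto_const_nhds (by simpa using h1.add h2)
    (fun _ => bot_le) fun k => eLpNorm_add_le (hF k) (hG k) (by norm_num)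

end L2

lemma memLp_continuous_restrict {μ : Measure (E N)} {A : Set (E N)} (hA : IsCompact A)
    [IsFiniteMeasure (μ.restrict A)] {f : E N → ℝ} (hf : Continuous f) :
    MemLp f 2 (μ.restrict A) := by
  obtain ⟨C, hC⟩ := hA.exists_bound_of_continuousOn hf.continuousOn
  exact MemLp.of_bound hf.aestronglyMeasurable C
    ((ae_restrict_mem hA.measurableSet).mono fun x hx => hC x hx)

lemma memLp_continuous_simplex (K : Finset (E N)) {f : E N → ℝ} (hf : Continuous f) :
    MemLp f 2 (volume.restrict (simplex K)) := by
  have : IsFiniteMeasure (volume.restrict (simplex K)) :=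
    ⟨by simpa using (isCompact_simplex K).measure_lt_top⟩
  exact memLp_continuous_restrict (isCompact_simplex K) hf

lemma IsElement.memLp_faceMeasure {K : Finset (E N)} (h : IsElement K) (hN : 0 < N)
    {τ : Finset (E N)} (hτ : τ ∈ facesOf K) {f : E N → ℝ} (hf : Continuous f) :
    MemLp f 2 (faceMeasure τ) := by
  have := h.isFiniteMeasure_faceMeasure hN hτ
  unfold faceMeasure at this ⊢
  exact memLp_continuous_restrict (isCompact_simplex τ) hf

/-! ### The trace inequality -/

lemma continuous_classicalPartial {φ : E N → ℝ} (hφ : ContDiff ℝ ∞ φ) (i : Fin N) :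
    Continuous (classicalPartial i φ) :=
  (hφ.continuous_fderiv (by simp)).clm_apply continuous_const

lemma contDiff_classicalPartial {φ : E N → ℝ} (hφ : ContDiff ℝ ∞ φ) (i : Fin N) :
    ContDiff ℝ ∞ (classicalPartial i φ) :=
  (hφ.fderiv_right (m := ∞) (by simp)).clm_apply contDiff_const

lemma integrable_simplex (K : Finset (E N)) {f : E N → ℝ} (hf : Continuous f) :
    Integrable f (volume.restrict (simplex K)) :=
  hf.continuousOn.integrableOn_compact (isCompact_simplex K)

lemma IsElement.integrable_faceMeasure {K : Finset (E N)} (h : IsElement K) (hN : 0 < N)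
    {τ : Finset (E N)} (hτ : τ ∈ facesOf K) {f : E N → ℝ} (hf : Continuous f) :
    Integrable f (faceMeasure τ) := by
  have := h.isFiniteMeasure_faceMeasure hN hτ
  exact (h.memLp_faceMeasure hN hτ hf).integrable (by norm_num)

lemma sum_inner_single (x y : E N) :
    ∑ i, ⟪x, EuclideanSpace.single i 1⟫ * y i = ⟪x, y⟫ := by
  rw [PiLp.inner_apply]
  refine Finset.sum_congr rfl fun i _ => ?_
  rw [EuclideanSpace.inner_single_right]
  simp [mul_comm]

lemma inner_single_one (x : E N) (i : Fin N) : ⟪x, EuclideanSpace.single i 1⟫ = x i := by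
  rw [EuclideanSpace.inner_single_right]; simp

/-- The divergence theorem for a vector field on an element. -/
lemma IsElement.integral_divergence {K : Finset (E N)} (h : IsElement K) (hN : 0 < N)
    {X : Fin N → E N → ℝ} (hX : ∀ i, ContDiff ℝ ∞ (X i)) :
    ∫ x in simplex K, ∑ i, classicalPartial i (X i) x =
      ∑ τ ∈ facesOf K, ∫ x, ∑ i, outerNormal K τ i * X i x ∂(faceMeasure τ) := by
  rw [integral_finsetSum _ fun i _ =>
    integrable_simplex K (continuous_classicalPartial (hX i) i)]
  have h1 : ∀ i, ∫ x in simplex K, classicalPartial i (X i) x =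
      ∑ τ ∈ facesOf K, outerNormal K τ i * ∫ x, X i x ∂(faceMeasure τ) := by
    intro i
    have := h.integral_fderiv hN ((hX i).of_le (by norm_cast)) (EuclideanSpace.single i 1)
    simp_rw [inner_single_one] at this
    exact this
  simp_rw [h1]
  rw [Finset.sum_comm]
  refine Finset.sum_congr rfl fun τ hτ => ?_
  rw [integral_finsetSum _ fun i _ =>
    (h.integrable_faceMeasure hN hτ (hX i).continuous).const_mul _]
  simp_rw [integral_const_mul]

lemma contDiff_apply_E (i : Fin N) : ContDiff ℝ ∞ (fun x : E N => x i) :=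
  contDiff_piLp_apply (p := 2)

lemma classicalPartial_mul {f g : E N → ℝ} {x : E N} (hf : DifferentiableAt ℝ f x)
    (hg : DifferentiableAt ℝ g x) (i : Fin N) :
    classicalPartial i (fun x => f x * g x) x =
      classicalPartial i f x * g x + f x * classicalPartial i g x := by
  unfold classicalPartial
  rw [fderiv_fun_mul hf hg]
  simp
  ring

lemma differentiableAt_of_contDiff {f : E N → ℝ} (hf : ContDiff ℝ ∞ f) (x : E N) :
    DifferentiableAt ℝ f x := hf.differentiable (by simp) x

lemma classicalPartial_apply_sub (i : Fin N) (a x : E N) :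
    classicalPartial i (fun y => y i - a i) x = 1 := by
  unfold classicalPartial
  rw [fderiv_sub_const]
  have h : (fun y : E N => y i) = (EuclideanSpace.proj i : E N →L[ℝ] ℝ) := rfl
  rw [h, ContinuousLinearMap.fderiv]
  simp

/-- The multiplicative trace inequality on a face of an element. -/
lemma IsElement.exists_trace_le {K : Finset (E N)} (h : IsElement K) (hN : 0 < N)
    {τ : Finset (E N)} (hτ : τ ∈ facesOf K) :
    ∃ C : ℝ, 0 ≤ C ∧ ∀ φ : E N → ℝ, ContDiff ℝ ∞ φ → ∫ x, φ x ^ 2 ∂(faceMeasure τ) ≤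
      C * ((∫ x in simplex K, φ x ^ 2) + ∑ i, ∫ x in simplex K, classicalPartial i φ x ^ 2) := by
  have := h.nontrivial hN
  obtain ⟨a, rfl⟩ := h.exists_eq_erase hτ
  obtain ⟨c, hca⟩ := exists_ne a
  have hG : 0 < ‖coordGrad h.basis a‖ := norm_pos_iff.2 (coordGrad_ne_zero h.basis (Ne.symm hca))
  obtain ⟨R, hR⟩ := (isCompact_simplex K).exists_bound_of_continuousOn
    (f := fun x => x - (a : E N)) (by fun_prop)
  refine ⟨‖coordGrad h.basis a‖ * (N * (1 + R ^ 2) + 1), by positivity, fun φ hφ => ?_⟩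
  -- The field `(x - a) φ²` isolates one face: its flux vanishes through every face containing `a`,
  -- while on the opposite face `(x - a) · n` is the constant height `‖coordGrad‖⁻¹`.
  have hX : ∀ i, ContDiff ℝ ∞ fun x : E N => (x i - (a : E N) i) * (φ x * φ x) := fun i =>
    ((contDiff_apply_E i).sub contDiff_const).mul (hφ.mul hφ)
  have hφ2 : Continuous fun x => φ x ^ 2 := hφ.continuous.pow 2
  have hdφ2 : ∀ i, Continuous fun x => classicalPartial i φ x ^ 2 := fun i =>
    (continuous_classicalPartial hφ i).pow 2
  have hdiv := h.integral_divergence hN hX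
  have hface : ∀ τ ∈ facesOf K, ∫ x, ∑ i, outerNormal K τ i *
      ((x i - (a : E N) i) * (φ x * φ x)) ∂(faceMeasure τ) =
      if τ = K.erase a then ‖coordGrad h.basis a‖⁻¹ * ∫ x, φ x ^ 2 ∂(faceMeasure (K.erase a))
        else 0 := by
    intro τ' hτ'
    obtain ⟨d, rfl⟩ := h.exists_eq_erase hτ'
    have hpt : ∀ x ∈ simplex (K.erase d), ∑ i, outerNormal K (K.erase d) i *
        ((x i - (a : E N) i) * (φ x * φ x)) =
        ‖coordGrad h.basis d‖⁻¹ * h.basis.coord d a * φ x ^ 2 := by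
      intro x hx
      rw [h.simplex_erase] at hx
      have h1 : ∑ i, outerNormal K (K.erase d) i * ((x i - (a : E N) i) * (φ x * φ x)) =
          ⟪outerNormal K (K.erase d), x - a⟫ * φ x ^ 2 := by
        rw [← sum_inner_single, Finset.sum_mul]
        refine Finset.sum_congr rfl fun i _ => ?_
        rw [inner_single_one, PiLp.sub_apply]
        ring
      rw [h1, h.outerNormal_eq hN, inner_neg_left, inner_smul_left, inner_coordGrad_sub, hx.1]
      simp
    have h2 : ∫ x, ∑ i, outerNormal K (K.erase d) i *
        ((x i - (a : E N) i) * (φ x * φ x)) ∂(faceMeasure (K.erase d)) =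
        ∫ x, ‖coordGrad h.basis d‖⁻¹ * h.basis.coord d a * φ x ^ 2 ∂(faceMeasure (K.erase d)) :=
      setIntegral_congr_fun (measurableSet_simplex _) fun x hx => hpt x hx
    rw [h2, integral_const_mul, h.coord_vertex d a.2]
    by_cases hd : (a : E N) = d
    · rw [if_pos hd, ← hd, Subtype.ext hd]; simp
    · rw [if_neg hd, if_neg]
      · simp
      · intro he
        have : (a : E N) ∈ K.erase d := Finset.mem_erase.2 ⟨hd, a.2⟩
        rw [he] at this
        exact Finset.notMem_erase _ _ this
  rw [Finset.sum_congr rfl hface, Finset.sum_ite_eq' , if_pos hτ] at hdiv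
  -- The divergence is `N φ² + 2 φ (x - a) · ∇φ`. Young's inequality in each coordinate, with `|xᵢ -
  -- aᵢ| ≤ R`, produces the constant `N (1 + R²)`.
  have hle : ∫ x in simplex K, ∑ i, classicalPartial i
      (fun x : E N => (x i - (a : E N) i) * (φ x * φ x)) x ≤
      ∫ x in simplex K, (N * (1 + R ^ 2) * φ x ^ 2 + ∑ i, classicalPartial i φ x ^ 2) := by
    refine setIntegral_mono_on ?_ ?_ (measurableSet_simplex K) fun x hx => ?_
    · exact integrable_simplex K (continuous_finsetSum _ fun i _ =>
        continuous_classicalPartial (hX i) i)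
    · exact integrable_simplex K ((continuous_const.mul hφ2).add
        (continuous_finsetSum _ fun i _ => hdφ2 i))
    · have h3 : (N : ℝ) * (1 + R ^ 2) * φ x ^ 2 = ∑ _i : Fin N, (1 + R ^ 2) * φ x ^ 2 := by
        simp [mul_assoc]
      rw [h3, ← Finset.sum_add_distrib]
      refine Finset.sum_le_sum fun i _ => ?_
      have hd := differentiableAt_of_contDiff hφ x
      rw [classicalPartial_mul (((contDiff_apply_E i).sub contDiff_const).differentiable (by simp) x)
        (hd.fun_mul hd), classicalPartial_mul hd hd, classicalPartial_apply_sub]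
      have h4 : (x i - (a : E N) i) ^ 2 ≤ R ^ 2 := by
        have h5 := (PiLp.norm_apply_le (x - (a : E N)) i).trans (hR x hx)
        rw [PiLp.sub_apply, Real.norm_eq_abs] at h5
        exact sq_le_sq' (by linarith [neg_abs_le (x i - (a : E N) i)]) (le_of_abs_le h5)
      nlinarith [sq_nonneg ((x i - (a : E N) i) * φ x - classicalPartial i φ x),
        mul_le_mul_of_nonneg_right h4 (sq_nonneg (φ x))]
  rw [hdiv, integral_add (integrable_simplex K (f := fun x => (N : ℝ) * (1 + R ^ 2) * φ x ^ 2) (continuous_const.mul hφ2))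
    (integrable_simplex K (continuous_finsetSum _ fun i _ => hdφ2 i)), integral_const_mul,
    integral_finsetSum _ fun i _ => integrable_simplex K (hdφ2 i),
    inv_mul_le_iff₀ hG] at hle
  refine hle.trans ?_
  rw [mul_assoc ‖coordGrad h.basis a‖]
  have h6 : 0 ≤ ∫ x in simplex K, φ x ^ 2 := integral_nonneg fun x => sq_nonneg _
  have h7 : 0 ≤ ∑ i, ∫ x in simplex K, classicalPartial i φ x ^ 2 :=
    Finset.sum_nonneg fun i _ => integral_nonneg fun x => sq_nonneg _
  have h8 : 0 ≤ (N : ℝ) * (1 + R ^ 2) := by positivity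
  refine mul_le_mul_of_nonneg_left ?_ hG.le
  nlinarith [mul_nonneg h8 h7]

/-! ### Weak derivatives -/

section Weak

variable {Ω : Set (E N)} {i : Fin N}

lemma memLp_test {φ : E N → ℝ} (h1 : ContDiff ℝ ∞ φ) (h2 : HasCompactSupport φ)
    (μ : Measure (E N)) [IsFiniteMeasureOnCompacts μ] : MemLp φ 2 μ :=
  h1.continuous.memLp_of_hasCompactSupport h2

lemma hasCompactSupport_classicalPartial {φ : E N → ℝ} (h2 : HasCompactSupport φ) :
    HasCompactSupport (classicalPartial i φ) :=
  h2.fderiv_apply ℝ _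

lemma tsupport_classicalPartial_subset (φ : E N → ℝ) :
    tsupport (classicalPartial i φ) ⊆ tsupport φ :=
  tsupport_fderiv_apply_subset ℝ _

lemma integrable_mul_test {w φ : E N → ℝ} (hw : MemLp w 2 (volume.restrict Ω))
    (h1 : ContDiff ℝ ∞ φ) (h2 : HasCompactSupport φ) :
    Integrable (fun x => w x * φ x) (volume.restrict Ω) :=
  hw.integrable_mul (memLp_test h1 h2 _)

lemma integrable_mul_test' {w φ : E N → ℝ} (hw : MemLp w 2 (volume.restrict Ω))
    (h1 : ContDiff ℝ ∞ φ) (h2 : HasCompactSupport φ) :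
    Integrable (fun x => w x * classicalPartial i φ x) (volume.restrict Ω) :=
  integrable_mul_test hw (contDiff_classicalPartial h1 i) (hasCompactSupport_classicalPartial h2)

lemma IsWeakPartial.congr {w w' g g' : E N → ℝ} (h : IsWeakPartial Ω i w g)
    (hw : w =ᵐ[volume.restrict Ω] w') (hg : g =ᵐ[volume.restrict Ω] g') :
    IsWeakPartial Ω i w' g' := by
  refine ⟨(memLp_congr_ae hg).1 h.1, fun φ h1 h2 h3 => ?_⟩
  have e1 : ∫ x in Ω, w' x * classicalPartial i φ x = ∫ x in Ω, w x * classicalPartial i φ x :=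
    integral_congr_ae (by filter_upwards [hw] with x hx; rw [hx])
  have e2 : ∫ x in Ω, g' x * φ x = ∫ x in Ω, g x * φ x :=
    integral_congr_ae (by filter_upwards [hg] with x hx; rw [hx])
  rw [e1, e2, h.2 φ h1 h2 h3]

lemma IsWeakPartial.add {w w' g g' : E N → ℝ} (hw : MemLp w 2 (volume.restrict Ω))
    (hw' : MemLp w' 2 (volume.restrict Ω)) (h : IsWeakPartial Ω i w g)
    (h' : IsWeakPartial Ω i w' g') : IsWeakPartial Ω i (w + w') (g + g') := by
  refine ⟨h.1.add h'.1, fun φ h1 h2 h3 => ?_⟩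
  simp_rw [Pi.add_apply, add_mul]
  rw [integral_add (integrable_mul_test' hw h1 h2) (integrable_mul_test' hw' h1 h2),
    integral_add (integrable_mul_test h.1 h1 h2) (integrable_mul_test h'.1 h1 h2),
    h.2 φ h1 h2 h3, h'.2 φ h1 h2 h3]
  ring

lemma IsWeakPartial.const_mul {w g : E N → ℝ} (h : IsWeakPartial Ω i w g) (r : ℝ) :
    IsWeakPartial Ω i (fun x => r * w x) (fun x => r * g x) := by
  refine ⟨h.1.const_mul r, fun φ h1 h2 h3 => ?_⟩
  simp_rw [mul_assoc]
  rw [integral_const_mul, integral_const_mul, h.2 φ h1 h2 h3]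
  ring

lemma IsWeakPartial.zero : IsWeakPartial Ω i 0 0 :=
  ⟨MemLp.zero, fun φ _ _ _ => by simp⟩

lemma IsWeakPartial.sub {w w' g g' : E N → ℝ} (hw : MemLp w 2 (volume.restrict Ω))
    (hw' : MemLp w' 2 (volume.restrict Ω)) (h : IsWeakPartial Ω i w g)
    (h' : IsWeakPartial Ω i w' g') : IsWeakPartial Ω i (w - w') (g - g') := by
  have h1 := IsWeakPartial.add hw (hw'.const_mul (-1)) h (h'.const_mul (-1))
  convert h1 using 1 <;> ext x <;> simp [sub_eq_add_neg]

lemma setIntegral_mul_test {U V : Set (E N)} (hUV : U ⊆ V) {φ : E N → ℝ} (hφ : tsupport φ ⊆ U)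
    (w : E N → ℝ) :
    ∫ x in V, w x * φ x = ∫ x in U, w x * φ x := by
  have h0 : ∀ x ∉ U, w x * φ x = 0 := fun x hx => by
    rw [image_eq_zero_of_notMem_tsupport fun h => hx (hφ h), mul_zero]
  rw [setIntegral_eq_integral_of_forall_compl_eq_zero h0,
    setIntegral_eq_integral_of_forall_compl_eq_zero fun x hx => h0 x fun h => hx (hUV h)]

/-- The weak derivative on an open set where `w` is smooth is the classical one. -/
lemma IsWeakPartial.ae_eq_classicalPartial {w g p : E N → ℝ} {U : Set (E N)} (hU : IsOpen U)
    (hUΩ : U ⊆ Ω) (h : IsWeakPartial Ω i w g) (hp : ContDiff ℝ ∞ p)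
    (hwp : w =ᵐ[volume.restrict U] p) : g =ᵐ[volume.restrict U] classicalPartial i p := by
  have hg : LocallyIntegrableOn g U volume := by
    refine LocallyIntegrableOn.mono_set ?_ hUΩ
    exact locallyIntegrableOn_of_locallyIntegrable_restrict (h.1.locallyIntegrable (by norm_num))
  have hp' := continuous_classicalPartial hp i
  have hzero := hU.ae_eq_zero_of_integral_contDiff_smul_eq_zero
    (hg.sub (hp'.locallyIntegrable.locallyIntegrableOn U)) (fun φ h1 h2 h3 => by
      have e1 : ∫ x in U, w x * classicalPartial i φ x = ∫ x in U, p x * classicalPartial i φ x :=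
        integral_congr_ae (by filter_upwards [hwp] with x hx; rw [hx])
      have e2 := h.2 φ h1 h2 (h3.trans hUΩ)
      rw [setIntegral_mul_test hUΩ ((tsupport_classicalPartial_subset φ).trans h3) w, e1, setIntegral_mul_test hUΩ h3 g] at e2
      have hφ0 : ∀ x ∉ U, φ x = 0 := fun x hx =>
        image_eq_zero_of_notMem_tsupport fun h => hx (h3 h)
      have hφ0' : ∀ x ∉ U, classicalPartial i φ x = 0 := fun x hx =>
        image_eq_zero_of_notMem_tsupport fun h => hx (h3 (tsupport_classicalPartial_subset φ h))
      have e3 : ∫ x, p x * classicalPartial i φ x = -∫ x, classicalPartial i p x * φ x := by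
        refine integral_mul_fderiv_eq_neg_fderiv_mul_of_integrable ?_ ?_ ?_
          (fun x _ => hp.differentiable (by simp) x) (fun x _ => h1.differentiable (by simp) x)
        · exact (hp'.mul h1.continuous).integrable_of_hasCompactSupport h2.mul_left
        · exact (hp.continuous.mul (continuous_classicalPartial h1 i)).integrable_of_hasCompactSupport
            (hasCompactSupport_classicalPartial h2).mul_left
        · exact (hp.continuous.mul h1.continuous).integrable_of_hasCompactSupport h2.mul_left
      rw [setIntegral_eq_integral_of_forall_compl_eq_zero
        (fun x hx => by rw [hφ0' x hx, mul_zero]), e3, neg_inj] at e2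
      have i1 : Integrable fun x => g x * φ x := by
        have i2 := integrable_mul_test h.1 h1 h2
        refine (integrableOn_iff_integrable_of_support_subset (s := Ω) fun x hx => ?_).1 i2
        by_contra hxΩ
        exact hx (by simp only; rw [hφ0 x fun h => hxΩ (hUΩ h), mul_zero])
      have i3 : Integrable fun x => classicalPartial i p x * φ x :=
        (hp'.mul h1.continuous).integrable_of_hasCompactSupport h2.mul_left
      have e4 : ∫ x, φ x • (g - classicalPartial i p) x =
          ∫ x, (g x * φ x - classicalPartial i p x * φ x) :=
        integral_congr_ae (Filter.Eventually.of_forall fun x => by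
          simp only [Pi.sub_apply, smul_eq_mul]; ring)
      rw [e4, integral_sub i1 i3, e2, setIntegral_eq_integral_of_forall_compl_eq_zero
        (fun x hx => by rw [hφ0 x hx, mul_zero]), sub_self])
  rw [Filter.EventuallyEq, ae_restrict_iff' hU.measurableSet]
  filter_upwards [hzero] with x hx hxU
  exact sub_eq_zero.1 (hx hxU)

/-- The difference is a weak derivative of `w - w = 0`, which is smooth. It makes the arbitrary
representative chosen by `weakPartial` computable almost everywhere. -/
lemma IsWeakPartial.unique (hΩ : IsOpen Ω) {w g g' : E N → ℝ} (hw : MemLp w 2 (volume.restrict Ω))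
    (h : IsWeakPartial Ω i w g) (h' : IsWeakPartial Ω i w g') : g =ᵐ[volume.restrict Ω] g' := by
  have h1 := (h.sub hw hw h').ae_eq_classicalPartial hΩ subset_rfl (p := fun _ => 0) contDiff_const
    (Filter.Eventually.of_forall fun x => by simp)
  filter_upwards [h1] with x hx
  have h2 : classicalPartial i (fun _ : E N => (0 : ℝ)) x = 0 := by simp [classicalPartial]
  rw [h2] at hx
  exact sub_eq_zero.1 hx

lemma IsWeakPartial.weakPartial_ae_eq (hΩ : IsOpen Ω) {w g : E N → ℝ}
    (hw : MemLp w 2 (volume.restrict Ω)) (h : IsWeakPartial Ω i w g) :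
    weakPartial Ω i w =ᵐ[volume.restrict Ω] g :=
  (isWeakPartial_weakPartial ⟨g, h⟩).unique hΩ hw h

lemma MemH1.memLp_weakPartial {w : E N → ℝ} (h : MemH1 Ω w) (i : Fin N) :
    MemLp (weakPartial Ω i w) 2 (volume.restrict Ω) :=
  (isWeakPartial_weakPartial (h.2 i)).1

lemma MemH1.congr {w w' : E N → ℝ} (h : MemH1 Ω w) (hw : w =ᵐ[volume.restrict Ω] w') :
    MemH1 Ω w' :=
  ⟨(memLp_congr_ae hw).1 h.1, fun i => (h.2 i).imp fun _ hg => hg.congr hw (ae_eq_refl _)⟩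

lemma MemH1.sub {w w' : E N → ℝ} (h : MemH1 Ω w) (h' : MemH1 Ω w') : MemH1 Ω (w - w') :=
  ⟨h.1.sub h'.1, fun i => ⟨_, (isWeakPartial_weakPartial (h.2 i)).sub h.1 h'.1
    (isWeakPartial_weakPartial (h'.2 i))⟩⟩

lemma MemH1.weakPartial_sub (hΩ : IsOpen Ω) {w w' : E N → ℝ} (h : MemH1 Ω w) (h' : MemH1 Ω w')
    (i : Fin N) : weakPartial Ω i (w - w') =ᵐ[volume.restrict Ω]
      weakPartial Ω i w - weakPartial Ω i w' :=
  ((isWeakPartial_weakPartial (h.2 i)).sub h.1 h'.1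
    (isWeakPartial_weakPartial (h'.2 i))).weakPartial_ae_eq hΩ (h.1.sub h'.1)

lemma MemH1.weakPartial_congr (hΩ : IsOpen Ω) {w w' : E N → ℝ} (h : MemH1 Ω w)
    (hw : w =ᵐ[volume.restrict Ω] w') (i : Fin N) :
    weakPartial Ω i w =ᵐ[volume.restrict Ω] weakPartial Ω i w' :=
  (((isWeakPartial_weakPartial (h.2 i)).congr hw (ae_eq_refl _)).weakPartial_ae_eq hΩ
    (h.congr hw).1).symm

lemma MemH2.sub (hΩ : IsOpen Ω) {w w' : E N → ℝ} (h : MemH2 Ω w) (h' : MemH2 Ω w') :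
    MemH2 Ω (w - w') :=
  ⟨h.1.sub h'.1, fun i => ((h.2 i).sub (h'.2 i)).congr (h.1.weakPartial_sub hΩ h'.1 i).symm⟩

lemma MemH2.weakPartial_weakPartial_sub (hΩ : IsOpen Ω) {w w' : E N → ℝ} (h : MemH2 Ω w)
    (h' : MemH2 Ω w') (i j : Fin N) :
    weakPartial Ω i (weakPartial Ω j (w - w')) =ᵐ[volume.restrict Ω]
      weakPartial Ω i (weakPartial Ω j w) - weakPartial Ω i (weakPartial Ω j w') := by
  have h1 := ((h.sub hΩ h').2 j).weakPartial_congr hΩ (h.1.weakPartial_sub hΩ h'.1 j) i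
  exact h1.trans ((h.2 j).weakPartial_sub hΩ (h'.2 j) i)

lemma MemH2.memLp_weakLaplacian {w : E N → ℝ} (h : MemH2 Ω w) :
    MemLp (weakLaplacian Ω w) 2 (volume.restrict Ω) :=
  memLp_finsetSum _ fun i _ => (h.2 i).memLp_weakPartial i

lemma MemH2.weakLaplacian_sub (hΩ : IsOpen Ω) {w w' : E N → ℝ} (h : MemH2 Ω w)
    (h' : MemH2 Ω w') : weakLaplacian Ω (w - w') =ᵐ[volume.restrict Ω]
      weakLaplacian Ω w - weakLaplacian Ω w' := by
  have h1 : ∀ᵐ x ∂(volume.restrict Ω), ∀ i, weakPartial Ω i (weakPartial Ω i (w - w')) x =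
      (weakPartial Ω i (weakPartial Ω i w) - weakPartial Ω i (weakPartial Ω i w')) x :=
    ae_all_iff.2 fun i => h.weakPartial_weakPartial_sub hΩ h' i i
  filter_upwards [h1] with x hx
  simp only [weakLaplacian, Pi.sub_apply, hx, Finset.sum_sub_distrib]

end Weak

/-! ### The mesh as a partition of the domain -/

section Mesh

variable {Ω : Set (E N)} (𝒯 : Triangulation Ω)

lemma Triangulation.mem_faces {K : Finset (E N)} (hK : K ∈ 𝒯.elements) :
    K ∈ 𝒯.complex.faces := by
  rw [Triangulation.elements, Finset.mem_filter, Set.Finite.mem_toFinset] at hK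
  exact hK.1

lemma Triangulation.iUnion_simplex : ⋃ K ∈ 𝒯.elements, simplex K = closure Ω := by
  rw [← 𝒯.space_eq]
  apply subset_antisymm
  · exact iUnion₂_subset fun K hK =>
      Geometry.SimplicialComplex.convexHull_subset_space (𝒯.mem_faces hK)
  · intro x hx
    obtain ⟨s, hs, hxs⟩ := Geometry.SimplicialComplex.mem_space_iff.1 hx
    obtain ⟨K, hK, hcard, hsK⟩ := 𝒯.pure s hs
    refine mem_iUnion₂.2 ⟨K, ?_, simplex_mono hsK hxs⟩
    rw [Triangulation.elements, Finset.mem_filter, Set.Finite.mem_toFinset]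
    exact ⟨hK, hcard⟩

lemma Triangulation.simplex_subset_closure {K : Finset (E N)} (hK : K ∈ 𝒯.elements) :
    simplex K ⊆ closure Ω := by
  rw [← 𝒯.iUnion_simplex]
  exact subset_biUnion_of_mem (u := fun K => simplex K) hK

/-- Convexity matters here: an open convex set is the interior of its closure, so no slit of the
domain can hide inside an element. -/
lemma Triangulation.interior_simplex_subset (ho : IsOpen Ω) (hc : Convex ℝ Ω)
    {K : Finset (E N)} (hK : K ∈ 𝒯.elements) : interior (simplex K) ⊆ Ω := by
  rcases Ω.eq_empty_or_nonempty with rfl | hne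
  · simpa using interior_mono (𝒯.simplex_subset_closure hK)
  have h := interior_mono (𝒯.simplex_subset_closure hK)
  rwa [hc.interior_closure_eq_interior_of_nonempty_interior (by rwa [ho.interior_eq]),
    ho.interior_eq] at h

lemma Triangulation.inter_simplex {K K' : Finset (E N)} (hK : K ∈ 𝒯.elements)
    (hK' : K' ∈ 𝒯.elements) : simplex K ∩ simplex K' = convexHull ℝ (K ∩ K' : Set (E N)) :=
  Geometry.SimplicialComplex.convexHull_inter_convexHull (𝒯.mem_faces hK) (𝒯.mem_faces hK')

/-- The intersection is the hull of the common vertices. It misses some vertex `a` of `K`, so the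
coordinate of `a` vanishes on it. -/
lemma Triangulation.volume_inter_simplex {K K' : Finset (E N)} (hK : K ∈ 𝒯.elements)
    (hK' : K' ∈ 𝒯.elements) (hne : K ≠ K') : volume (simplex K ∩ simplex K') = 0 := by
  have h := 𝒯.isElement hK
  have h' := 𝒯.isElement hK'
  obtain ⟨a, haK, haK'⟩ : ∃ a ∈ K, a ∉ K' := by
    by_contra! hall
    exact hne (Finset.eq_of_subset_of_card_le hall (by rw [h.2, h'.2]))
  rw [𝒯.inter_simplex hK hK']
  refine measure_mono_null (t := {x | h.basis.coord ⟨a, haK⟩ x = 0}) ?_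
    (volume_coord_eq_zero h.basis _)
  refine (convexHull_mono (t := (K.erase a : Set (E N))) fun x hx => ?_).trans
    (fun x hx => ((h.simplex_erase ⟨a, haK⟩).subset hx).1)
  rw [Finset.coe_erase]
  exact ⟨hx.1, fun hxa => haK' (hxa ▸ hx.2)⟩

lemma volume_restrict_closure (hc : Convex ℝ Ω) :
    (volume.restrict (closure Ω) : Measure (E N)) = volume.restrict Ω := by
  refine Measure.restrict_congr_set ?_
  refine (ae_eq_set.2 ⟨?_, ?_⟩)
  · exact measure_mono_null (t := frontier Ω)
      (fun x hx => show x ∈ closure Ω \ interior Ω from ⟨hx.1, fun h => hx.2 (interior_subset h)⟩)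
      (hc.addHaar_frontier volume)
  · rw [sdiff_eq_empty.2 subset_closure, measure_empty]

lemma Triangulation.restrict_eq_sum (hc : Convex ℝ Ω) :
    (volume.restrict Ω : Measure (E N)) = ∑ K ∈ 𝒯.elements, volume.restrict (simplex K) := by
  rw [← volume_restrict_closure hc, ← 𝒯.iUnion_simplex, ← Finset.sum_coe_sort,
    ← Measure.sum_fintype]
  have h1 : ⋃ K ∈ 𝒯.elements, simplex K = ⋃ K : 𝒯.elements, simplex (K : Finset (E N)) := by
    ext x; simp
  rw [h1, Measure.restrict_iUnion_ae]
  · intro K K' hne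
    exact 𝒯.volume_inter_simplex K.2 K'.2 fun h => hne (Subtype.ext h)
  · exact fun K => (measurableSet_simplex _).nullMeasurableSet

lemma Triangulation.restrict_le (hc : Convex ℝ Ω) {K : Finset (E N)} (hK : K ∈ 𝒯.elements) :
    (volume.restrict (simplex K) : Measure (E N)) ≤ volume.restrict Ω := by
  rw [← volume_restrict_closure hc]
  exact Measure.restrict_mono_set _ (𝒯.simplex_subset_closure hK)

lemma Triangulation.integral_eq_sum (hc : Convex ℝ Ω) {f : E N → ℝ}
    (hf : Integrable f (volume.restrict Ω)) :
    ∫ x in Ω, f x = ∑ K ∈ 𝒯.elements, ∫ x in simplex K, f x := by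
  rw [𝒯.restrict_eq_sum hc, integral_finsetSum_measure]
  exact fun K hK => hf.mono_measure (𝒯.restrict_le hc hK)

lemma restrict_interior_simplex (K : Finset (E N)) :
    (volume.restrict (interior (simplex K)) : Measure (E N)) = volume.restrict (simplex K) := by
  refine Measure.restrict_congr_set (ae_eq_set.2 ⟨?_, volume_simplex_diff_interior K⟩)
  rw [sdiff_eq_empty.2 interior_subset, measure_empty]

/-- The weak derivative on an element where `w` is smooth is the classical one. -/
lemma Triangulation.weakPartial_ae_eq (ho : IsOpen Ω) (hc : Convex ℝ Ω) {K : Finset (E N)}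
    (hK : K ∈ 𝒯.elements) {i : Fin N} {w p : E N → ℝ} (hw : ∃ g, IsWeakPartial Ω i w g)
    (hp : ContDiff ℝ ∞ p) (hwp : w =ᵐ[volume.restrict (simplex K)] p) :
    weakPartial Ω i w =ᵐ[volume.restrict (simplex K)] classicalPartial i p := by
  rw [← restrict_interior_simplex] at hwp ⊢
  exact (isWeakPartial_weakPartial hw).ae_eq_classicalPartial isOpen_interior
    (𝒯.interior_simplex_subset ho hc hK) hp hwp

/-! ### Piecewise smooth functions -/

/-- A function that is Lipschitz on finitely many closed pieces of a convex set is Lipschitz. -/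
lemma lipschitzOnWith_of_finite_cover {F ι : Type*} [NormedAddCommGroup F] [NormedSpace ℝ F]
    (s : Finset ι) {A : ι → Set F} {D : Set F} (hD : Convex ℝ D) (hA : ∀ k ∈ s, IsClosed (A k))
    (hcov : D = ⋃ k ∈ s, A k) {v : F → ℝ} {L : NNReal}
    (hv : ∀ k ∈ s, LipschitzOnWith L v (A k)) : LipschitzOnWith L v D := by
  have hcont : ContinuousOn v D := by
    have h1 : D = ⋃ k : s, A k := by rw [hcov]; ext x; simp
    rw [h1]
    exact (locallyFinite_of_finite _).continuousOn_iUnion (fun k => hA k k.2)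
      fun k => (hv k k.2).continuousOn
  have key : ∀ x ∈ D, ∀ y ∈ D, v y ≤ v x + L * ‖y - x‖ := by
    intro x hx y hy
    set γ : ℝ → F := fun t => x + t • (y - x) with hγ
    have hγc : Continuous γ := by fun_prop
    have hγD : ∀ t ∈ Icc (0 : ℝ) 1, γ t ∈ D := fun t ht => hD.add_smul_sub_mem hx hy ht
    -- The segment may switch between pieces infinitely often, so Lipschitz bounds cannot simply be
    -- chained. It is enough that at each time some right difference quotients, arbitrarily near,
    -- are at most `L * ‖y - x‖`.
    have hfence := image_le_of_liminf_slope_right_le_deriv_boundary (f := v ∘ γ) (a := 0) (b := 1)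
      (hcont.comp hγc.continuousOn hγD) (B := fun t => v x + (L * ‖y - x‖) * t)
      (B' := fun _ => L * ‖y - x‖) (by simp [hγ]) (by fun_prop)
      (fun t _ => by
        simpa using (((hasDerivAt_id t).const_mul (L * ‖y - x‖)).const_add (v x)).hasDerivWithinAt)
      (fun t ht r hr => by
        have hev : ∀ᶠ z in 𝓝[>] t, z ∈ Icc (0 : ℝ) 1 :=
          Icc_mem_nhdsGT_of_mem ht
        -- With finitely many pieces, one contains `γ z` for `z` arbitrarily close to `t` from the
        -- right; being closed, it contains `γ t` as well.
        obtain ⟨k, hk, hfreq⟩ : ∃ k ∈ s, ∃ᶠ z in 𝓝[>] t, γ z ∈ A k := by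
          by_contra! hno
          have h2 : ∀ᶠ z in 𝓝[>] t, ∀ k ∈ s, γ z ∉ A k :=
            (Filter.eventually_all_finset s).2 fun k hk => hno k hk
          obtain ⟨z, hz1, hz2⟩ := (hev.and h2).exists
          have h3 := hγD z hz1
          rw [hcov] at h3
          obtain ⟨k, hk, hzk⟩ := mem_iUnion₂.1 h3
          exact hz2 k hk hzk
        have hmem : γ t ∈ A k := (hA k hk).mem_of_frequently_of_tendsto hfreq
          ((hγc.tendsto t).mono_left nhdsWithin_le_nhds)
        refine (hfreq.and_eventually self_mem_nhdsWithin).mono fun z hz => lt_of_le_of_lt ?_ hr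
        have hzt : 0 < z - t := sub_pos.2 hz.2
        rw [slope_def_field, div_le_iff₀ hzt]
        have h4 := (hv k hk).dist_le_mul _ hz.1 _ hmem
        have h5 : γ z - γ t = (z - t) • (y - x) := by simp only [hγ]; module
        rw [Real.dist_eq, dist_eq_norm, h5, norm_smul, Real.norm_of_nonneg hzt.le] at h4
        calc (v ∘ γ) z - (v ∘ γ) t ≤ |v (γ z) - v (γ t)| := le_abs_self _
          _ ≤ L * ((z - t) * ‖y - x‖) := h4
          _ = L * ‖y - x‖ * (z - t) := by ring)
    have h6 := hfence (right_mem_Icc.2 zero_le_one)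
    simpa [hγ] using h6
  refine LipschitzOnWith.of_dist_le_mul fun x hx y hy => ?_
  rw [Real.dist_eq, dist_eq_norm, abs_sub_le_iff]
  constructor
  · linarith [key y hy x hx]
  · have := key x hx y hy
    rw [norm_sub_rev] at this
    linarith

/-- `v` coincides with a smooth function on each closed element. -/
def IsPiecewiseSmooth (v : E N → ℝ) : Prop :=
  ∀ K ∈ 𝒯.elements, ∃ p : E N → ℝ, ContDiff ℝ ∞ p ∧ EqOn v p (simplex K)

variable {𝒯}

lemma IsPiecewiseSmooth.exists_lipschitzOnWith (hc : Convex ℝ Ω) {v : E N → ℝ}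
    (hv : IsPiecewiseSmooth 𝒯 v) : ∃ L, LipschitzOnWith L v (closure Ω) := by
  have h1 : ∀ K ∈ 𝒯.elements, ∃ L, LipschitzOnWith L v (simplex K) := by
    intro K hK
    obtain ⟨p, hp, hvp⟩ := hv K hK
    obtain ⟨L, hL⟩ := (isCompact_simplex K).exists_bound_of_continuousOn
      (hp.continuous_fderiv (by simp)).continuousOn
    have h2 : LipschitzOnWith L.toNNReal p (simplex K) := by
      refine (convex_simplex K).lipschitzOnWith_of_nnnorm_fderiv_le
        (fun x _ => hp.differentiable (by simp) x) fun x hx => ?_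
      rw [← NNReal.coe_le_coe, coe_nnnorm]
      exact (hL x hx).trans (Real.le_coe_toNNReal L)
    exact ⟨L.toNNReal, fun x hx y hy => by rw [hvp hx, hvp hy]; exact h2 hx hy⟩
  choose! L hL using h1
  refine ⟨∑ K ∈ 𝒯.elements, L K, lipschitzOnWith_of_finite_cover 𝒯.elements hc.closure
    (fun K _ => (isCompact_simplex K).isClosed) 𝒯.iUnion_simplex.symm fun K hK => ?_⟩
  exact (hL K hK).weaken (Finset.single_le_sum (f := L) (fun _ _ => bot_le) hK)

/-- Agreement with smooth functions on closed elements forces continuity across faces, hence a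
Lipschitz bound. The line derivatives of a global Lipschitz extension are bounded and satisfy
integration by parts, so no interface terms arise. -/
lemma IsPiecewiseSmooth.memH1 (hb : Bornology.IsBounded Ω)
    (hc : Convex ℝ Ω) (ho : IsOpen Ω) {v : E N → ℝ} (hv : IsPiecewiseSmooth 𝒯 v) : MemH1 Ω v := by
  obtain ⟨L, hL⟩ := hv.exists_lipschitzOnWith hc
  obtain ⟨g, hg, hvg⟩ := hL.extend_real
  have hfin : IsFiniteMeasure (volume.restrict Ω) := ⟨by simpa using hb.measure_lt_top⟩
  have hvg' : v =ᵐ[volume.restrict Ω] g :=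
    (ae_restrict_mem ho.measurableSet).mono fun x hx => hvg (subset_closure hx)
  have hgc : IsCompact (closure Ω) := hb.isCompact_closure
  obtain ⟨M, hM⟩ := hgc.exists_bound_of_continuousOn hg.continuous.continuousOn
  refine MemH1.congr ⟨?_, fun i => ⟨fun x => lineDeriv ℝ g x (EuclideanSpace.single i 1), ?_, ?_⟩⟩
    hvg'.symm
  · exact MemLp.of_bound hg.continuous.aestronglyMeasurable M
      ((ae_restrict_mem ho.measurableSet).mono fun x hx => hM x (subset_closure hx))
  · exact MemLp.of_bound (measurable_lineDeriv hg.continuous).aestronglyMeasurable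
      (L * ‖EuclideanSpace.single i (1 : ℝ)‖)
      (Filter.Eventually.of_forall fun x => norm_lineDeriv_le_of_lipschitz ℝ hg)
  · intro φ h1 h2 h3
    obtain ⟨D, hD⟩ := h1.lipschitzWith_of_hasCompactSupport h2 (by simp)
    have h4 := hg.integral_lineDeriv_mul_eq (μ := volume) hD h2 (EuclideanSpace.single i 1)
    have hφ0 : ∀ x ∉ Ω, φ x = 0 := fun x hx =>
      image_eq_zero_of_notMem_tsupport fun h => hx (h3 h)
    have hφ0' : ∀ x ∉ Ω, classicalPartial i φ x = 0 := fun x hx =>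
      image_eq_zero_of_notMem_tsupport fun h => hx (h3 (tsupport_classicalPartial_subset φ h))
    rw [setIntegral_eq_integral_of_forall_compl_eq_zero fun x hx => by rw [hφ0' x hx, mul_zero],
      setIntegral_eq_integral_of_forall_compl_eq_zero fun x hx => by rw [hφ0 x hx, mul_zero],
      h4, ← integral_neg]
    refine integral_congr_ae (Filter.Eventually.of_forall fun x => ?_)
    simp only
    rw [(h1.differentiable (by simp) x).lineDeriv_eq_fderiv, map_neg, classicalPartial]
    ring

end Mesh

/-! ### Neighbouring elements -/

section Neighbours

variable {K K' : Finset (E N)}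

lemma IsElement.coord_eq_sum {ι : Type*} (b : AffineBasis ι ℝ (E N)) (i : ι) (h : IsElement K)
    (x : E N) : b.coord i x = ∑ j : K, h.basis.coord j x * b.coord i j := by
  have h1 : ∀ y, b.coord i y = b.coord i 0 + ⟪coordGrad b i, y⟫ := fun y => by
    simpa using coord_add b i 0 y
  rw [h1, ← h.sum_coord_smul x, inner_sum]
  simp_rw [inner_smul_right, h.sum_coord_smul x]
  have h2 : ∀ j : K, h.basis.coord j x * b.coord i j =
      h.basis.coord j x * b.coord i 0 + h.basis.coord j x * ⟪coordGrad b i, (j : E N)⟫ :=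
    fun j => by rw [h1 j]; ring
  simp_rw [h2]
  rw [Finset.sum_add_distrib, ← Finset.sum_mul, h.basis.sum_coord_apply_eq_one, one_mul]

/-- Coordinates of two elements with a common face are proportional. -/
lemma IsElement.coord_eq_mul (h : IsElement K) (h' : IsElement K') (a : K) (a' : K')
    (hface : K.erase a = K'.erase a') (x : E N) :
    h.basis.coord a x = h'.basis.coord a' x * h.basis.coord a a' := by
  rw [h'.coord_eq_sum h.basis a x]
  refine Finset.sum_eq_single a' (fun j _ hj => ?_) fun h => absurd (Finset.mem_univ _) h
  have hj' : (j : E N) ∈ K.erase a := by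
    rw [hface]; exact Finset.mem_erase.2 ⟨fun h => hj (Subtype.ext h), j.2⟩
  rw [Finset.mem_erase] at hj'
  rw [h.coord_vertex a hj'.2, if_neg hj'.1, mul_zero]

/-- A point in the relative interior of a face. -/
lemma IsElement.exists_mem_face (h : IsElement K) (hN : 0 < N) (a : K) :
    ∃ m, h.basis.coord a m = 0 ∧ ∀ c ≠ a, 0 < h.basis.coord c m := by
  classical
  -- The barycentre of the face: equal weights on its `N` vertices and none on `a`.
  set w : K → ℝ := fun c => if c = a then 0 else (N : ℝ)⁻¹ with hw
  have hsum : ∑ c, w c = 1 := by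
    rw [← Finset.add_sum_erase _ _ (Finset.mem_univ a)]
    have h1 : ∀ c ∈ Finset.univ.erase a, w c = (N : ℝ)⁻¹ := fun c hc => by
      rw [hw]; exact if_neg (Finset.ne_of_mem_erase hc)
    rw [Finset.sum_congr rfl h1, Finset.sum_const, Finset.card_erase_of_mem (Finset.mem_univ a),
      Finset.card_univ, Fintype.card_coe, h.2]
    have : (N : ℝ) ≠ 0 := by exact_mod_cast hN.ne'
    simp [hw, this]
  refine ⟨Finset.univ.affineCombination ℝ h.basis w, ?_, fun c hc => ?_⟩
  · rw [h.basis.coord_apply_combination_of_mem (Finset.mem_univ a) hsum]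
    simp [hw]
  · rw [h.basis.coord_apply_combination_of_mem (Finset.mem_univ c) hsum]
    simp [hw, hc, hN]

variable {Ω : Set (E N)} (𝒯 : Triangulation Ω)

/-- Two elements with a common face lie on opposite sides of it. -/
lemma Triangulation.coord_neg_of_common_face (hN : 0 < N) (hK : K ∈ 𝒯.elements)
    (hK' : K' ∈ 𝒯.elements) (hne : K ≠ K') (a : K) (a' : K')
    (hface : K.erase a = K'.erase a') : (𝒯.isElement hK).basis.coord a a' < 0 := by
  have h := 𝒯.isElement hK
  have h' := 𝒯.isElement hK'
  -- If the coordinate vanished at `a'`, it would vanish identically by proportionality, yet it is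
  -- `1` at `a`. If it were positive, a point slightly displaced from the interior of the face
  -- towards `a'` would lie in both elements but off the common face, against conformity.
  by_contra! hge
  rcases hge.eq_or_lt with h0 | hpos
  · have h1 := h.coord_eq_mul h' a a' hface a
    rw [← h0, mul_zero, h.coord_vertex a a.2, if_pos rfl] at h1
    exact one_ne_zero h1
  · obtain ⟨m, hm0, hm⟩ := h.exists_mem_face hN a
    have hmK' : m ∈ simplex K' := by
      have h1 : m ∈ simplex (K.erase a) := by
        rw [h.simplex_erase]
        refine ⟨hm0, fun c => ?_⟩
        by_cases hc : c = a
        · rw [hc, hm0]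
        · exact (hm c hc).le
      rw [hface] at h1
      exact simplex_mono (Finset.erase_subset _ _) h1
    have hcont : ∀ c : K, Continuous fun δ : ℝ => h.basis.coord c (m + δ • ((a' : E N) - m)) :=
      fun c => (continuous_coord h.basis c).comp (by fun_prop)
    have hev : ∀ c ∈ Finset.univ.erase a,
        ∀ᶠ δ : ℝ in 𝓝[>] 0, 0 < h.basis.coord c (m + δ • ((a' : E N) - m)) := by
      intro c hc
      refine ((hcont c).tendsto 0).mono_left nhdsWithin_le_nhds |>.eventually_const_lt ?_
      simpa using hm c (Finset.ne_of_mem_erase hc)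
    obtain ⟨δ, hδ, hδ1⟩ := (((Filter.eventually_all_finset _).2 hev).and
      (Ioc_mem_nhdsGT (zero_lt_one (α := ℝ)))).exists
    set x := m + δ • ((a' : E N) - m)
    have hxa : 0 < h.basis.coord a x := by
      rw [coord_add, inner_smul_right, inner_coordGrad_sub, hm0]
      simpa using mul_pos hδ1.1 hpos
    have hxK : x ∈ simplex K := by
      rw [h.simplex_eq]
      intro c
      by_cases hc : c = a
      · rw [hc]; exact hxa.le
      · exact (hδ c (Finset.mem_erase.2 ⟨hc, Finset.mem_univ c⟩)).le
    have hxK' : x ∈ simplex K' :=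
      (convex_simplex K').add_smul_sub_mem hmK' (subset_simplex a'.2) ⟨hδ1.1.le, hδ1.2⟩
    have hx := (𝒯.inter_simplex hK hK').subset ⟨hxK, hxK'⟩
    have haK' : (a : E N) ∉ K' := by
      intro haK'
      refine hne (Finset.eq_of_subset_of_card_le (fun y hy => ?_) (by rw [h.2, h'.2]))
      by_cases hya : y = a
      · rwa [hya]
      · have : y ∈ K'.erase a' := hface ▸ Finset.mem_erase.2 ⟨hya, hy⟩
        exact (Finset.mem_erase.1 this).2
    have hx2 : x ∈ simplex (K.erase a) := by
      refine convexHull_mono (fun y hy => ?_) hx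
      rw [Finset.coe_erase]
      exact ⟨hy.1, fun hya => haK' (hya ▸ hy.2)⟩
    rw [h.simplex_erase] at hx2
    exact hxa.ne' hx2.1

lemma mem_facesOf_of_subset {τ : Finset (E N)}
    (hτ : τ ∈ facesOf K) (hsub : τ ⊆ K') : τ ∈ facesOf K' := by
  rw [facesOf, Finset.mem_powersetCard] at hτ ⊢
  exact ⟨hsub, hτ.2⟩

/-- A face has only two sides. Three distinct elements would lie pairwise on opposite sides, and by
proportionality one negative number would equal a product of two negative numbers. -/
lemma Triangulation.neighbour_unique (hN : 0 < N) {τ K'' : Finset (E N)} (hK : K ∈ 𝒯.elements)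
    (hτ : τ ∈ facesOf K) (h1 : IsNeighbour 𝒯 K τ K') (h2 : IsNeighbour 𝒯 K τ K'') : K' = K'' := by
  by_contra hne
  have h := 𝒯.isElement hK
  have h' := 𝒯.isElement h1.1
  have h'' := 𝒯.isElement h2.1
  obtain ⟨a, ha⟩ := h.exists_eq_erase hτ
  obtain ⟨a', ha'⟩ := h'.exists_eq_erase (mem_facesOf_of_subset hτ h1.2.2)
  obtain ⟨a'', ha''⟩ := h''.exists_eq_erase (mem_facesOf_of_subset hτ h2.2.2)
  have e1 := 𝒯.coord_neg_of_common_face hN hK h1.1 h1.2.1.symm a a' (ha.symm.trans ha')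
  have e2 := 𝒯.coord_neg_of_common_face hN hK h2.1 h2.2.1.symm a a'' (ha.symm.trans ha'')
  have e3 := 𝒯.coord_neg_of_common_face hN h1.1 h2.1 hne a' a'' (ha'.symm.trans ha'')
  have e4 := h.coord_eq_mul h' a a' (ha.symm.trans ha') a''
  nlinarith

lemma Triangulation.outerNormal_neighbour (hN : 0 < N) {τ : Finset (E N)} (hK : K ∈ 𝒯.elements)
    (hτ : τ ∈ facesOf K) (h1 : IsNeighbour 𝒯 K τ K') :
    outerNormal K' τ = -outerNormal K τ := by
  have h := 𝒯.isElement hK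
  have h' := 𝒯.isElement h1.1
  have hτ' := mem_facesOf_of_subset hτ h1.2.2
  symm
  refine h'.eq_outerNormal hN hτ' ?_
  obtain ⟨a, rfl⟩ := h.exists_eq_erase hτ
  obtain ⟨a', ha'⟩ := h'.exists_eq_erase hτ'
  have e1 := 𝒯.coord_neg_of_common_face hN hK h1.1 h1.2.1.symm a a' ha'
  have hn : IsOuterNormal K (K.erase a) (outerNormal K (K.erase a)) :=
    (h.isOuterNormal_iff hN a).2 (h.outerNormal_eq hN a)
  refine ⟨by rw [norm_neg, hn.1], fun x hx y hy => by rw [inner_neg_left, hn.2.1 x hx y hy, neg_zero],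
    fun x hx y hy => ?_⟩
  by_cases hxa : x = a'
  · have hy' := Finset.mem_erase.1 hy
    rw [h.outerNormal_eq hN, neg_neg, inner_smul_left, inner_coordGrad_sub,
      h.coord_vertex a hy'.2, if_neg hy'.1, hxa, sub_zero]
    exact mul_nonpos_of_nonneg_of_nonpos (by simp) e1.le
  · have hx' : x ∈ K.erase a := by rw [ha']; exact Finset.mem_erase.2 ⟨hxa, hx⟩
    rw [inner_neg_left, hn.2.1 x hx' y hy, neg_zero]

open Classical in
/-- The neighbour of `K` across `τ`, or `K` itself if there is none. -/
def Triangulation.across (K τ : Finset (E N)) : Finset (E N) :=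
  if h : ∃ K', IsNeighbour 𝒯 K τ K' then h.choose else K

lemma Triangulation.across_mem {τ : Finset (E N)} (hK : K ∈ 𝒯.elements) :
    𝒯.across K τ ∈ 𝒯.elements := by
  rw [Triangulation.across]
  split_ifs with h
  · exact h.choose_spec.1
  · exact hK

lemma Triangulation.mem_facesOf_across {τ : Finset (E N)}
    (hτ : τ ∈ facesOf K) : τ ∈ facesOf (𝒯.across K τ) := by
  refine mem_facesOf_of_subset hτ ?_
  rw [Triangulation.across]
  split_ifs with h
  · exact h.choose_spec.2.2
  · exact (Finset.mem_powersetCard.1 hτ).1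

/-- Uniqueness of the neighbour makes crossing a face an involution; element-face pairs on the
boundary are its fixed points. -/
lemma Triangulation.across_across (hN : 0 < N) {τ : Finset (E N)} (hK : K ∈ 𝒯.elements)
    (hτ : τ ∈ facesOf K) : 𝒯.across (𝒯.across K τ) τ = K := by
  by_cases h : ∃ K', IsNeighbour 𝒯 K τ K'
  · have e1 : 𝒯.across K τ = h.choose := dif_pos h
    have hs := h.choose_spec
    have hτ' := mem_facesOf_of_subset hτ hs.2.2
    have hb : IsNeighbour 𝒯 h.choose τ K :=
      ⟨hK, hs.2.1.symm, (Finset.mem_powersetCard.1 hτ).1⟩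
    have h2 : ∃ K', IsNeighbour 𝒯 h.choose τ K' := ⟨K, hb⟩
    rw [e1, Triangulation.across, dif_pos h2]
    exact 𝒯.neighbour_unique hN hs.1 hτ' h2.choose_spec hb
  · have e1 : 𝒯.across K τ = K := dif_neg h
    rw [e1, e1]

/-- Face contributions may be averaged over the two sides of each face. -/
lemma Triangulation.sum_faces_eq (hN : 0 < N) (A : Finset (E N) → Finset (E N) → ℝ) :
    ∑ K ∈ 𝒯.elements, ∑ τ ∈ facesOf K, A K τ =
      ∑ K ∈ 𝒯.elements, ∑ τ ∈ facesOf K, (A K τ + A (𝒯.across K τ) τ) / 2 := by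
  -- Reindex by the involution that keeps the face and crosses it.
  have h1 : ∑ K ∈ 𝒯.elements, ∑ τ ∈ facesOf K, A (𝒯.across K τ) τ =
      ∑ K ∈ 𝒯.elements, ∑ τ ∈ facesOf K, A K τ := by
    rw [Finset.sum_sigma', Finset.sum_sigma']
    refine Finset.sum_bij' (fun p _ => ⟨𝒯.across p.1 p.2, p.2⟩) (fun p _ => ⟨𝒯.across p.1 p.2, p.2⟩)
      ?_ ?_ ?_ ?_ ?_
    · rintro ⟨K, τ⟩ hp
      rw [Finset.mem_sigma] at hp ⊢
      exact ⟨𝒯.across_mem hp.1, 𝒯.mem_facesOf_across hp.2⟩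
    · rintro ⟨K, τ⟩ hp
      rw [Finset.mem_sigma] at hp ⊢
      exact ⟨𝒯.across_mem hp.1, 𝒯.mem_facesOf_across hp.2⟩
    · rintro ⟨K, τ⟩ hp
      rw [Finset.mem_sigma] at hp
      simp only [𝒯.across_across hN hp.1 hp.2]
    · rintro ⟨K, τ⟩ hp
      rw [Finset.mem_sigma] at hp
      simp only [𝒯.across_across hN hp.1 hp.2]
    · rintro ⟨K, τ⟩ _
      rfl
  simp_rw [add_div, Finset.sum_add_distrib, ← Finset.sum_div]
  rw [h1]
  ring

end Neighbours

/-! ### Smooth sequences converging in `H¹` and their traces -/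

section H1Sequences

variable {Ω : Set (E N)}

/-- The smooth functions `φ k` converge to `v` in `H¹(Ω)`. -/
def H1Tendsto (Ω : Set (E N)) (φ : ℕ → E N → ℝ) (v : E N → ℝ) : Prop :=
  (∀ k, ContDiff ℝ ∞ (φ k)) ∧
    Tendsto (fun k => eLpNorm (φ k - v) 2 (volume.restrict Ω)) atTop (𝓝 0) ∧
    ∀ i, Tendsto (fun k => eLpNorm (classicalPartial i (φ k) - weakPartial Ω i v) 2
      (volume.restrict Ω)) atTop (𝓝 0)

lemma HasTrace.exists_h1Tendsto {τ : Finset (E N)} {w g : E N → ℝ} (h : HasTrace Ω τ w g) :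
    ∃ φ, H1Tendsto Ω φ w ∧ Tendsto (fun k => eLpNorm (φ k - g) 2 (faceMeasure τ)) atTop (𝓝 0) := by
  obtain ⟨_, φ, h1, h2, h3, h4⟩ := h
  exact ⟨φ, ⟨h1, h2, h3⟩, h4⟩

lemma classicalPartial_add {f g : E N → ℝ} (hf : ContDiff ℝ ∞ f) (hg : ContDiff ℝ ∞ g)
    (i : Fin N) : classicalPartial i (f + g) = classicalPartial i f + classicalPartial i g := by
  ext x
  simp [classicalPartial, fderiv_add (differentiableAt_of_contDiff hf x)
    (differentiableAt_of_contDiff hg x)]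

lemma classicalPartial_const_mul (r : ℝ) {f : E N → ℝ} (hf : ContDiff ℝ ∞ f) (i : Fin N) :
    classicalPartial i (fun x => r * f x) = fun x => r * classicalPartial i f x := by
  ext x
  simp [classicalPartial, fderiv_const_mul (differentiableAt_of_contDiff hf x)]

lemma classicalPartial_sub {f g : E N → ℝ} (hf : ContDiff ℝ ∞ f) (hg : ContDiff ℝ ∞ g)
    (i : Fin N) : classicalPartial i (f - g) = classicalPartial i f - classicalPartial i g := by
  ext x
  simp [classicalPartial, fderiv_sub (differentiableAt_of_contDiff hf x)
    (differentiableAt_of_contDiff hg x)]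

lemma MemH1.add {w w' : E N → ℝ} (h : MemH1 Ω w) (h' : MemH1 Ω w') : MemH1 Ω (w + w') :=
  ⟨h.1.add h'.1, fun i => ⟨_, (isWeakPartial_weakPartial (h.2 i)).add h.1 h'.1
    (isWeakPartial_weakPartial (h'.2 i))⟩⟩

lemma MemH1.const_mul {w : E N → ℝ} (h : MemH1 Ω w) (r : ℝ) : MemH1 Ω (fun x => r * w x) :=
  ⟨h.1.const_mul r, fun i => ⟨_, (isWeakPartial_weakPartial (h.2 i)).const_mul r⟩⟩

lemma memH1_zero : MemH1 Ω (0 : E N → ℝ) := ⟨MemLp.zero, fun _ => ⟨0, IsWeakPartial.zero⟩⟩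

lemma memH1_sum {ι : Type*} (s : Finset ι) (c : ι → ℝ) {v : ι → E N → ℝ}
    (h : ∀ j, MemH1 Ω (v j)) : MemH1 Ω (fun x => ∑ j ∈ s, c j * v j x) := by
  classical
  induction s using Finset.induction_on with
  | empty => simpa using! memH1_zero
  | insert a s ha ih =>
    simp_rw [Finset.sum_insert ha]
    exact ((h a).const_mul (c a)).add ih

lemma tendsto_eLpNorm_congr {μ : Measure (E N)} {F G : ℕ → E N → ℝ}
    (h : Tendsto (fun k => eLpNorm (F k) 2 μ) atTop (𝓝 0)) (hFG : ∀ k, F k =ᵐ[μ] G k) :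
    Tendsto (fun k => eLpNorm (G k) 2 μ) atTop (𝓝 0) := by
  simpa only [eLpNorm_congr_ae (hFG _)] using h

lemma tendsto_eLpNorm_const_mul {μ : Measure (E N)} {F : ℕ → E N → ℝ} (r : ℝ)
    (h : Tendsto (fun k => eLpNorm (F k) 2 μ) atTop (𝓝 0)) :
    Tendsto (fun k => eLpNorm (fun x => r * F k x) 2 μ) atTop (𝓝 0) := by
  have h1 : ∀ k, eLpNorm (fun x => r * F k x) 2 μ = ‖r‖ₑ * eLpNorm (F k) 2 μ := fun k =>
    eLpNorm_const_smul r (F k) 2 μ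
  simp_rw [h1]
  simpa using ENNReal.Tendsto.const_mul h (Or.inr enorm_ne_top)

lemma H1Tendsto.add (hΩ : IsOpen Ω) {φ χ : ℕ → E N → ℝ} {v w : E N → ℝ} (hv : MemH1 Ω v)
    (hw : MemH1 Ω w) (h : H1Tendsto Ω φ v) (h' : H1Tendsto Ω χ w) :
    H1Tendsto Ω (fun k => φ k + χ k) (v + w) := by
  refine ⟨fun k => (h.1 k).add (h'.1 k), ?_, fun i => ?_⟩
  · refine tendsto_eLpNorm_congr (eLpNorm_tendsto_zero_add
      (fun k => (h.1 k).continuous.aestronglyMeasurable.sub hv.1.1)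
      (fun k => (h'.1 k).continuous.aestronglyMeasurable.sub hw.1.1) h.2.1 h'.2.1) fun k => ?_
    exact Filter.Eventually.of_forall fun x => by simp; ring
  · refine tendsto_eLpNorm_congr (eLpNorm_tendsto_zero_add
      (fun k => (continuous_classicalPartial (h.1 k) i).aestronglyMeasurable.sub
        (hv.memLp_weakPartial i).1)
      (fun k => (continuous_classicalPartial (h'.1 k) i).aestronglyMeasurable.sub
        (hw.memLp_weakPartial i).1) (h.2.2 i) (h'.2.2 i)) fun k => ?_
    have h1 := ((isWeakPartial_weakPartial (hv.2 i)).add hv.1 hw.1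
      (isWeakPartial_weakPartial (hw.2 i))).weakPartial_ae_eq hΩ (hv.add hw).1
    filter_upwards [h1] with x hx
    rw [classicalPartial_add (h.1 k) (h'.1 k)]
    simp only [Pi.add_apply, Pi.sub_apply] at hx ⊢
    rw [hx]
    ring

lemma H1Tendsto.const_mul (hΩ : IsOpen Ω) {φ : ℕ → E N → ℝ} {v : E N → ℝ} (hv : MemH1 Ω v)
    (h : H1Tendsto Ω φ v) (r : ℝ) :
    H1Tendsto Ω (fun k x => r * φ k x) (fun x => r * v x) := by
  refine ⟨fun k => contDiff_const.mul (h.1 k), ?_, fun i => ?_⟩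
  · refine tendsto_eLpNorm_congr (tendsto_eLpNorm_const_mul r h.2.1) fun k => ?_
    exact Filter.Eventually.of_forall fun x => by simp; ring
  · refine tendsto_eLpNorm_congr (tendsto_eLpNorm_const_mul r (h.2.2 i)) fun k => ?_
    have h1 := ((isWeakPartial_weakPartial (hv.2 i)).const_mul r).weakPartial_ae_eq hΩ
      (hv.const_mul r).1
    filter_upwards [h1] with x hx
    rw [classicalPartial_const_mul r (h.1 k)]
    simp only [Pi.sub_apply] at hx ⊢
    rw [hx]
    ring

lemma h1Tendsto_zero (hΩ : IsOpen Ω) : H1Tendsto Ω (fun _ => (0 : E N → ℝ)) 0 := by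
  refine ⟨fun _ => contDiff_const, by simp, fun i => ?_⟩
  have h1 := (IsWeakPartial.zero (Ω := Ω) (i := i)).weakPartial_ae_eq hΩ MemLp.zero
  refine tendsto_eLpNorm_congr (F := fun _ => 0) (by simp) fun k => ?_
  filter_upwards [h1] with x hx
  rw [Pi.sub_apply, hx]
  simp [classicalPartial]

lemma H1Tendsto.sum (hΩ : IsOpen Ω) {ι : Type*} (s : Finset ι) (c : ι → ℝ)
    {φ : ι → ℕ → E N → ℝ} {v : ι → E N → ℝ} (hv : ∀ j, MemH1 Ω (v j))
    (h : ∀ j, H1Tendsto Ω (φ j) (v j)) :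
    H1Tendsto Ω (fun k x => ∑ j ∈ s, c j * φ j k x) (fun x => ∑ j ∈ s, c j * v j x) := by
  classical
  induction s using Finset.induction_on with
  | empty => simpa using! h1Tendsto_zero hΩ
  | insert a s ha ih =>
    simp_rw [Finset.sum_insert ha]
    exact H1Tendsto.add hΩ ((hv a).const_mul (c a)) (memH1_sum s c hv)
      ((h a).const_mul hΩ (hv a) (c a)) ih

lemma H1Tendsto.sub_tendsto_zero {φ χ : ℕ → E N → ℝ} {v : E N → ℝ} (hv : MemH1 Ω v)
    (h : H1Tendsto Ω φ v) (h' : H1Tendsto Ω χ v) :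
    Tendsto (fun k => eLpNorm (φ k - χ k) 2 (volume.restrict Ω)) atTop (𝓝 0) ∧
      ∀ i, Tendsto (fun k => eLpNorm (classicalPartial i (φ k - χ k)) 2 (volume.restrict Ω))
        atTop (𝓝 0) := by
  constructor
  · refine tendsto_eLpNorm_congr (eLpNorm_tendsto_zero_add
      (fun k => (h.1 k).continuous.aestronglyMeasurable.sub hv.1.1)
      (fun k => ((h'.1 k).continuous.aestronglyMeasurable.sub hv.1.1).const_mul (-1)) h.2.1
      (tendsto_eLpNorm_const_mul (-1) h'.2.1)) fun k => ?_
    exact Filter.Eventually.of_forall fun x => by simp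
  · intro i
    refine tendsto_eLpNorm_congr (eLpNorm_tendsto_zero_add
      (fun k => (continuous_classicalPartial (h.1 k) i).aestronglyMeasurable.sub
        (hv.memLp_weakPartial i).1)
      (fun k => ((continuous_classicalPartial (h'.1 k) i).aestronglyMeasurable.sub
        (hv.memLp_weakPartial i).1).const_mul (-1)) (h.2.2 i)
      (tendsto_eLpNorm_const_mul (-1) (h'.2.2 i))) fun k => ?_
    refine Filter.Eventually.of_forall fun x => ?_
    rw [classicalPartial_sub (h.1 k) (h'.1 k)]
    simp

lemma IsElement.exists_eLpNorm_trace_le {K : Finset (E N)} (h : IsElement K) (hN : 0 < N)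
    {τ : Finset (E N)} (hτ : τ ∈ facesOf K) :
    ∃ C : ℝ, ∀ φ : E N → ℝ, ContDiff ℝ ∞ φ → eLpNorm φ 2 (faceMeasure τ) ^ 2 ≤
      ENNReal.ofReal C * (eLpNorm φ 2 (volume.restrict (simplex K)) ^ 2 +
        ∑ i, eLpNorm (classicalPartial i φ) 2 (volume.restrict (simplex K)) ^ 2) := by
  obtain ⟨C, hC, hle⟩ := h.exists_trace_le hN hτ
  refine ⟨C, fun φ hφ => ?_⟩
  have h1 : ∀ f : E N → ℝ, 0 ≤ ∫ x in simplex K, f x ^ 2 := fun f =>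
    integral_nonneg fun x => sq_nonneg _
  rw [eLpNorm_two_sq_eq (h.memLp_faceMeasure hN hτ hφ.continuous),
    eLpNorm_two_sq_eq (memLp_continuous_simplex K hφ.continuous)]
  simp_rw [fun i => eLpNorm_two_sq_eq
    (memLp_continuous_simplex K (continuous_classicalPartial hφ i))]
  rw [← ENNReal.ofReal_sum_of_nonneg fun i _ => h1 _, ← ENNReal.ofReal_add (h1 _)
    (Finset.sum_nonneg fun i _ => h1 _), ← ENNReal.ofReal_mul hC]
  exact ENNReal.ofReal_le_ofReal (hle φ hφ)

/-- The trace of an `H¹` function on a face does not depend on the approximating sequence. -/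
lemma H1Tendsto.tendsto_trace (𝒯 : Triangulation Ω) (hc : Convex ℝ Ω) (hN : 0 < N)
    {K τ : Finset (E N)} (hK : K ∈ 𝒯.elements) (hτ : τ ∈ facesOf K) {φ χ : ℕ → E N → ℝ}
    {v g : E N → ℝ} (hv : MemH1 Ω v) (hg : AEStronglyMeasurable g (faceMeasure τ))
    (h : H1Tendsto Ω φ v) (h' : H1Tendsto Ω χ v)
    (hχ : Tendsto (fun k => eLpNorm (χ k - g) 2 (faceMeasure τ)) atTop (𝓝 0)) :
    Tendsto (fun k => eLpNorm (φ k - g) 2 (faceMeasure τ)) atTop (𝓝 0) := by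
  obtain ⟨C, hC⟩ := (𝒯.isElement hK).exists_eLpNorm_trace_le hN hτ
  obtain ⟨h1, h2⟩ := h.sub_tendsto_zero hv h'
  have hmono : ∀ f : E N → ℝ, eLpNorm f 2 (volume.restrict (simplex K)) ≤
      eLpNorm f 2 (volume.restrict Ω) := fun f => eLpNorm_mono_measure f (𝒯.restrict_le hc hK)
  have h3 : Tendsto (fun k => ENNReal.ofReal C * (eLpNorm (φ k - χ k) 2 (volume.restrict Ω) ^ 2 +
      ∑ i, eLpNorm (classicalPartial i (φ k - χ k)) 2 (volume.restrict Ω) ^ 2)) atTop (𝓝 0) := by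
    have h4 : Tendsto (fun k => eLpNorm (φ k - χ k) 2 (volume.restrict Ω) ^ 2 +
      ∑ i, eLpNorm (classicalPartial i (φ k - χ k)) 2 (volume.restrict Ω) ^ 2) atTop
        (𝓝 (0 ^ 2 + ∑ _i : Fin N, 0 ^ 2)) :=
      (ENNReal.Tendsto.pow h1).add (tendsto_finsetSum _ fun i _ => ENNReal.Tendsto.pow (h2 i))
    have h5 := ENNReal.Tendsto.const_mul h4 (Or.inr (ENNReal.ofReal_ne_top (r := C)))
    simpa using h5
  have h6 : Tendsto (fun k => eLpNorm (φ k - χ k) 2 (faceMeasure τ) ^ 2) atTop (𝓝 0) := by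
    refine tendsto_of_tendsto_of_tendsto_of_le_of_le tendsto_const_nhds h3 (fun _ => bot_le)
      fun k => (hC _ ((h.1 k).sub (h'.1 k))).trans ?_
    gcongr
    · exact hmono _
    · exact hmono _
  have h7 : Tendsto (fun k => eLpNorm (φ k - χ k) 2 (faceMeasure τ)) atTop (𝓝 0) := by
    have h8 := (ENNReal.continuous_rpow_const (y := (2 : ℝ)⁻¹)).tendsto 0 |>.comp h6
    rw [ENNReal.zero_rpow_of_pos (by norm_num)] at h8
    refine h8.congr fun k => ?_
    rw [Function.comp_apply, ← ENNReal.rpow_natCast, ← ENNReal.rpow_mul]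
    norm_num
  refine tendsto_eLpNorm_congr (eLpNorm_tendsto_zero_add
    (fun k => ((h.1 k).sub (h'.1 k)).continuous.aestronglyMeasurable)
    (fun k => (h'.1 k).continuous.aestronglyMeasurable.sub hg) h7 hχ) fun k => ?_
  exact Filter.Eventually.of_forall fun x => by simp

/-- Translation along a vector orthogonal to all the normals changes no barycentric coordinate, so
the vector is zero. Hence normal derivatives on the faces of one element determine the whole
gradient. -/
lemma IsElement.span_outerNormal {K : Finset (E N)} (h : IsElement K) (hN : 0 < N) :
    Submodule.span ℝ (range fun a : K => outerNormal K (K.erase a)) = ⊤ := by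
  rw [← Submodule.orthogonal_eq_bot_iff, eq_bot_iff]
  intro d hd
  have := h.nontrivial hN
  have h1 : ∀ a, ⟪coordGrad h.basis a, d⟫ = 0 := by
    intro a
    obtain ⟨c, hca⟩ := exists_ne a
    have hG : ‖coordGrad h.basis a‖⁻¹ ≠ 0 :=
      inv_ne_zero (norm_ne_zero_iff.2 (coordGrad_ne_zero h.basis (Ne.symm hca)))
    have h2 := (Submodule.mem_orthogonal _ _).1 hd _ (Submodule.subset_span ⟨a, rfl⟩)
    simp only [h.outerNormal_eq hN, inner_neg_left, inner_smul_left, neg_eq_zero] at h2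
    exact (mul_eq_zero.1 h2).resolve_left (by simpa using hG)
  have h3 : (0 : E N) + d = 0 := by
    rw [← h.sum_coord_smul (0 + d)]
    conv_rhs => rw [← h.sum_coord_smul 0]
    exact Finset.sum_congr rfl fun a _ => by rw [coord_add, h1, add_zero]
  simpa using h3

lemma normalDeriv_single (w : E N → ℝ) (i : Fin N) :
    normalDeriv Ω (EuclideanSpace.single i 1) w = weakPartial Ω i w := by
  ext x
  simp [normalDeriv]

lemma MemH2.memH1_normalDeriv {w : E N → ℝ} (h : MemH2 Ω w) (n : E N) :
    MemH1 Ω (normalDeriv Ω n w) :=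
  memH1_sum Finset.univ (fun i => n i) h.2

/-- Smooth approximations of the normal derivatives on the faces of one element give smooth
approximations of the gradient. -/
lemma IsElement.exists_h1Tendsto_gradient (hΩ : IsOpen Ω) {K : Finset (E N)} (h : IsElement K)
    (hN : 0 < N) {w : E N → ℝ} (hw : MemH2 Ω w)
    (happ : ∀ τ ∈ facesOf K, ∃ θ, H1Tendsto Ω θ (normalDeriv Ω (outerNormal K τ) w)) :
    ∃ θ : Fin N → ℕ → E N → ℝ, ∀ i, H1Tendsto Ω (θ i) (weakPartial Ω i w) := by
  have h0 : ∀ a : K, ∃ θ, H1Tendsto Ω θ (normalDeriv Ω (outerNormal K (K.erase a)) w) :=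
    fun a => happ _ (h.erase_mem_facesOf a)
  choose θ hθ using h0
  have h1 : ∀ i, ∃ χ, H1Tendsto Ω χ (weakPartial Ω i w) := by
    intro i
    have h2 : EuclideanSpace.single i (1 : ℝ) ∈
        Submodule.span ℝ (range fun a : K => outerNormal K (K.erase a)) := by
      rw [h.span_outerNormal hN]; trivial
    obtain ⟨c, hc⟩ := (Submodule.mem_span_range_iff_exists_fun ℝ).1 h2
    have h3 := H1Tendsto.sum hΩ Finset.univ c (fun a : K => hw.memH1_normalDeriv _) hθ
    have h4 : (fun x => ∑ a : K, c a * normalDeriv Ω (outerNormal K (K.erase a)) w x) =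
        weakPartial Ω i w := by
      rw [← normalDeriv_single, ← hc]
      ext x
      simp only [normalDeriv, WithLp.ofLp_sum, WithLp.ofLp_smul, Finset.sum_apply, Pi.smul_apply,
        smul_eq_mul, Finset.mul_sum, Finset.sum_mul]
      rw [Finset.sum_comm]
      exact Finset.sum_congr rfl fun j _ => Finset.sum_congr rfl fun a _ => by ring
    rw [h4] at h3
    exact ⟨_, h3⟩
  choose χ hχ using h1
  exact ⟨χ, hχ⟩

end H1Sequences

/-! ### Angles and the number of elements in a patch -/

section Angles

variable {Ω : Set (E N)} (𝒯 : Triangulation Ω) {K K' : Finset (E N)} {v : E N}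

/-- The dilation factor works for all large `n`, not just for one, so that two cones with the same
apex can be compared at a common factor. -/
lemma coneAt_subset_iUnion (hv : v ∈ K) {x : E N} (hx : x ∈ coneAt K v) :
    ∃ n₀ : ℕ, ∀ n ≥ n₀, ∃ z ∈ simplex K, AffineMap.homothety v ((n : ℝ) + 1) z = x := by
  obtain ⟨r, hr, y, hy, rfl⟩ := hx
  obtain ⟨n₀, hn₀⟩ := exists_nat_ge r
  refine ⟨n₀, fun n hn => ?_⟩
  have hn' : r ≤ (n : ℝ) + 1 := by
    have : (n₀ : ℝ) ≤ n := by exact_mod_cast hn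
    linarith
  have hpos : (0 : ℝ) < n + 1 := by positivity
  refine ⟨v + (r / (n + 1)) • (y - v), (convex_simplex K).add_smul_sub_mem (subset_simplex hv) hy
    ⟨by positivity, (div_le_one hpos).2 hn'⟩, ?_⟩
  rw [AffineMap.homothety_apply, vsub_eq_sub, vadd_eq_add, add_sub_cancel_left, smul_smul,
    mul_div_cancel₀ _ hpos.ne', add_comm]

lemma coneAt_eq_iUnion (hv : v ∈ K) :
    coneAt K v = ⋃ n : ℕ, AffineMap.homothety v ((n : ℝ) + 1) '' simplex K := by
  ext x
  constructor
  · intro hx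
    obtain ⟨n, hn⟩ := coneAt_subset_iUnion hv hx
    exact mem_iUnion.2 ⟨n, hn n le_rfl⟩
  · intro hx
    obtain ⟨n, z, hz, rfl⟩ := mem_iUnion.1 hx
    exact ⟨n + 1, by positivity, z, hz, by
      rw [AffineMap.homothety_apply, vsub_eq_sub, vadd_eq_add, add_comm]⟩

lemma measurableSet_coneAt (hv : v ∈ K) : MeasurableSet (coneAt K v) := by
  rw [coneAt_eq_iUnion hv]
  exact MeasurableSet.iUnion fun n => ((isCompact_simplex K).image
    (AffineMap.homothety v ((n : ℝ) + 1)).continuous_of_finiteDimensional).measurableSet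

/-- A point of both cones lies in both elements after one common contraction towards `v`, so the
intersection is covered by countably many dilates of a null set. -/
lemma Triangulation.volume_inter_coneAt (hK : K ∈ 𝒯.elements) (hK' : K' ∈ 𝒯.elements)
    (hne : K ≠ K') (hv : v ∈ K) (hv' : v ∈ K') : volume (coneAt K v ∩ coneAt K' v) = 0 := by
  refine measure_mono_null (t := ⋃ n : ℕ, AffineMap.homothety v ((n : ℝ) + 1) ''
    (simplex K ∩ simplex K')) ?_ (measure_iUnion_null fun n => ?_)
  · rintro x ⟨hx, hx'⟩
    obtain ⟨n, hn⟩ := coneAt_subset_iUnion hv hx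
    obtain ⟨n', hn'⟩ := coneAt_subset_iUnion hv' hx'
    obtain ⟨z, hz, hzx⟩ := hn (max n n') (le_max_left _ _)
    obtain ⟨z', hz', hzx'⟩ := hn' (max n n') (le_max_right _ _)
    have hzz : z = z' := by
      have h1 := hzx.trans hzx'.symm
      simp only [AffineMap.homothety_apply, vsub_eq_sub, vadd_eq_add, add_left_inj] at h1
      have h2 := smul_right_injective (E N) (by positivity : ((max n n' : ℕ) : ℝ) + 1 ≠ 0) h1
      exact sub_left_injective h2
    exact mem_iUnion.2 ⟨max n n', z, ⟨hz, hzz ▸ hz'⟩, hzx⟩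
  · rw [Measure.addHaar_image_homothety, 𝒯.volume_inter_simplex hK hK' hne, mul_zero]

/-- The interior of the element, contracted towards `v` until it fits into the unit ball, is a set
of positive volume inside the sector. -/
lemma IsElement.angleAt_pos (h : IsElement K) (hN : 0 < N) (hv : v ∈ K) : 0 < angleAt K v := by
  obtain ⟨R, hR⟩ := (isCompact_simplex K).exists_bound_of_continuousOn
    (f := fun x => x - v) (by fun_prop)
  have hR0 : 0 ≤ R := (norm_nonneg _).trans (hR v (subset_simplex hv))
  have hδ : (0 : ℝ) < (R + 1)⁻¹ := by positivity
  have hsub : AffineMap.homothety v (R + 1)⁻¹ '' interior (simplex K) ⊆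
      coneAt K v ∩ Metric.ball v 1 := by
    rintro x ⟨y, hy, rfl⟩
    have hy' := interior_subset hy
    refine ⟨⟨(R + 1)⁻¹, hδ.le, y, hy', by
      rw [AffineMap.homothety_apply, vsub_eq_sub, vadd_eq_add, add_comm]⟩, ?_⟩
    rw [Metric.mem_ball, dist_eq_norm, AffineMap.homothety_apply, vsub_eq_sub, vadd_eq_add,
      add_sub_cancel_right, norm_smul, Real.norm_of_nonneg hδ.le, inv_mul_lt_iff₀ (by positivity)]
    linarith [hR y hy']
  have h1 : 0 < volume (AffineMap.homothety v (R + 1)⁻¹ '' interior (simplex K)) := by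
    rw [Measure.addHaar_image_homothety]
    refine ENNReal.mul_pos ?_ (isOpen_interior.measure_pos volume h.nonempty_interior).ne'
    rw [Ne, ENNReal.ofReal_eq_zero, not_le]
    positivity
  have h2 : volume (coneAt K v ∩ Metric.ball v 1) ≠ ⊤ :=
    ((measure_mono inter_subset_right).trans_lt measure_ball_lt_top).ne
  refine mul_pos (by exact_mod_cast hN) ?_
  exact ENNReal.toReal_pos (h1.trans_le (measure_mono hsub)).ne' h2

/-- The sectors at `v` overlap only in null sets and all lie in the unit ball about `v`. -/
lemma Triangulation.sum_angleAt_le (v : E N) :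
    ∑ K ∈ 𝒯.elements with v ∈ K, angleAt K v ≤ N * volume.real (Metric.ball (0 : E N) 1) := by
  have hfin : ∀ K : Finset (E N), volume (coneAt K v ∩ Metric.ball v 1) ≠ ⊤ := fun K =>
    ((measure_mono inter_subset_right).trans_lt measure_ball_lt_top).ne
  simp only [angleAt]
  rw [← Finset.mul_sum]
  refine mul_le_mul_of_nonneg_left ?_ (by positivity)
  have h1 : volume (⋃ K ∈ 𝒯.elements.filter (v ∈ ·), coneAt K v ∩ Metric.ball v 1) =
      ∑ K ∈ 𝒯.elements with v ∈ K, volume (coneAt K v ∩ Metric.ball v 1) := by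
    refine measure_biUnion_finset₀ ?_ fun K hK => ?_
    · intro K hK K' hK' hne
      rw [Finset.mem_coe, Finset.mem_filter] at hK hK'
      exact measure_mono_null (inter_subset_inter inter_subset_left inter_subset_left)
        (𝒯.volume_inter_coneAt hK.1 hK'.1 hne hK.2 hK'.2)
    · rw [Finset.mem_filter] at hK
      exact ((measurableSet_coneAt hK.2).inter Metric.isOpen_ball.measurableSet).nullMeasurableSet
  have h2 : volume (⋃ K ∈ 𝒯.elements.filter (v ∈ ·), coneAt K v ∩ Metric.ball v 1) ≤
      volume (Metric.ball (0 : E N) 1) := by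
    rw [← Measure.addHaar_ball_center volume v 1]
    exact measure_mono (iUnion₂_subset fun _ _ => inter_subset_right)
  simp only [Measure.real]
  rw [← ENNReal.toReal_sum fun K _ => hfin K, ← h1]
  exact ENNReal.toReal_mono measure_ball_lt_top.ne h2

lemma Triangulation.finite_angles :
    {θ | ∃ K ∈ 𝒯.elements, ∃ v ∈ K, θ = angleAt K v}.Finite := by
  refine Set.Finite.subset (Finset.finite_toSet (𝒯.elements.biUnion fun K => K.image (angleAt K)))
    ?_
  rintro θ ⟨K, hK, v, hv, rfl⟩
  simp only [Finset.coe_biUnion, mem_iUnion]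
  exact ⟨K, hK, by simpa using ⟨v, hv, rfl⟩⟩

lemma Triangulation.minAngle_le (hK : K ∈ 𝒯.elements) (hv : v ∈ K) :
    𝒯.minAngle ≤ angleAt K v :=
  csInf_le 𝒯.finite_angles.bddBelow ⟨K, hK, v, hv, rfl⟩

lemma Triangulation.elements_nonempty (hne : Ω.Nonempty) : 𝒯.elements.Nonempty := by
  obtain ⟨x, hx⟩ := hne
  have h1 := subset_closure hx
  rw [← 𝒯.iUnion_simplex] at h1
  obtain ⟨K, hK, _⟩ := mem_iUnion₂.1 h1
  exact ⟨K, hK⟩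

lemma Triangulation.minAngle_pos (hN : 0 < N) (hne : Ω.Nonempty) : 0 < 𝒯.minAngle := by
  obtain ⟨K, hK⟩ := 𝒯.elements_nonempty hne
  have hv : K.Nonempty := Finset.card_pos.1 (by rw [(𝒯.isElement hK).2]; omega)
  obtain ⟨v, hv⟩ := hv
  have hne' : {θ | ∃ K ∈ 𝒯.elements, ∃ v ∈ K, θ = angleAt K v}.Nonempty :=
    ⟨angleAt K v, K, hK, v, hv, rfl⟩
  have hmem := hne'.csInf_mem 𝒯.finite_angles
  obtain ⟨K', hK', v', hv', he⟩ := hmem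
  rw [Triangulation.minAngle, he]
  exact (𝒯.isElement hK').angleAt_pos hN hv'

open Classical in
/-- The number of elements meeting a given one is bounded in terms of the minimum angle. -/
lemma Triangulation.card_patch_le (hN : 0 < N) (hne : Ω.Nonempty) (hK : K ∈ 𝒯.elements) :
    (((𝒯.elements.filter fun K' => (simplex K ∩ simplex K').Nonempty).card : ℕ) : ℝ) ≤
      (N + 1) * (N * volume.real (Metric.ball (0 : E N) 1)) / 𝒯.minAngle := by
  have hθ := 𝒯.minAngle_pos hN hne
  have hvert : ∀ v : E N, ((𝒯.elements.filter (v ∈ ·)).card : ℝ) ≤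
      N * volume.real (Metric.ball (0 : E N) 1) / 𝒯.minAngle := by
    intro v
    rw [le_div_iff₀ hθ]
    refine le_trans ?_ (𝒯.sum_angleAt_le v)
    rw [← nsmul_eq_mul]
    refine Finset.card_nsmul_le_sum _ _ _ fun K hK => ?_
    rw [Finset.mem_filter] at hK
    exact 𝒯.minAngle_le hK.1 hK.2
  -- By conformity two elements that meet share a vertex, so counting elements at each of the `N +
  -- 1` vertices of `K` suffices.
  have hsub : 𝒯.elements.filter (fun K' => (simplex K ∩ simplex K').Nonempty) ⊆
      K.biUnion fun v => 𝒯.elements.filter (v ∈ ·) := by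
    intro K' hK'
    rw [Finset.mem_filter] at hK'
    rw [𝒯.inter_simplex hK hK'.1, convexHull_nonempty_iff] at hK'
    obtain ⟨v, hv, hv'⟩ := hK'.2
    rw [Finset.mem_biUnion]
    exact ⟨v, hv, Finset.mem_filter.2 ⟨hK'.1, hv'⟩⟩
  calc _ ≤ ((K.biUnion fun v => 𝒯.elements.filter (v ∈ ·)).card : ℝ) := by
        exact_mod_cast Finset.card_le_card hsub
    _ ≤ ∑ v ∈ K, ((𝒯.elements.filter (v ∈ ·)).card : ℝ) := by
        exact_mod_cast Finset.card_biUnion_le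
    _ ≤ ∑ _v ∈ K, N * volume.real (Metric.ball (0 : E N) 1) / 𝒯.minAngle :=
        Finset.sum_le_sum fun v _ => hvert v
    _ = _ := by
        rw [Finset.sum_const, (𝒯.isElement hK).2, nsmul_eq_mul]
        push_cast
        ring

end Angles

/-! ### Local `H²` norms -/

section LocalNorms

variable {Ω : Set (E N)} {ψ : E N → ℝ}

lemma l2Norm_sq {μ : Measure (E N)} {w : E N → ℝ} (hw : MemLp w 2 μ) :
    l2Norm μ w ^ 2 = ∫ x, w x ^ 2 ∂μ := by
  rw [l2Norm, ← ENNReal.toReal_pow, eLpNorm_two_sq_eq hw,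
    ENNReal.toReal_ofReal (integral_nonneg fun x => sq_nonneg _)]

lemma l2Norm_nonneg (μ : Measure (E N)) (w : E N → ℝ) : 0 ≤ l2Norm μ w := ENNReal.toReal_nonneg

/-- The sum of the squares of the derivatives of order at most two. -/
def h2Density (Ω : Set (E N)) (ψ : E N → ℝ) (x : E N) : ℝ :=
  ψ x ^ 2 + (∑ i, weakPartial Ω i ψ x ^ 2)
    + ∑ i, ∑ j with i ≤ j, weakPartial Ω i (weakPartial Ω j ψ) x ^ 2

lemma h2Density_nonneg (Ω : Set (E N)) (ψ : E N → ℝ) (x : E N) : 0 ≤ h2Density Ω ψ x := by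
  unfold h2Density
  positivity

lemma integrable_h2Density (hψ : MemH2 Ω ψ) : Integrable (h2Density Ω ψ) (volume.restrict Ω) := by
  refine (hψ.1.1.integrable_sq.add (integrable_finsetSum _ fun i _ =>
    (hψ.1.memLp_weakPartial i).integrable_sq)).add (integrable_finsetSum _ fun i _ =>
      integrable_finsetSum _ fun j _ => ((hψ.2 j).memLp_weakPartial i).integrable_sq)

lemma h2Norm_nonneg (Ω A : Set (E N)) (ψ : E N → ℝ) : 0 ≤ h2Norm Ω A ψ := Real.sqrt_nonneg _

lemma h2Norm_sq (hψ : MemH2 Ω ψ) (A : Set (E N)) :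
    h2Norm Ω A ψ ^ 2 = ∫ x in A ∩ Ω, h2Density Ω ψ x := by
  have hle : (volume.restrict (A ∩ Ω) : Measure (E N)) ≤ volume.restrict Ω :=
    Measure.restrict_mono_set _ inter_subset_right
  have h0 := hψ.1.1.mono_measure hle
  have h1 := fun i => (hψ.1.memLp_weakPartial i).mono_measure hle
  have h2 := fun i j => ((hψ.2 j).memLp_weakPartial i).mono_measure hle
  rw [h2Norm, Real.sq_sqrt (by positivity), l2Norm_sq h0]
  simp_rw [fun i => l2Norm_sq (h1 i), fun i j => l2Norm_sq (h2 i j)]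
  unfold h2Density
  have i1 : Integrable (fun x => ∑ i, weakPartial Ω i ψ x ^ 2) (volume.restrict (A ∩ Ω)) :=
    integrable_finsetSum _ fun i _ => (h1 i).integrable_sq
  have i2 : Integrable (fun x => ∑ i, ∑ j with i ≤ j, weakPartial Ω i (weakPartial Ω j ψ) x ^ 2)
      (volume.restrict (A ∩ Ω)) :=
    integrable_finsetSum _ fun i _ => integrable_finsetSum _ fun j _ => (h2 i j).integrable_sq
  have i3 : Integrable (fun x => ψ x ^ 2 + ∑ i, weakPartial Ω i ψ x ^ 2)
      (volume.restrict (A ∩ Ω)) := h0.integrable_sq.add i1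
  rw [integral_add i3 i2, integral_add h0.integrable_sq i1,
    integral_finsetSum _ fun i _ => (h1 i).integrable_sq,
    integral_finsetSum _ fun i _ => integrable_finsetSum _ fun j _ => (h2 i j).integrable_sq]
  simp_rw [fun i => integral_finsetSum (Finset.univ.filter fun j => i ≤ j)
    fun j _ => (h2 i j).integrable_sq]

lemma h2Norm_mono (hψ : MemH2 Ω ψ) {A B : Set (E N)} (hAB : A ⊆ B) :
    h2Norm Ω A ψ ≤ h2Norm Ω B ψ := by
  refine le_of_sq_le_sq ?_ (h2Norm_nonneg _ _ _)
  rw [h2Norm_sq hψ, h2Norm_sq hψ]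
  refine integral_mono_measure (Measure.restrict_mono_set _ (inter_subset_inter_left Ω hAB))
    (Filter.Eventually.of_forall fun x => h2Density_nonneg Ω ψ x)
    ((integrable_h2Density hψ).mono_measure (Measure.restrict_mono_set _ inter_subset_right))

variable (𝒯 : Triangulation Ω)

lemma Triangulation.patch_mono {s t : Finset (E N)} (h : s ⊆ t) : 𝒯.patch s ⊆ 𝒯.patch t := by
  refine biUnion_subset_biUnion_left fun K hK => ⟨hK.1, ?_⟩
  exact hK.2.mono (inter_subset_inter_right _ (simplex_mono h))

lemma Triangulation.measurableSet_patch (s : Finset (E N)) : MeasurableSet (𝒯.patch s) :=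
  MeasurableSet.biUnion ((𝒯.elements.finite_toSet.subset fun _ h => h.1).countable)
    fun K _ => measurableSet_simplex K

-- An element that does not meet `K` intersects the patch in a null set only; the others contribute
-- at most their whole integral.
open Classical in
lemma Triangulation.h2Norm_patch_sq_le (hc : Convex ℝ Ω) (hψ : MemH2 Ω ψ) {K : Finset (E N)} :
    h2Norm Ω (𝒯.patch K) ψ ^ 2 ≤
      ∑ K' ∈ 𝒯.elements.filter (fun K' => (simplex K' ∩ simplex K).Nonempty),
        ∫ x in simplex K', h2Density Ω ψ x := by
  have hint := integrable_h2Density hψ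
  have hm := 𝒯.measurableSet_patch K
  rw [h2Norm_sq hψ, ← Measure.restrict_restrict hm, ← integral_indicator hm,
    𝒯.integral_eq_sum hc (hint.indicator hm), Finset.sum_filter]
  refine Finset.sum_le_sum fun K' hK' => ?_
  split_ifs with hmeet
  · have hK'int := hint.mono_measure (𝒯.restrict_le hc hK')
    exact integral_mono (hK'int.indicator hm) hK'int
      (indicator_le_self' fun x _ => h2Density_nonneg Ω ψ x)
  · refine le_of_eq (integral_eq_zero_of_ae ?_)
    have hnull : volume (𝒯.patch K ∩ simplex K') = 0 := by
      rw [Triangulation.patch, iUnion₂_inter]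
      refine (measure_biUnion_null_iff
        ((𝒯.elements.finite_toSet.subset fun _ h => h.1).countable)).2 fun K'' hK'' => ?_
      refine 𝒯.volume_inter_simplex hK''.1 hK' ?_
      rintro rfl
      exact hmeet hK''.2
    have hae : ∀ᵐ x ∂(volume.restrict (simplex K')), x ∉ 𝒯.patch K := by
      rw [ae_iff]
      simp only [not_not]
      rw [Measure.restrict_apply' (measurableSet_simplex K')]
      exact hnull
    filter_upwards [hae] with x hx
    rw [indicator_of_notMem hx]
    rfl

/-- After exchanging the sums, the integral over `K'` is counted once for every element meeting
`K'`, and `Triangulation.card_patch_le` bounds that number. -/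
lemma Triangulation.sum_h2Norm_patch_le (hN : 0 < N) (hne : Ω.Nonempty) (hc : Convex ℝ Ω)
    (hψ : MemH2 Ω ψ) : ∑ K ∈ 𝒯.elements, h2Norm Ω (𝒯.patch K) ψ ^ 2 ≤
      (N + 1) * (N * volume.real (Metric.ball (0 : E N) 1)) / 𝒯.minAngle * h2Norm Ω Ω ψ ^ 2 := by
  classical
  have hint := integrable_h2Density hψ
  have h0 : ∀ K : Finset (E N), 0 ≤ ∫ x in simplex K, h2Density Ω ψ x := fun K =>
    integral_nonneg fun x => h2Density_nonneg Ω ψ x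
  calc ∑ K ∈ 𝒯.elements, h2Norm Ω (𝒯.patch K) ψ ^ 2
      ≤ ∑ K ∈ 𝒯.elements, ∑ K' ∈ 𝒯.elements,
          if (simplex K' ∩ simplex K).Nonempty then ∫ x in simplex K', h2Density Ω ψ x else 0 :=
        Finset.sum_le_sum fun K _ => (𝒯.h2Norm_patch_sq_le hc hψ).trans_eq
          (Finset.sum_filter _ _)
    _ = ∑ K' ∈ 𝒯.elements, (((𝒯.elements.filter fun K =>
          (simplex K' ∩ simplex K).Nonempty).card : ℕ) : ℝ) *
            ∫ x in simplex K', h2Density Ω ψ x := by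
        rw [Finset.sum_comm]
        refine Finset.sum_congr rfl fun K' _ => ?_
        rw [← Finset.sum_filter, Finset.sum_const, nsmul_eq_mul]
    _ ≤ ∑ K' ∈ 𝒯.elements, (N + 1) * (N * volume.real (Metric.ball (0 : E N) 1)) / 𝒯.minAngle *
            ∫ x in simplex K', h2Density Ω ψ x :=
        Finset.sum_le_sum fun K' hK' =>
          mul_le_mul_of_nonneg_right (𝒯.card_patch_le hN hne hK') (h0 K')
    _ = _ := by
        rw [← Finset.mul_sum, h2Norm_sq hψ, inter_self, 𝒯.integral_eq_sum hc hint]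

end LocalNorms

/-! ### The time derivative of a discrete solution -/

/-- The time derivative of a curve in a finite-dimensional space of functions is in that space. -/
lemma exists_timeDeriv_eq {A : Set (E N)} {S : Submodule ℝ (E N → ℝ)} [FiniteDimensional ℝ S]
    {T t : ℝ} (ht : t ∈ Ioc 0 T) {u : ℝ → E N → ℝ} (hu : ∀ s ∈ Icc 0 T, u s ∈ S)
    (hd : ∀ x ∈ A, DifferentiableWithinAt ℝ (fun s => u s x) (Icc 0 T) t) :
    ∃ v ∈ S, ∀ x ∈ A, timeDeriv T u t x = v x := by
  set R : (E N → ℝ) →ₗ[ℝ] (A → ℝ) := LinearMap.funLeft ℝ ℝ Subtype.val with hR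
  have ht' : t ∈ Icc 0 T := ⟨ht.1.le, ht.2⟩
  -- Restricting to `A` leaves a finite-dimensional, hence closed, subspace for the topology of
  -- pointwise convergence, so pointwise limits of difference quotients stay in it.
  have hclosed : IsClosed ((S.map R : Submodule ℝ (A → ℝ)) : Set (A → ℝ)) :=
    Submodule.closed_of_finiteDimensional _
  have hlim : Tendsto (fun s => (s - t)⁻¹ • (R (u s) - R (u t))) (𝓝[Icc 0 T \ {t}] t)
      (𝓝 (fun x : A => timeDeriv T u t x)) := by
    rw [tendsto_pi_nhds]
    intro x
    have h1 := (hasDerivWithinAt_iff_tendsto_slope).1 (hd x x.2).hasDerivWithinAt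
    refine h1.congr fun s => ?_
    rw [slope_def_field, div_eq_inv_mul]
    rfl
  -- Since `0 < t ≤ T`, the interval is nondegenerate and `t` is an accumulation point of it.
  have hbot : (𝓝[Icc 0 T \ {t}] t).NeBot := by
    have h2 : UniqueDiffWithinAt ℝ (Icc 0 T) t :=
      uniqueDiffOn_Icc (ht.1.trans_le ht.2) t ht'
    rw [← accPt_principal_iff_nhdsWithin]
    exact h2.accPt
  have hmem : (fun x : A => timeDeriv T u t x) ∈ S.map R := by
    refine hclosed.mem_of_tendsto hlim ?_
    filter_upwards [self_mem_nhdsWithin] with s hs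
    exact Submodule.smul_mem _ _ (Submodule.sub_mem _
      (Submodule.mem_map_of_mem (hu s hs.1)) (Submodule.mem_map_of_mem (hu t ht')))
  obtain ⟨v, hv, he⟩ := hmem
  exact ⟨v, hv, fun x hx => (congrFun he ⟨x, hx⟩).symm⟩

/-! ### Piecewise polynomial functions -/

lemma contDiff_eval (p : MvPolynomial (Fin N) ℝ) :
    ContDiff ℝ ∞ (fun x : E N => MvPolynomial.eval (fun i => x i) p) := by
  induction p using MvPolynomial.induction_on with
  | C a => simpa using contDiff_const
  | add p q hp hq => simpa using hp.add hq
  | mul_X p i hp => simpa using hp.mul (contDiff_apply_E i)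

lemma contDiff_restrictTo (K : Finset (E N)) (v : E N → ℝ) : ContDiff ℝ ∞ (restrictTo K v) := by
  unfold restrictTo
  split_ifs with h
  · exact contDiff_eval _
  · exact contDiff_const

lemma restrictTo_eqOn {K : Finset (E N)} {v : E N → ℝ} (h : ∃ p, IsPolyOn K v p) :
    EqOn v (restrictTo K v) (simplex K) := by
  intro x hx
  rw [restrictTo, dif_pos h]
  exact h.choose_spec x hx

lemma laplacian_eq_sum {f : E N → ℝ} (hf : ContDiff ℝ ∞ f) :
    Laplacian.laplacian f = fun x => ∑ i, classicalPartial i (classicalPartial i f) x := by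
  rw [InnerProductSpace.laplacian_eq_iteratedFDeriv_orthonormalBasis f
    (EuclideanSpace.basisFun (Fin N) ℝ)]
  ext x
  refine Finset.sum_congr rfl fun i _ => ?_
  have h2 : DifferentiableAt ℝ (fderiv ℝ f) x :=
    (hf.fderiv_right (m := ∞) (by simp)).differentiable (by simp) x
  have h3 : classicalPartial i f = fun y => fderiv ℝ f y (EuclideanSpace.single i 1) := rfl
  rw [iteratedFDeriv_two_apply, h3, classicalPartial,
    fderiv_clm_apply h2 (differentiableAt_const _)]
  simp

lemma contDiff_laplacian {f : E N → ℝ} (hf : ContDiff ℝ ∞ f) :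
    ContDiff ℝ ∞ (Laplacian.laplacian f) := by
  rw [laplacian_eq_sum hf]
  exact ContDiff.sum fun i _ => contDiff_classicalPartial (contDiff_classicalPartial hf i) i

lemma contDiff_elementLaplacian (K : Finset (E N)) (v : E N → ℝ) :
    ContDiff ℝ ∞ (elementLaplacian K v) := contDiff_laplacian (contDiff_restrictTo K v)

lemma fderiv_apply_eq_sum (f : E N → ℝ) (x n : E N) :
    fderiv ℝ f x n = ∑ i, n i * classicalPartial i f x := by
  have h := (EuclideanSpace.basisFun (Fin N) ℝ).sum_repr n
  conv_lhs => rw [← h]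
  simp [classicalPartial]

variable {Ω : Set (E N)} {𝒯 : Triangulation Ω}

lemma Triangulation.weakLaplacian_ae_eq (ho : IsOpen Ω) (hc : Convex ℝ Ω) {K : Finset (E N)}
    (hK : K ∈ 𝒯.elements) {w p : E N → ℝ} (hw : MemH2 Ω w) (hp : ContDiff ℝ ∞ p)
    (hwp : EqOn w p (simplex K)) :
    weakLaplacian Ω w =ᵐ[volume.restrict (simplex K)] Laplacian.laplacian p := by
  have h0 : w =ᵐ[volume.restrict (simplex K)] p := by
    filter_upwards [ae_restrict_mem (measurableSet_simplex K)] with x hx using hwp hx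
  have h1 : ∀ᵐ x ∂(volume.restrict (simplex K)), ∀ i,
      weakPartial Ω i (weakPartial Ω i w) x = classicalPartial i (classicalPartial i p) x :=
    ae_all_iff.2 fun i => 𝒯.weakPartial_ae_eq ho hc hK ((hw.2 i).2 i)
      (contDiff_classicalPartial hp i) (𝒯.weakPartial_ae_eq ho hc hK (hw.1.2 i) hp h0)
  rw [laplacian_eq_sum hp]
  filter_upwards [h1] with x hx
  simp only [weakLaplacian, hx]

lemma IsPiecewiseSmooth.of_poly {v : E N → ℝ} (h : ∀ K ∈ 𝒯.elements, ∃ p, IsPolyOn K v p) :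
    IsPiecewiseSmooth 𝒯 v :=
  fun K hK => ⟨_, contDiff_restrictTo K v, restrictTo_eqOn (h K hK)⟩

lemma IsPiecewiseSmooth.comp {v : E N → ℝ} (h : IsPiecewiseSmooth 𝒯 v) {f : ℝ → ℝ}
    (hf : ContDiff ℝ ∞ f) : IsPiecewiseSmooth 𝒯 (fun x => f (v x)) := fun K hK => by
  obtain ⟨p, hp, hvp⟩ := h K hK
  exact ⟨fun x => f (p x), hf.comp hp, fun x hx => by simp only [hvp hx]⟩

lemma IsPiecewiseSmooth.mul {v w : E N → ℝ} (h : IsPiecewiseSmooth 𝒯 v)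
    (h' : IsPiecewiseSmooth 𝒯 w) : IsPiecewiseSmooth 𝒯 (fun x => v x * w x) := fun K hK => by
  obtain ⟨p, hp, hvp⟩ := h K hK
  obtain ⟨q, hq, hwq⟩ := h' K hK
  exact ⟨fun x => p x * q x, hp.mul hq, fun x hx => by simp only [hvp hx, hwq hx]⟩

lemma isPiecewiseSmooth_of_contDiff {v : E N → ℝ} (h : ContDiff ℝ ∞ v) : IsPiecewiseSmooth 𝒯 v :=
  fun _ _ => ⟨v, h, fun _ _ => rfl⟩

lemma contDiff_deriv {F : ℝ → ℝ} (hF : ContDiff ℝ ∞ F) : ContDiff ℝ ∞ (deriv F) :=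
  (contDiff_infty_iff_deriv.1 hF).2

lemma classicalPartial_comp {f : ℝ → ℝ} (hf : ContDiff ℝ ∞ f) {p : E N → ℝ}
    (hp : ContDiff ℝ ∞ p) (i : Fin N) (x : E N) :
    classicalPartial i (fun y => f (p y)) x = deriv f (p x) * classicalPartial i p x := by
  have h1 : HasDerivAt f (deriv f (p x)) (p x) := (hf.differentiable (by simp) _).hasDerivAt
  have h2 := (differentiableAt_of_contDiff hp x).hasFDerivAt
  unfold classicalPartial
  have h3 := (h1.comp_hasFDerivAt x h2).fderiv
  have h4 : (fun y => f (p y)) = f ∘ p := rfl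
  rw [h4, h3]
  simp

/-! ### Jumps across faces -/

lemma continuous_jumpLaplacian (𝒯 : Triangulation Ω) (v : E N → ℝ) (K τ : Finset (E N)) :
    Continuous (jumpLaplacian 𝒯 v K τ) := by
  unfold jumpLaplacian
  split_ifs with h
  · exact (contDiff_elementLaplacian _ v).continuous.sub (contDiff_elementLaplacian _ v).continuous
  · exact (contDiff_elementLaplacian _ v).continuous.const_mul 2

lemma continuous_jumpNormal (𝒯 : Triangulation Ω) (v : E N → ℝ) (K τ : Finset (E N)) :
    Continuous (jumpNormal 𝒯 v K τ) := by
  have h0 : ∀ K' n, Continuous fun x => fderiv ℝ (elementLaplacian K' v) x n := fun K' n =>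
    ((contDiff_elementLaplacian K' v).continuous_fderiv (by simp)).clm_apply continuous_const
  unfold jumpNormal
  split_ifs with h
  · exact (h0 _ _).sub (h0 _ _)
  · exact (h0 _ _).const_mul (-2)

/-- The contributions of the two elements at a face to Green's formula. -/
lemma Triangulation.half_sum_eq_jumpLaplacian (𝒯 : Triangulation Ω) (hN : 0 < N)
    {K τ : Finset (E N)} (hK : K ∈ 𝒯.elements) (hτ : τ ∈ facesOf K) (v : E N → ℝ)
    {Y : Fin N → E N → ℝ} (hY : ∀ i, Continuous (Y i)) :
    ((∫ x, ∑ i, outerNormal K τ i * (elementLaplacian K v x * Y i x) ∂(faceMeasure τ)) +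
      ∫ x, ∑ i, outerNormal (𝒯.across K τ) τ i *
        (elementLaplacian (𝒯.across K τ) v x * Y i x) ∂(faceMeasure τ)) / 2 =
      2⁻¹ * ∫ x, jumpLaplacian 𝒯 v K τ x * ∑ i, outerNormal K τ i * Y i x ∂(faceMeasure τ) := by
  have hint : ∀ (K' : Finset (E N)) (n : E N), Integrable
      (fun x => ∑ i, n i * (elementLaplacian K' v x * Y i x)) (faceMeasure τ) := fun K' n =>
    (𝒯.isElement hK).integrable_faceMeasure hN hτ (continuous_finsetSum _ fun i _ =>
      ((contDiff_elementLaplacian K' v).continuous.mul (hY i)).const_mul _)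
  rw [← integral_add (hint _ _) (hint _ _), div_eq_inv_mul]
  congr 1
  refine integral_congr_ae (Filter.Eventually.of_forall fun x => ?_)
  simp only
  -- With a neighbour, the opposite normals turn the sum into a difference. Without one, `across`
  -- returns `K` itself and the two equal terms match the factor 2 in the boundary jump.
  unfold jumpLaplacian Triangulation.across
  split_ifs with h
  · rw [𝒯.outerNormal_neighbour hN hK hτ h.choose_spec, Finset.mul_sum, ← Finset.sum_add_distrib]
    refine Finset.sum_congr rfl fun i _ => ?_
    simp only [PiLp.neg_apply]
    ring
  · rw [Finset.mul_sum, ← Finset.sum_add_distrib]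
    exact Finset.sum_congr rfl fun i _ => by ring

/-- Counterpart of `Triangulation.half_sum_eq_jumpLaplacian` for the fluxes of `∇Δv`. The minus sign
appears because `jumpNormal` subtracts the value on `K` from that on the neighbour, or carries `-2`
on the boundary. -/
lemma Triangulation.half_sum_eq_jumpNormal (𝒯 : Triangulation Ω) (hN : 0 < N)
    {K τ : Finset (E N)} (hK : K ∈ 𝒯.elements) (hτ : τ ∈ facesOf K) (v : E N → ℝ)
    {φ : E N → ℝ} (hφ : Continuous φ) :
    ((∫ x, ∑ i, outerNormal K τ i *
        (classicalPartial i (elementLaplacian K v) x * φ x) ∂(faceMeasure τ)) +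
      ∫ x, ∑ i, outerNormal (𝒯.across K τ) τ i *
        (classicalPartial i (elementLaplacian (𝒯.across K τ) v) x * φ x) ∂(faceMeasure τ)) / 2 =
      -(2⁻¹ * ∫ x, jumpNormal 𝒯 v K τ x * φ x ∂(faceMeasure τ)) := by
  have hint : ∀ (K' : Finset (E N)) (n : E N), Integrable
      (fun x => ∑ i, n i * (classicalPartial i (elementLaplacian K' v) x * φ x)) (faceMeasure τ) :=
    fun K' n => (𝒯.isElement hK).integrable_faceMeasure hN hτ (continuous_finsetSum _ fun i _ =>
      ((continuous_classicalPartial (contDiff_elementLaplacian K' v) i).mul hφ).const_mul _)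
  rw [← integral_add (hint _ _) (hint _ _), div_eq_inv_mul, ← mul_neg, ← integral_neg]
  congr 1
  refine integral_congr_ae (Filter.Eventually.of_forall fun x => ?_)
  simp only
  have hs : ∀ (K' : Finset (E N)) (n : E N),
      ∑ i, n i * (classicalPartial i (elementLaplacian K' v) x * φ x) =
        fderiv ℝ (elementLaplacian K' v) x n * φ x := fun K' n => by
    rw [fderiv_apply_eq_sum, Finset.sum_mul]
    exact Finset.sum_congr rfl fun i _ => by ring
  rw [hs, hs]
  unfold jumpNormal Triangulation.across
  split_ifs with h
  · rw [𝒯.outerNormal_neighbour hN hK hτ h.choose_spec, map_neg]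
    ring
  · ring

/-! ### Green's formula on the mesh, for smooth functions -/

lemma integrable_simplex_mul (K : Finset (E N)) {f g : E N → ℝ} (hf : Continuous f)
    (hg : Continuous g) : Integrable (fun x => f x * g x) (volume.restrict (simplex K)) :=
  integrable_simplex K (hf.mul hg)

/-- The divergence theorem for `Δv|_K` times `Y` on each element. Since `Y` is smooth on the whole
space, both sides of a face see the same `Y`, and only `Δv` jumps. -/
lemma Triangulation.sum_integral_mul_divergence (𝒯 : Triangulation Ω) (hN : 0 < N) (v : E N → ℝ)
    {Y : Fin N → E N → ℝ} (hY : ∀ i, ContDiff ℝ ∞ (Y i)) :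
    ∑ K ∈ 𝒯.elements, ((∑ i, ∫ x in simplex K, elementLaplacian K v x * classicalPartial i (Y i) x)
      + ∑ i, ∫ x in simplex K, classicalPartial i (elementLaplacian K v) x * Y i x) =
    ∑ K ∈ 𝒯.elements, ∑ τ ∈ facesOf K, 2⁻¹ *
      ∫ x, jumpLaplacian 𝒯 v K τ x * ∑ i, outerNormal K τ i * Y i x ∂(faceMeasure τ) := by
  have h1 : ∀ K ∈ 𝒯.elements,
      (∑ i, ∫ x in simplex K, elementLaplacian K v x * classicalPartial i (Y i) x)
      + ∑ i, ∫ x in simplex K, classicalPartial i (elementLaplacian K v) x * Y i x =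
      ∑ τ ∈ facesOf K, ∫ x, ∑ i, outerNormal K τ i * (elementLaplacian K v x * Y i x)
        ∂(faceMeasure τ) := by
    intro K hK
    have hq := contDiff_elementLaplacian K v
    rw [← (𝒯.isElement hK).integral_divergence hN fun i => hq.mul (hY i),
      ← Finset.sum_add_distrib, integral_finsetSum _ fun i _ =>
      integrable_simplex K (continuous_classicalPartial (hq.mul (hY i)) i)]
    refine Finset.sum_congr rfl fun i _ => ?_
    rw [← integral_add
      (integrable_simplex_mul K hq.continuous (continuous_classicalPartial (hY i) i))
      (integrable_simplex_mul K (continuous_classicalPartial hq i) (hY i).continuous)]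
    refine integral_congr_ae (Filter.Eventually.of_forall fun x => ?_)
    simp only
    rw [classicalPartial_mul (differentiableAt_of_contDiff hq x)
      (differentiableAt_of_contDiff (hY i) x)]
    ring
  rw [Finset.sum_congr rfl h1, 𝒯.sum_faces_eq hN]
  exact Finset.sum_congr rfl fun K hK => Finset.sum_congr rfl fun τ hτ =>
    𝒯.half_sum_eq_jumpLaplacian hN hK hτ v fun i => (hY i).continuous

/-- The divergence theorem for the field `φ ∇Δv|_K`, with the faces averaged over their two sides.
-/
lemma Triangulation.sum_integral_laplacian_mul (𝒯 : Triangulation Ω) (hN : 0 < N) (v : E N → ℝ)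
    {φ : E N → ℝ} (hφ : ContDiff ℝ ∞ φ) :
    ∑ K ∈ 𝒯.elements, ((∫ x in simplex K, Laplacian.laplacian (elementLaplacian K v) x * φ x)
      + ∑ i, ∫ x in simplex K, classicalPartial i (elementLaplacian K v) x
        * classicalPartial i φ x) =
    ∑ K ∈ 𝒯.elements, ∑ τ ∈ facesOf K, -(2⁻¹ *
      ∫ x, jumpNormal 𝒯 v K τ x * φ x ∂(faceMeasure τ)) := by
  have h1 : ∀ K ∈ 𝒯.elements,
      (∫ x in simplex K, Laplacian.laplacian (elementLaplacian K v) x * φ x)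
      + ∑ i, ∫ x in simplex K, classicalPartial i (elementLaplacian K v) x
        * classicalPartial i φ x =
      ∑ τ ∈ facesOf K, ∫ x, ∑ i, outerNormal K τ i *
        (classicalPartial i (elementLaplacian K v) x * φ x) ∂(faceMeasure τ) := by
    intro K hK
    have hq := contDiff_elementLaplacian K v
    have hq' := fun i => contDiff_classicalPartial hq i
    rw [← (𝒯.isElement hK).integral_divergence hN fun i => (hq' i).mul hφ,
      ← integral_finsetSum _ fun i _ => integrable_simplex_mul K
        (hq' i).continuous (continuous_classicalPartial hφ i), ← integral_add
      (integrable_simplex_mul K (contDiff_laplacian hq).continuous hφ.continuous)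
      (integrable_finsetSum _ fun i _ => integrable_simplex_mul K
        (hq' i).continuous (continuous_classicalPartial hφ i))]
    refine integral_congr_ae (Filter.Eventually.of_forall fun x => ?_)
    simp only
    rw [laplacian_eq_sum hq, Finset.sum_mul, ← Finset.sum_add_distrib]
    refine Finset.sum_congr rfl fun i _ => ?_
    rw [classicalPartial_mul (differentiableAt_of_contDiff (hq' i) x)
      (differentiableAt_of_contDiff hφ x)]
  rw [Finset.sum_congr rfl h1, 𝒯.sum_faces_eq hN]
  exact Finset.sum_congr rfl fun K hK => Finset.sum_congr rfl fun τ hτ =>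
    𝒯.half_sum_eq_jumpNormal hN hK hτ v hφ.continuous

/-! ### Green's formula on the mesh, for functions with traces -/

/-- `L²(Ω)` convergence passes to integrals over elements. -/
lemma Triangulation.tendsto_integral_mul (𝒯 : Triangulation Ω) (hc : Convex ℝ Ω)
    {K : Finset (E N)} (hK : K ∈ 𝒯.elements) {q f : E N → ℝ} {φ : ℕ → E N → ℝ}
    (hq : Continuous q) (hf : MemLp f 2 (volume.restrict Ω)) (hφ : ∀ k, Continuous (φ k))
    (h : Tendsto (fun k => eLpNorm (φ k - f) 2 (volume.restrict Ω)) atTop (𝓝 0)) :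
    Tendsto (fun k => ∫ x in simplex K, q x * φ k x) atTop
      (𝓝 (∫ x in simplex K, q x * f x)) :=
  tendsto_integral_mul_of_eLpNorm (memLp_continuous_simplex K hq)
    (hf.mono_measure (𝒯.restrict_le hc hK)) (fun k => memLp_continuous_simplex K (hφ k))
    (tendsto_of_tendsto_of_tendsto_of_le_of_le tendsto_const_nhds h (fun _ => bot_le)
      fun _ => eLpNorm_mono_measure _ (𝒯.restrict_le hc hK))

/-- Take `Y` to be smooth approximations of `∇w` and pass to the limit. They come from the traces on
the faces of a single element `K₀`; `H1Tendsto.tendsto_trace` ensures that they also produce the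
prescribed traces on all other faces. -/
lemma Triangulation.sum_integral_mul_weakLaplacian (𝒯 : Triangulation Ω) (hN : 0 < N)
    (hc : Convex ℝ Ω) (ho : IsOpen Ω) (hne : Ω.Nonempty) (v : E N → ℝ) {w : E N → ℝ}
    (hw : MemH2 Ω w) {g : Finset (E N) → Finset (E N) → E N → ℝ}
    (hg : ∀ K ∈ 𝒯.elements, ∀ τ ∈ facesOf K,
      HasTrace Ω τ (normalDeriv Ω (outerNormal K τ) w) (g K τ)) :
    ∑ K ∈ 𝒯.elements, ((∫ x in simplex K, elementLaplacian K v x * weakLaplacian Ω w x)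
      + ∑ i, ∫ x in simplex K, classicalPartial i (elementLaplacian K v) x * weakPartial Ω i w x) =
    ∑ K ∈ 𝒯.elements, ∑ τ ∈ facesOf K, 2⁻¹ *
      ∫ x, jumpLaplacian 𝒯 v K τ x * g K τ x ∂(faceMeasure τ) := by
  obtain ⟨K₀, hK₀⟩ := 𝒯.elements_nonempty hne
  obtain ⟨θ, hθ⟩ := (𝒯.isElement hK₀).exists_h1Tendsto_gradient ho hN hw fun τ hτ =>
    (hg K₀ hK₀ τ hτ).exists_h1Tendsto.imp fun _ h => h.1
  have hleft : Tendsto (fun k => ∑ K ∈ 𝒯.elements,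
      ((∑ i, ∫ x in simplex K, elementLaplacian K v x * classicalPartial i (θ i k) x)
      + ∑ i, ∫ x in simplex K, classicalPartial i (elementLaplacian K v) x * θ i k x)) atTop
      (𝓝 (∑ K ∈ 𝒯.elements, ((∑ i, ∫ x in simplex K, elementLaplacian K v x *
          weakPartial Ω i (weakPartial Ω i w) x)
      + ∑ i, ∫ x in simplex K, classicalPartial i (elementLaplacian K v) x *
          weakPartial Ω i w x))) := by
    refine tendsto_finsetSum _ fun K hK => ?_
    have hq := contDiff_elementLaplacian K v
    refine (tendsto_finsetSum _ fun i _ => ?_).add (tendsto_finsetSum _ fun i _ => ?_)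
    · exact 𝒯.tendsto_integral_mul hc hK hq.continuous ((hw.2 i).memLp_weakPartial i)
        (fun k => continuous_classicalPartial ((hθ i).1 k) i) ((hθ i).2.2 i)
    · exact 𝒯.tendsto_integral_mul hc hK (continuous_classicalPartial hq i) (hw.2 i).1
        (fun k => ((hθ i).1 k).continuous) (hθ i).2.1
  have hright : Tendsto (fun k => ∑ K ∈ 𝒯.elements, ∑ τ ∈ facesOf K, 2⁻¹ *
      ∫ x, jumpLaplacian 𝒯 v K τ x * ∑ i, outerNormal K τ i * θ i k x ∂(faceMeasure τ)) atTop
      (𝓝 (∑ K ∈ 𝒯.elements, ∑ τ ∈ facesOf K, 2⁻¹ *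
        ∫ x, jumpLaplacian 𝒯 v K τ x * g K τ x ∂(faceMeasure τ))) := by
    refine tendsto_finsetSum _ fun K hK => tendsto_finsetSum _ fun τ hτ => Tendsto.const_mul _ ?_
    obtain ⟨χ, hχ, hχg⟩ := (hg K hK τ hτ).exists_h1Tendsto
    have hs : H1Tendsto Ω (fun k x => ∑ i, outerNormal K τ i * θ i k x)
        (normalDeriv Ω (outerNormal K τ) w) :=
      H1Tendsto.sum ho Finset.univ (fun i => outerNormal K τ i) hw.2 hθ
    exact tendsto_integral_mul_of_eLpNorm
      ((𝒯.isElement hK).memLp_faceMeasure hN hτ (continuous_jumpLaplacian 𝒯 v K τ))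
      (hg K hK τ hτ).1
      (fun k => (𝒯.isElement hK).memLp_faceMeasure hN hτ (hs.1 k).continuous)
      (hs.tendsto_trace 𝒯 hc hN hK hτ (hw.memH1_normalDeriv _) (hg K hK τ hτ).1.1 hχ hχg)
  have heq := tendsto_nhds_unique hleft (hright.congr fun k =>
    (𝒯.sum_integral_mul_divergence hN v fun i => (hθ i).1 k).symm)
  rw [← heq]
  refine Finset.sum_congr rfl fun K hK => ?_
  congr 1
  rw [← integral_finsetSum]
  · simp only [weakLaplacian, Finset.mul_sum]
  · intro i _
    exact (memLp_continuous_simplex K (contDiff_elementLaplacian K v).continuous).integrable_mul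
      (((hw.2 i).memLp_weakPartial i).mono_measure (𝒯.restrict_le hc hK))

/-- One sequence `φ` serves all faces, whatever sequences define the individual traces, because
traces do not depend on the sequence. -/
lemma Triangulation.sum_integral_laplacian_mul_trace (𝒯 : Triangulation Ω) (hN : 0 < N)
    (hc : Convex ℝ Ω) (v : E N → ℝ) {w : E N → ℝ}
    (hw : MemH1 Ω w) {φ : ℕ → E N → ℝ} (hφ : H1Tendsto Ω φ w)
    {g : Finset (E N) → Finset (E N) → E N → ℝ}
    (hg : ∀ K ∈ 𝒯.elements, ∀ τ ∈ facesOf K, HasTrace Ω τ w (g K τ)) :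
    ∑ K ∈ 𝒯.elements, ((∫ x in simplex K, Laplacian.laplacian (elementLaplacian K v) x * w x)
      + ∑ i, ∫ x in simplex K, classicalPartial i (elementLaplacian K v) x * weakPartial Ω i w x) =
    ∑ K ∈ 𝒯.elements, ∑ τ ∈ facesOf K, -(2⁻¹ *
      ∫ x, jumpNormal 𝒯 v K τ x * g K τ x ∂(faceMeasure τ)) := by
  have hleft : Tendsto (fun k => ∑ K ∈ 𝒯.elements,
      ((∫ x in simplex K, Laplacian.laplacian (elementLaplacian K v) x * φ k x)
      + ∑ i, ∫ x in simplex K, classicalPartial i (elementLaplacian K v) x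
        * classicalPartial i (φ k) x)) atTop
      (𝓝 (∑ K ∈ 𝒯.elements,
        ((∫ x in simplex K, Laplacian.laplacian (elementLaplacian K v) x * w x)
      + ∑ i, ∫ x in simplex K, classicalPartial i (elementLaplacian K v) x *
          weakPartial Ω i w x))) := by
    refine tendsto_finsetSum _ fun K hK => ?_
    have hq := contDiff_elementLaplacian K v
    refine Tendsto.add ?_ (tendsto_finsetSum _ fun i _ => ?_)
    · exact 𝒯.tendsto_integral_mul hc hK (contDiff_laplacian hq).continuous hw.1
        (fun k => (hφ.1 k).continuous) hφ.2.1
    · exact 𝒯.tendsto_integral_mul hc hK (continuous_classicalPartial hq i)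
        (hw.memLp_weakPartial i) (fun k => continuous_classicalPartial (hφ.1 k) i) (hφ.2.2 i)
  have hright : Tendsto (fun k => ∑ K ∈ 𝒯.elements, ∑ τ ∈ facesOf K, -(2⁻¹ *
      ∫ x, jumpNormal 𝒯 v K τ x * φ k x ∂(faceMeasure τ))) atTop
      (𝓝 (∑ K ∈ 𝒯.elements, ∑ τ ∈ facesOf K, -(2⁻¹ *
        ∫ x, jumpNormal 𝒯 v K τ x * g K τ x ∂(faceMeasure τ)))) := by
    refine tendsto_finsetSum _ fun K hK => tendsto_finsetSum _ fun τ hτ =>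
      (Tendsto.const_mul _ ?_).neg
    obtain ⟨χ, hχ, hχg⟩ := (hg K hK τ hτ).exists_h1Tendsto
    exact tendsto_integral_mul_of_eLpNorm
      ((𝒯.isElement hK).memLp_faceMeasure hN hτ (continuous_jumpNormal 𝒯 v K τ))
      (hg K hK τ hτ).1
      (fun k => (𝒯.isElement hK).memLp_faceMeasure hN hτ (hφ.1 k).continuous)
      (hφ.tendsto_trace 𝒯 hc hN hK hτ hw (hg K hK τ hτ).1.1 hχ hχg)
  exact tendsto_nhds_unique hleft (hright.congr fun k =>
    (𝒯.sum_integral_laplacian_mul hN v (hφ.1 k)).symm)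

/-- The piecewise Laplacian of a piecewise polynomial `v` integrated twice by parts. -/
lemma Triangulation.sum_integral_green (𝒯 : Triangulation Ω) (hN : 0 < N)
    (hc : Convex ℝ Ω) (ho : IsOpen Ω) (hne : Ω.Nonempty) (v : E N → ℝ) {w : E N → ℝ}
    (hw : MemH2 Ω w) {φ : ℕ → E N → ℝ} (hφ : H1Tendsto Ω φ w)
    {g g' : Finset (E N) → Finset (E N) → E N → ℝ}
    (hg : ∀ K ∈ 𝒯.elements, ∀ τ ∈ facesOf K, HasTrace Ω τ w (g K τ))
    (hg' : ∀ K ∈ 𝒯.elements, ∀ τ ∈ facesOf K,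
      HasTrace Ω τ (normalDeriv Ω (outerNormal K τ) w) (g' K τ)) :
    ∑ K ∈ 𝒯.elements, ∫ x in simplex K, elementLaplacian K v x * weakLaplacian Ω w x =
    ∑ K ∈ 𝒯.elements, ((∫ x in simplex K, Laplacian.laplacian (elementLaplacian K v) x * w x)
      + ∑ τ ∈ facesOf K, 2⁻¹ * ((∫ x, jumpLaplacian 𝒯 v K τ x * g' K τ x ∂(faceMeasure τ))
        + ∫ x, jumpNormal 𝒯 v K τ x * g K τ x ∂(faceMeasure τ))) := by
  -- Subtracting the two formulas cancels the mixed terms `∇Δv · ∇w`.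
  have h1 := 𝒯.sum_integral_mul_weakLaplacian hN hc ho hne v hw hg'
  have h2 := 𝒯.sum_integral_laplacian_mul_trace hN hc v hw.1 hφ hg
  simp only [Finset.sum_add_distrib, mul_add, Finset.sum_neg_distrib] at h1 h2 ⊢
  linarith

/-! ### The nonlinear term -/

lemma integrable_mul_of_memLp {α : Type*} {_ : MeasurableSpace α} {μ : Measure α} {f g : α → ℝ}
    (hf : MemLp f 2 μ) (hg : MemLp g 2 μ) : Integrable (fun x => f x * g x) μ :=
  hf.integrable_mul hg

lemma laplacian_comp {f : ℝ → ℝ} (hf : ContDiff ℝ ∞ f) {p : E N → ℝ} (hp : ContDiff ℝ ∞ p)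
    (x : E N) : Laplacian.laplacian (fun y => f (p y)) x =
      ∑ i, (deriv (deriv f) (p x) * classicalPartial i p x * classicalPartial i p x +
        deriv f (p x) * classicalPartial i (classicalPartial i p) x) := by
  have h0 : ContDiff ℝ ∞ (fun y => f (p y)) := hf.comp hp
  rw [laplacian_eq_sum h0]
  refine Finset.sum_congr rfl fun i _ => ?_
  have h1 : classicalPartial i (fun y => f (p y)) =
      fun y => deriv f (p y) * classicalPartial i p y :=
    funext fun y => classicalPartial_comp hf hp i y
  have h2 := contDiff_deriv hf
  have h3 : ContDiff ℝ ∞ (fun y => deriv f (p y)) := h2.comp hp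
  rw [h1, classicalPartial_mul (differentiableAt_of_contDiff h3 x)
    (differentiableAt_of_contDiff (contDiff_classicalPartial hp i) x), classicalPartial_comp h2 hp]

lemma MemH1.integrable_sum_mul {v w : E N → ℝ} (hv : MemH1 Ω v) (hw : MemH1 Ω w) :
    Integrable (fun x => ∑ i, weakPartial Ω i v x * weakPartial Ω i w x) (volume.restrict Ω) :=
  integrable_finsetSum _ fun i _ => (hv.memLp_weakPartial i).integrable_mul (hw.memLp_weakPartial i)

lemma ae_eq_of_eqOn_simplex {K : Finset (E N)} {v p : E N → ℝ} (h : EqOn v p (simplex K)) :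
    v =ᵐ[volume.restrict (simplex K)] p := by
  filter_upwards [ae_restrict_mem (measurableSet_simplex K)] with x hx using h hx

/-- Green's formula for the nonlinear term, tested with a smooth function. -/
lemma Triangulation.sum_integral_comp_smooth (𝒯 : Triangulation Ω) (hb : Bornology.IsBounded Ω)
    (hc : Convex ℝ Ω) (ho : IsOpen Ω) {v : E N → ℝ} (hv : MemH2E Ω v)
    (hpoly : ∀ K ∈ 𝒯.elements, ∃ p, IsPolyOn K v p) {f : ℝ → ℝ} (hf : ContDiff ℝ ∞ f)
    {φ : E N → ℝ} (hφ : ContDiff ℝ ∞ φ) :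
    ∑ K ∈ 𝒯.elements,
      ((∑ i, ∫ x in simplex K, classicalPartial i (fun y => f (restrictTo K v y)) x *
          classicalPartial i φ x) +
        ∫ x in simplex K, Laplacian.laplacian (fun y => f (restrictTo K v y)) x * φ x) = 0 := by
  have hf' := contDiff_deriv hf
  -- With `η = f'(v) φ` the chain rule gives, on each element, `∇v · ∇η + Δv η = ∇f(v) · ∇φ + Δf(v)
  -- φ`. The Green identity in `MemH2E` thus absorbs all face terms and the boundary condition at
  -- once.
  have hη : MemH1 Ω (fun x => deriv f (v x) * φ x) :=
    (((IsPiecewiseSmooth.of_poly hpoly).comp hf').mul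
      (isPiecewiseSmooth_of_contDiff hφ)).memH1 hb hc ho
  have h0 := hv.2 _ hη
  rw [𝒯.integral_eq_sum hc (hv.1.1.integrable_sum_mul hη),
    𝒯.integral_eq_sum hc (integrable_mul_of_memLp hv.1.memLp_weakLaplacian hη.1),
    ← Finset.sum_add_distrib] at h0
  rw [← h0]
  refine Finset.sum_congr rfl fun K hK => ?_
  set p := restrictTo K v
  have hp : ContDiff ℝ ∞ p := contDiff_restrictTo K v
  have hvp : EqOn v p (simplex K) := restrictTo_eqOn (hpoly K hK)
  have hfp : ContDiff ℝ ∞ (fun y => f (p y)) := hf.comp hp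
  have hηp : ContDiff ℝ ∞ (fun y => deriv f (p y) * φ y) := (hf'.comp hp).mul hφ
  have hle := 𝒯.restrict_le hc hK
  rw [← integral_finsetSum _ fun i _ => integrable_simplex_mul K
      (continuous_classicalPartial hfp i) (continuous_classicalPartial hφ i), ← integral_add
      (integrable_finsetSum _ fun i _ => integrable_simplex_mul K
      (continuous_classicalPartial hfp i) (continuous_classicalPartial hφ i))
      (integrable_simplex_mul K (contDiff_laplacian hfp).continuous hφ.continuous),
    ← integral_add ((hv.1.1.integrable_sum_mul hη).mono_measure hle)
      ((integrable_mul_of_memLp hv.1.memLp_weakLaplacian hη.1).mono_measure hle)]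
  have h1 : ∀ᵐ x ∂(volume.restrict (simplex K)), ∀ i,
      weakPartial Ω i v x = classicalPartial i p x :=
    ae_all_iff.2 fun i => 𝒯.weakPartial_ae_eq ho hc hK (hv.1.1.2 i) hp (ae_eq_of_eqOn_simplex hvp)
  have h2 : ∀ᵐ x ∂(volume.restrict (simplex K)), ∀ i,
      weakPartial Ω i (fun x => deriv f (v x) * φ x) x =
        classicalPartial i (fun y => deriv f (p y) * φ y) x :=
    ae_all_iff.2 fun i => 𝒯.weakPartial_ae_eq ho hc hK (hη.2 i) hηp
      (ae_eq_of_eqOn_simplex fun x hx => by simp only [hvp hx])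
  refine integral_congr_ae ?_
  filter_upwards [h1, h2, ae_eq_of_eqOn_simplex hvp,
    𝒯.weakLaplacian_ae_eq ho hc hK hv.1 hp hvp] with x h1 h2 h3 h4
  simp only [h1, h2, h3, h4]
  rw [laplacian_comp hf hp, laplacian_eq_sum hp, Finset.sum_mul, Finset.sum_mul,
    ← Finset.sum_add_distrib, ← Finset.sum_add_distrib]
  refine Finset.sum_congr rfl fun i _ => ?_
  have h5 : ContDiff ℝ ∞ (fun y => deriv f (p y)) := hf'.comp hp
  rw [classicalPartial_mul (differentiableAt_of_contDiff h5 x)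
    (differentiableAt_of_contDiff hφ x), classicalPartial_comp hf' hp, classicalPartial_comp hf hp]
  ring

/-- Green's formula for the nonlinear term. -/
lemma Triangulation.integral_comp (𝒯 : Triangulation Ω) (hb : Bornology.IsBounded Ω)
    (hc : Convex ℝ Ω) (ho : IsOpen Ω) {v : E N → ℝ} (hv : MemH2E Ω v)
    (hpoly : ∀ K ∈ 𝒯.elements, ∃ p, IsPolyOn K v p) {f : ℝ → ℝ} (hf : ContDiff ℝ ∞ f)
    {w : E N → ℝ} (hw : MemH1 Ω w) {φ : ℕ → E N → ℝ} (hφ : H1Tendsto Ω φ w) :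
    ∫ x in Ω, ∑ i, weakPartial Ω i (fun y => f (v y)) x * weakPartial Ω i w x =
    -∑ K ∈ 𝒯.elements,
      ∫ x in simplex K, Laplacian.laplacian (fun y => f (restrictTo K v y)) x * w x := by
  have hfp : ∀ K, ContDiff ℝ ∞ (fun y => f (restrictTo K v y)) :=
    fun K => hf.comp (contDiff_restrictTo K v)
  have hlim : Tendsto (fun k => ∑ K ∈ 𝒯.elements,
      ((∑ i, ∫ x in simplex K, classicalPartial i (fun y => f (restrictTo K v y)) x *
          classicalPartial i (φ k) x) +
        ∫ x in simplex K, Laplacian.laplacian (fun y => f (restrictTo K v y)) x * φ k x)) atTop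
      (𝓝 (∑ K ∈ 𝒯.elements,
      ((∑ i, ∫ x in simplex K, classicalPartial i (fun y => f (restrictTo K v y)) x *
          weakPartial Ω i w x) +
        ∫ x in simplex K, Laplacian.laplacian (fun y => f (restrictTo K v y)) x * w x))) := by
    refine tendsto_finsetSum _ fun K hK => Tendsto.add (tendsto_finsetSum _ fun i _ => ?_) ?_
    · exact 𝒯.tendsto_integral_mul hc hK (continuous_classicalPartial (hfp K) i)
        (hw.memLp_weakPartial i) (fun k => continuous_classicalPartial (hφ.1 k) i) (hφ.2.2 i)
    · exact 𝒯.tendsto_integral_mul hc hK (contDiff_laplacian (hfp K)).continuous hw.1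
        (fun k => (hφ.1 k).continuous) hφ.2.1
  have hzero := tendsto_nhds_unique hlim (tendsto_const_nhds.congr fun k =>
    (𝒯.sum_integral_comp_smooth hb hc ho hv hpoly hf (hφ.1 k)).symm)
  have hfv : MemH1 Ω (fun y => f (v y)) :=
    ((IsPiecewiseSmooth.of_poly hpoly).comp hf).memH1 hb hc ho
  rw [Finset.sum_add_distrib] at hzero
  rw [𝒯.integral_eq_sum hc (hfv.integrable_sum_mul hw), ← eq_neg_of_add_eq_zero_left hzero]
  refine Finset.sum_congr rfl fun K hK => ?_
  rw [← integral_finsetSum _ fun i _ =>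
    integrable_mul_of_memLp
      (memLp_continuous_simplex K (continuous_classicalPartial (hfp K) i))
      ((hw.memLp_weakPartial i).mono_measure (𝒯.restrict_le hc hK))]
  have h1 : ∀ᵐ x ∂(volume.restrict (simplex K)), ∀ i,
      weakPartial Ω i (fun y => f (v y)) x =
        classicalPartial i (fun y => f (restrictTo K v y)) x :=
    ae_all_iff.2 fun i => 𝒯.weakPartial_ae_eq ho hc hK (hfv.2 i) (hfp K)
      (ae_eq_of_eqOn_simplex fun x hx => by simp only [restrictTo_eqOn (hpoly K hK) hx])
  refine integral_congr_ae ?_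
  filter_upwards [h1] with x h1
  simp only [h1]

/-! ### The residual as a sum of element and face terms -/

lemma laplacian_lin {p q : E N → ℝ} (hp : ContDiff ℝ ∞ p) (hq : ContDiff ℝ ∞ q) (a b : ℝ)
    (x : E N) : Laplacian.laplacian (fun y => a * p y - b * q y) x =
      a * Laplacian.laplacian p x - b * Laplacian.laplacian q x := by
  have hap : ContDiff ℝ ∞ (fun y => a * p y) := contDiff_const.mul hp
  have hbq : ContDiff ℝ ∞ (fun y => b * q y) := contDiff_const.mul hq
  have h0 : ContDiff ℝ ∞ (fun y => a * p y - b * q y) := hap.sub hbq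
  have h1 : ∀ {f g : E N → ℝ}, ContDiff ℝ ∞ f → ContDiff ℝ ∞ g → ∀ i,
      classicalPartial i (fun y => a * f y - b * g y) =
        fun y => a * classicalPartial i f y - b * classicalPartial i g y := fun {f g} hf hg i => by
    have h2 := classicalPartial_sub (contDiff_const.mul hf : ContDiff ℝ ∞ fun y => a * f y)
      (contDiff_const.mul hg : ContDiff ℝ ∞ fun y => b * g y) i
    rw [classicalPartial_const_mul a hf, classicalPartial_const_mul b hg] at h2
    exact h2
  rw [laplacian_eq_sum h0, laplacian_eq_sum hp, laplacian_eq_sum hq]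
  simp only [Finset.mul_sum]
  rw [← Finset.sum_sub_distrib]
  refine Finset.sum_congr rfl fun i _ => ?_
  rw [h1 hp hq, h1 (contDiff_classicalPartial hp i) (contDiff_classicalPartial hq i)]

variable {S : Submodule ℝ (E N → ℝ)} {F : ℝ → ℝ} {ε T t : ℝ} {u : ℝ → E N → ℝ}

lemma memLp_timeDeriv (hS : IsConformingSpace 𝒯 S) (ho : IsOpen Ω)
    (hu : IsSemidiscreteSolution Ω S F ε T u) (ht : t ∈ Ioc 0 T) :
    MemLp (timeDeriv T u t) 2 (volume.restrict Ω) := by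
  have := hS.1
  obtain ⟨z, hz, he⟩ := exists_timeDeriv_eq ht hu.1 (hu.2.1 t ⟨ht.1.le, ht.2⟩)
  refine (memLp_congr_ae ?_).1 (hS.2 z hz).1.1.1.1
  filter_upwards [ae_restrict_mem ho.measurableSet] with x hx
  exact (he x (subset_closure hx)).symm

lemma feResidual_sub (ho : IsOpen Ω) (hd : MemLp (timeDeriv T u t) 2 (volume.restrict Ω))
    (hv : MemH2 Ω (u t)) (hf : MemH1 Ω (fun y => deriv F (u t y))) {ψ χ : E N → ℝ}
    (hψ : MemH2 Ω ψ) (hχ : MemH2 Ω χ) :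
    feResidual Ω F ε T u t (ψ - χ) = feResidual Ω F ε T u t ψ - feResidual Ω F ε T u t χ := by
  have h1 : ∫ x in Ω, timeDeriv T u t x * (ψ - χ) x =
      (∫ x in Ω, timeDeriv T u t x * ψ x) - ∫ x in Ω, timeDeriv T u t x * χ x := by
    rw [← integral_sub (integrable_mul_of_memLp hd hψ.1.1) (integrable_mul_of_memLp hd hχ.1.1)]
    simp only [Pi.sub_apply, mul_sub]
  have h2 : ∫ x in Ω, weakLaplacian Ω (u t) x * weakLaplacian Ω (ψ - χ) x =
      (∫ x in Ω, weakLaplacian Ω (u t) x * weakLaplacian Ω ψ x) -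
        ∫ x in Ω, weakLaplacian Ω (u t) x * weakLaplacian Ω χ x := by
    rw [← integral_sub (integrable_mul_of_memLp hv.memLp_weakLaplacian hψ.memLp_weakLaplacian)
      (integrable_mul_of_memLp hv.memLp_weakLaplacian hχ.memLp_weakLaplacian)]
    refine integral_congr_ae ?_
    filter_upwards [hψ.weakLaplacian_sub ho hχ] with x hx
    rw [hx, Pi.sub_apply, mul_sub]
  have h3 : ∫ x in Ω, ∑ i, weakPartial Ω i (fun y => deriv F (u t y)) x *
        weakPartial Ω i (ψ - χ) x =
      (∫ x in Ω, ∑ i, weakPartial Ω i (fun y => deriv F (u t y)) x * weakPartial Ω i ψ x) -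
        ∫ x in Ω, ∑ i, weakPartial Ω i (fun y => deriv F (u t y)) x * weakPartial Ω i χ x := by
    rw [← integral_sub (hf.integrable_sum_mul hψ.1) (hf.integrable_sum_mul hχ.1)]
    refine integral_congr_ae ?_
    have h4 : ∀ᵐ x ∂(volume.restrict Ω), ∀ i, weakPartial Ω i (ψ - χ) x =
        (weakPartial Ω i ψ - weakPartial Ω i χ) x :=
      ae_all_iff.2 fun i => hψ.1.weakPartial_sub ho hχ.1 i
    filter_upwards [h4] with x hx
    simp only [hx, Pi.sub_apply, mul_sub, Finset.sum_sub_distrib]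
  unfold feResidual
  rw [h1, h2, h3]
  ring

lemma memLp_elementResidual (hc : Convex ℝ Ω) (hF : ContDiff ℝ ∞ F)
    (hd : MemLp (timeDeriv T u t) 2 (volume.restrict Ω)) {K : Finset (E N)}
    (hK : K ∈ 𝒯.elements) :
    MemLp (elementResidual F ε T u t K) 2 (volume.restrict (simplex K)) := by
  have h1 : ContDiff ℝ ∞
      (fun y => ε * elementLaplacian K (u t) y - ε⁻¹ * deriv F (restrictTo K (u t) y)) :=
    (contDiff_const.mul (contDiff_elementLaplacian K (u t))).sub
      (contDiff_const.mul ((contDiff_deriv hF).comp (contDiff_restrictTo K (u t))))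
  exact (hd.mono_measure (𝒯.restrict_le hc hK)).add
    (memLp_continuous_simplex K (contDiff_laplacian h1).continuous)

/-- Face terms come from the fourth-order term alone, so they all carry the factor `ε`; the
nonlinear term enters only through the element residual. -/
lemma feResidual_eq_sum (hN : 0 < N) (hb : Bornology.IsBounded Ω) (hc : Convex ℝ Ω)
    (ho : IsOpen Ω) (hne : Ω.Nonempty) (hF : ContDiff ℝ ∞ F)
    (hd : MemLp (timeDeriv T u t) 2 (volume.restrict Ω)) (hv : MemH2E Ω (u t))
    (hpoly : ∀ K ∈ 𝒯.elements, ∃ p, IsPolyOn K (u t) p) {w : E N → ℝ} (hw : MemH2 Ω w)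
    {g g' : Finset (E N) → Finset (E N) → E N → ℝ}
    (hg : ∀ K ∈ 𝒯.elements, ∀ τ ∈ facesOf K, HasTrace Ω τ w (g K τ))
    (hg' : ∀ K ∈ 𝒯.elements, ∀ τ ∈ facesOf K,
      HasTrace Ω τ (normalDeriv Ω (outerNormal K τ) w) (g' K τ)) :
    feResidual Ω F ε T u t w = ∑ K ∈ 𝒯.elements,
      ((∫ x in simplex K, elementResidual F ε T u t K x * w x) +
        ε * ∑ τ ∈ facesOf K, 2⁻¹ *
          ((∫ x, jumpLaplacian 𝒯 (u t) K τ x * g' K τ x ∂(faceMeasure τ))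
            + ∫ x, jumpNormal 𝒯 (u t) K τ x * g K τ x ∂(faceMeasure τ))) := by
  obtain ⟨K₀, hK₀⟩ := 𝒯.elements_nonempty hne
  obtain ⟨τ₀, hτ₀⟩ : (facesOf K₀).Nonempty :=
    Finset.powersetCard_nonempty.2 (by rw [(𝒯.isElement hK₀).2]; omega)
  -- Any one trace hypothesis already supplies smooth functions converging to `w` in `H¹(Ω)`.
  obtain ⟨φ, hφ, -⟩ := (hg K₀ hK₀ τ₀ hτ₀).exists_h1Tendsto
  have hf := contDiff_deriv hF
  have hfp : ∀ K, ContDiff ℝ ∞ (fun y => deriv F (restrictTo K (u t) y)) :=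
    fun K => hf.comp (contDiff_restrictTo K (u t))
  have hR : ∀ K ∈ 𝒯.elements, ∫ x in simplex K, elementResidual F ε T u t K x * w x =
      (∫ x in simplex K, timeDeriv T u t x * w x) +
      (ε * (∫ x in simplex K, Laplacian.laplacian (elementLaplacian K (u t)) x * w x) -
        ε⁻¹ * ∫ x in simplex K,
          Laplacian.laplacian (fun y => deriv F (restrictTo K (u t) y)) x * w x) := by
    intro K hK
    have hwK := hw.1.1.mono_measure (𝒯.restrict_le hc hK)
    have i1 := integrable_mul_of_memLp (hd.mono_measure (𝒯.restrict_le hc hK)) hwK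
    have i2 := integrable_mul_of_memLp (memLp_continuous_simplex K
      (contDiff_laplacian (contDiff_elementLaplacian K (u t))).continuous) hwK
    have i3 := integrable_mul_of_memLp (memLp_continuous_simplex K
      (contDiff_laplacian (hfp K)).continuous) hwK
    have i4 := (i2.const_mul ε).sub (i3.const_mul ε⁻¹)
    rw [← integral_const_mul, ← integral_const_mul,
      ← integral_sub (i2.const_mul ε) (i3.const_mul ε⁻¹)]
    refine Eq.trans ?_ (integral_add i1 i4)
    refine integral_congr_ae (Filter.Eventually.of_forall fun x => ?_)
    simp only [elementResidual]
    rw [laplacian_lin (contDiff_elementLaplacian K (u t)) (hfp K)]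
    ring
  have h2 : ∫ x in Ω, weakLaplacian Ω (u t) x * weakLaplacian Ω w x =
      ∑ K ∈ 𝒯.elements, ∫ x in simplex K, elementLaplacian K (u t) x * weakLaplacian Ω w x := by
    rw [𝒯.integral_eq_sum hc
      (integrable_mul_of_memLp hv.1.memLp_weakLaplacian hw.memLp_weakLaplacian)]
    refine Finset.sum_congr rfl fun K hK => integral_congr_ae ?_
    filter_upwards [𝒯.weakLaplacian_ae_eq ho hc hK hv.1 (contDiff_restrictTo K (u t))
      (restrictTo_eqOn (hpoly K hK))] with x hx
    rw [hx]
    rfl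
  unfold feResidual
  rw [h2, 𝒯.sum_integral_green hN hc ho hne (u t) hw hφ hg hg',
    𝒯.integral_comp hb hc ho hv hpoly hf hw.1 hφ,
    𝒯.integral_eq_sum hc (integrable_mul_of_memLp hd hw.1.1)]
  simp only [Finset.sum_add_distrib]
  rw [Finset.sum_congr rfl hR]
  simp only [Finset.sum_add_distrib, Finset.sum_sub_distrib, ← Finset.mul_sum]
  ring

/-! ### The a posteriori estimate -/

lemma meshSize_nonneg (s : Finset (E N)) : 0 ≤ meshSize s := Metric.diam_nonneg

/-- This is `((x + y) / 2)² ≤ (x² + y²) / 2` with `x = h^(1/2) b` and `y = h^(3/2) a`; it matches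
the interpolation powers to the weights in the estimator. -/
lemma half_add_le_sqrt {h a b : ℝ} (hh : 0 ≤ h) :
    2⁻¹ * (h ^ (1 / 2 : ℝ) * b + h ^ (3 / 2 : ℝ) * a) ≤ √(h ^ 3 / 2 * a ^ 2 + h / 2 * b ^ 2) := by
  refine Real.le_sqrt_of_sq_le ?_
  have h1 : (h ^ (1 / 2 : ℝ)) ^ 2 = h := by
    rw [← Real.rpow_natCast, ← Real.rpow_mul hh]; norm_num
  have h2 : (h ^ (3 / 2 : ℝ)) ^ 2 = h ^ 3 := by
    rw [← Real.rpow_natCast, ← Real.rpow_mul hh, ← Real.rpow_natCast]; norm_num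
  calc _ ≤ (h ^ (3 / 2 : ℝ)) ^ 2 / 2 * a ^ 2 + (h ^ (1 / 2 : ℝ)) ^ 2 / 2 * b ^ 2 := by
        linarith [sq_nonneg (h ^ (1 / 2 : ℝ) * b - h ^ (3 / 2 : ℝ) * a)]
    _ = _ := by rw [h1, h2]

/-- The interpolation constant has no assumed sign, hence the absolute value. -/
lemma mul_le_abs_mul {c a H H' : ℝ} (ha : 0 ≤ a) (hH : 0 ≤ H) (hHH : H ≤ H') :
    c * a * H ≤ |c| * a * H' := by
  gcongr
  exact le_abs_self c

/-- The estimate of the contribution of one element to the residual. -/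
lemma abs_element_term_le (hN : 0 < N) (hc : Convex ℝ Ω) (hF : ContDiff ℝ ∞ F) (hε : 0 < ε)
    (hε1 : ε ≤ 1) (hd : MemLp (timeDeriv T u t) 2 (volume.restrict Ω)) {ψ w : E N → ℝ}
    (hψ : MemH2 Ω ψ) (hw : MemH2 Ω w) {c : ℝ} {K : Finset (E N)} (hK : K ∈ 𝒯.elements)
    (hwK : l2Norm (volume.restrict (simplex K)) w ≤ c * meshSize K ^ 2 * h2Norm Ω (𝒯.patch K) ψ)
    {g g' : Finset (E N) → E N → ℝ}
    (hgm : ∀ τ ∈ facesOf K, MemLp (g τ) 2 (faceMeasure τ))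
    (hgm' : ∀ τ ∈ facesOf K, MemLp (g' τ) 2 (faceMeasure τ))
    (hg : ∀ τ ∈ facesOf K, l2Norm (faceMeasure τ) (g τ) ≤
      c * meshSize τ ^ (3 / 2 : ℝ) * h2Norm Ω (𝒯.patch τ) ψ)
    (hg' : ∀ τ ∈ facesOf K, l2Norm (faceMeasure τ) (g' τ) ≤
      c * meshSize τ ^ (1 / 2 : ℝ) * h2Norm Ω (𝒯.patch τ) ψ) :
    |(∫ x in simplex K, elementResidual F ε T u t K x * w x) +
        ε * ∑ τ ∈ facesOf K, 2⁻¹ *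
          ((∫ x, jumpLaplacian 𝒯 (u t) K τ x * g' τ x ∂(faceMeasure τ))
            + ∫ x, jumpNormal 𝒯 (u t) K τ x * g τ x ∂(faceMeasure τ))| ≤
      |c| * h2Norm Ω (𝒯.patch K) ψ * estimator 𝒯 F ε T u t K := by
  have hH := h2Norm_nonneg Ω (𝒯.patch K) ψ
  have h1 : |∫ x in simplex K, elementResidual F ε T u t K x * w x| ≤
      |c| * h2Norm Ω (𝒯.patch K) ψ *
        (meshSize K ^ 2 * l2Norm (volume.restrict (simplex K)) (elementResidual F ε T u t K)) := by
    refine (abs_integral_mul_le (memLp_elementResidual hc hF hd hK)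
      (hw.1.1.mono_measure (𝒯.restrict_le hc hK))).trans ?_
    calc _ ≤ l2Norm (volume.restrict (simplex K)) (elementResidual F ε T u t K) *
          (|c| * meshSize K ^ 2 * h2Norm Ω (𝒯.patch K) ψ) :=
        mul_le_mul_of_nonneg_left (hwK.trans (mul_le_abs_mul (sq_nonneg _) hH le_rfl))
          (l2Norm_nonneg _ _)
      _ = _ := by ring
  have h2 : ∀ τ ∈ facesOf K, |2⁻¹ *
      ((∫ x, jumpLaplacian 𝒯 (u t) K τ x * g' τ x ∂(faceMeasure τ))
            + ∫ x, jumpNormal 𝒯 (u t) K τ x * g τ x ∂(faceMeasure τ))| ≤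
      |c| * h2Norm Ω (𝒯.patch K) ψ *
        √(meshSize τ ^ 3 / 2 * l2Norm (faceMeasure τ) (jumpNormal 𝒯 (u t) K τ) ^ 2
          + meshSize τ / 2 * l2Norm (faceMeasure τ) (jumpLaplacian 𝒯 (u t) K τ) ^ 2) := by
    intro τ hτ
    have hel := 𝒯.isElement hK
    have hmono : h2Norm Ω (𝒯.patch τ) ψ ≤ h2Norm Ω (𝒯.patch K) ψ :=
      h2Norm_mono hψ (𝒯.patch_mono (Finset.mem_powersetCard.1 hτ).1)
    have hτ0 := meshSize_nonneg τ
    have e1 := abs_integral_mul_le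
      (hel.memLp_faceMeasure hN hτ (continuous_jumpLaplacian 𝒯 (u t) K τ)) (hgm' τ hτ)
    have e2 := abs_integral_mul_le
      (hel.memLp_faceMeasure hN hτ (continuous_jumpNormal 𝒯 (u t) K τ)) (hgm τ hτ)
    have e3 := mul_le_mul_of_nonneg_left ((hg' τ hτ).trans (mul_le_abs_mul
      (Real.rpow_nonneg hτ0 _) (h2Norm_nonneg _ _ _) hmono))
      (l2Norm_nonneg (faceMeasure τ) (jumpLaplacian 𝒯 (u t) K τ))
    have e4 := mul_le_mul_of_nonneg_left ((hg τ hτ).trans (mul_le_abs_mul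
      (Real.rpow_nonneg hτ0 _) (h2Norm_nonneg _ _ _) hmono))
      (l2Norm_nonneg (faceMeasure τ) (jumpNormal 𝒯 (u t) K τ))
    refine le_trans ?_ (mul_le_mul_of_nonneg_left
      (half_add_le_sqrt hτ0) (mul_nonneg (abs_nonneg c) hH))
    rw [abs_mul, abs_of_pos (by norm_num : (0 : ℝ) < 2⁻¹)]
    calc _ ≤ 2⁻¹ * (_ + _) :=
        mul_le_mul_of_nonneg_left
          ((abs_add_le _ _).trans (add_le_add (e1.trans e3) (e2.trans e4))) (by norm_num)
      _ = _ := by ring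
  have h3 : |ε * ∑ τ ∈ facesOf K, 2⁻¹ *
          ((∫ x, jumpLaplacian 𝒯 (u t) K τ x * g' τ x ∂(faceMeasure τ))
            + ∫ x, jumpNormal 𝒯 (u t) K τ x * g τ x ∂(faceMeasure τ))| ≤
      |c| * h2Norm Ω (𝒯.patch K) ψ * ∑ τ ∈ facesOf K,
        √(meshSize τ ^ 3 / 2 * l2Norm (faceMeasure τ) (jumpNormal 𝒯 (u t) K τ) ^ 2
          + meshSize τ / 2 * l2Norm (faceMeasure τ) (jumpLaplacian 𝒯 (u t) K τ) ^ 2) := by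
    rw [abs_mul, abs_of_pos hε, Finset.mul_sum]
    -- The estimator has no `ε` in front of the jumps; `ε ≤ 1` allows it to be dropped.
    refine (mul_le_of_le_one_left (abs_nonneg _) hε1).trans ?_
    exact (Finset.abs_sum_le_sum_abs _ _).trans (Finset.sum_le_sum h2)
  refine (abs_add_le _ _).trans ((add_le_add h1 h3).trans_eq ?_)
  rw [estimator]
  ring

/-- The constant in the a posteriori estimate. -/
def patchConstant (N : ℕ) (θ : ℝ) : ℝ :=
  (N + 1) * (N * volume.real (Metric.ball (0 : E N) 1)) / θ

lemma patchConstant_nonneg (N : ℕ) {θ : ℝ} (hθ : 0 ≤ θ) : 0 ≤ patchConstant N θ := by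
  unfold patchConstant
  positivity

/-- Galerkin orthogonality, the element bounds, and a discrete Cauchy-Schwarz inequality combined
with finite overlap. -/
lemma feResidual_sq_le (hN : 0 < N) (hb : Bornology.IsBounded Ω) (hc : Convex ℝ Ω)
    (ho : IsOpen Ω) (hne : Ω.Nonempty) (hS : IsConformingSpace 𝒯 S) {c : ℝ}
    (hP : HasLocalInterpolant 𝒯 S c) (hF : ContDiff ℝ ∞ F) (hε : 0 < ε) (hε1 : ε ≤ 1)
    (hu : IsSemidiscreteSolution Ω S F ε T u) (ht : t ∈ Ioc 0 T) {ψ : E N → ℝ}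
    (hψ : MemH2E Ω ψ) :
    feResidual Ω F ε T u t ψ ^ 2 ≤ c ^ 2 * patchConstant N 𝒯.minAngle *
      (∑ K ∈ 𝒯.elements, estimator 𝒯 F ε T u t K ^ 2) * h2Norm Ω Ω ψ ^ 2 := by
  obtain ⟨P, hP⟩ := hP
  obtain ⟨hPS, hP⟩ := hP ψ hψ
  have ht' : t ∈ Icc 0 T := ⟨ht.1.le, ht.2⟩
  have hd := memLp_timeDeriv hS ho hu ht
  obtain ⟨hv, hpoly⟩ := hS.2 (u t) (hu.1 t ht')
  have hf : MemH1 Ω (fun y => deriv F (u t y)) :=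
    ((IsPiecewiseSmooth.of_poly hpoly).comp (contDiff_deriv hF)).memH1 hb hc ho
  have hPψ := (hS.2 _ hPS).1.1
  have hw : MemH2 Ω (ψ - P ψ) := hψ.1.sub ho hPψ
  choose hwK htr using hP
  choose htr1 htr2 using htr
  choose g hg using htr1
  choose g' hg' using htr2
  have hr : |feResidual Ω F ε T u t ψ| ≤ |c| * ∑ K ∈ 𝒯.elements,
      h2Norm Ω (𝒯.patch K) ψ * estimator 𝒯 F ε T u t K := by
    classical
    -- The chosen traces depend on membership proofs; extending them by zero gives families indexed
    -- by all pairs.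
    set G : Finset (E N) → Finset (E N) → E N → ℝ := fun K τ =>
      if h : K ∈ 𝒯.elements ∧ τ ∈ facesOf K then g K h.1 τ h.2 else 0 with hG
    set G' : Finset (E N) → Finset (E N) → E N → ℝ := fun K τ =>
      if h : K ∈ 𝒯.elements ∧ τ ∈ facesOf K then g' K h.1 τ h.2 else 0 with hG'
    have eG : ∀ K (hK : K ∈ 𝒯.elements) τ (hτ : τ ∈ facesOf K), G K τ = g K hK τ hτ :=
      fun K hK τ hτ => dif_pos ⟨hK, hτ⟩
    have eG' : ∀ K (hK : K ∈ 𝒯.elements) τ (hτ : τ ∈ facesOf K), G' K τ = g' K hK τ hτ :=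
      fun K hK τ hτ => dif_pos ⟨hK, hτ⟩
    -- Galerkin orthogonality: the scheme makes the residual vanish at `P ψ`.
    have h0 : feResidual Ω F ε T u t ψ = feResidual Ω F ε T u t (ψ - P ψ) := by
      rw [feResidual_sub ho hd hv.1 hf hψ.1 hPψ, hu.2.2 t ht' _ hPS, sub_zero]
    rw [h0, feResidual_eq_sum hN hb hc ho hne hF hd hv hpoly hw
      (g := G) (g' := G') (fun K hK τ hτ => by rw [eG K hK τ hτ]; exact (hg K hK τ hτ).1)
      (fun K hK τ hτ => by rw [eG' K hK τ hτ]; exact (hg' K hK τ hτ).1), Finset.mul_sum]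
    refine (Finset.abs_sum_le_sum_abs _ _).trans (Finset.sum_le_sum fun K hK => ?_)
    rw [← mul_assoc]
    refine abs_element_term_le hN hc hF hε hε1 hd hψ.1 hw hK (hwK K hK) ?_ ?_ ?_ ?_ <;>
      intro τ hτ
    · rw [eG K hK τ hτ]; exact (hg K hK τ hτ).1.1
    · rw [eG' K hK τ hτ]; exact (hg' K hK τ hτ).1.1
    · rw [eG K hK τ hτ]; exact (hg K hK τ hτ).2
    · rw [eG' K hK τ hτ]; exact (hg' K hK τ hτ).2
  have h1 : (∑ K ∈ 𝒯.elements, h2Norm Ω (𝒯.patch K) ψ * estimator 𝒯 F ε T u t K) ^ 2 ≤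
      patchConstant N 𝒯.minAngle * h2Norm Ω Ω ψ ^ 2 *
        ∑ K ∈ 𝒯.elements, estimator 𝒯 F ε T u t K ^ 2 :=
    (Finset.sum_mul_sq_le_sq_mul_sq _ _ _).trans (mul_le_mul_of_nonneg_right
      (𝒯.sum_h2Norm_patch_le hN hne hc hψ.1) (Finset.sum_nonneg fun _ _ => sq_nonneg _))
  calc feResidual Ω F ε T u t ψ ^ 2 = |feResidual Ω F ε T u t ψ| ^ 2 := (sq_abs _).symm
    _ ≤ (|c| * ∑ K ∈ 𝒯.elements, h2Norm Ω (𝒯.patch K) ψ * estimator 𝒯 F ε T u t K) ^ 2 :=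
        pow_le_pow_left₀ (abs_nonneg _) hr 2
    _ = c ^ 2 * (∑ K ∈ 𝒯.elements, h2Norm Ω (𝒯.patch K) ψ * estimator 𝒯 F ε T u t K) ^ 2 := by
        rw [mul_pow, sq_abs]
    _ ≤ c ^ 2 * (patchConstant N 𝒯.minAngle * h2Norm Ω Ω ψ ^ 2 *
        ∑ K ∈ 𝒯.elements, estimator 𝒯 F ε T u t K ^ 2) :=
        mul_le_mul_of_nonneg_left h1 (sq_nonneg c)
    _ = _ := by ring

lemma dualNorm_sq_le {r : (E N → ℝ) → ℝ} {A : ℝ} (hA : 0 ≤ A)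
    (h : ∀ ψ, MemH2E Ω ψ → r ψ ^ 2 ≤ A * h2Norm Ω Ω ψ ^ 2) :
    dualNorm Ω r ^ 2 ≤ ENNReal.ofReal A := by
  have h1 : dualNorm Ω r ≤ ENNReal.ofReal (√A) := by
    refine iSup₂_le fun ψ hψ => ENNReal.ofReal_le_ofReal ?_
    have hpos : 0 < h2Norm Ω Ω ψ := lt_of_le_of_ne (h2Norm_nonneg _ _ _) (Ne.symm hψ.2)
    rw [div_le_iff₀ hpos]
    refine (le_abs_self _).trans (abs_le_of_sq_le_sq ?_ (by positivity))
    rw [mul_pow, Real.sq_sqrt hA]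
    exact h ψ hψ.1
  calc dualNorm Ω r ^ 2 ≤ ENNReal.ofReal (√A) ^ 2 := by gcongr
    _ = ENNReal.ofReal A := by rw [← ENNReal.ofReal_pow (Real.sqrt_nonneg _), Real.sq_sqrt hA]

end CahnHilliardFE

end

open CahnHilliardFE
theorem mainTheorem9 (c : ℝ → ℝ) :
    ∃ C : ℝ → ℝ, ∀ (N : ℕ), (N = 2 ∨ N = 3) →
      ∀ (Ω : Set (EuclideanSpace ℝ (Fin N))), IsOpen Ω → Ω.Nonempty → Bornology.IsBounded Ω →
        Convex ℝ Ω →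
      ∀ (𝒯 : Triangulation Ω) (S : Submodule ℝ (EuclideanSpace ℝ (Fin N) → ℝ)),
        IsConformingSpace 𝒯 S → HasLocalInterpolant 𝒯 S (c 𝒯.minAngle) →
      ∀ (F : ℝ → ℝ), IsDoubleWell F →
      ∀ (ε : ℝ), 0 < ε → ε ≤ 1 → ∀ (T : ℝ), 0 < T →
      ∀ (u : ℝ → EuclideanSpace ℝ (Fin N) → ℝ), IsSemidiscreteSolution Ω S F ε T u →
      ∀ t ∈ Set.Ioc 0 T,
        dualNorm Ω (feResidual Ω F ε T u t) ^ 2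
          ≤ ENNReal.ofReal
              (C 𝒯.minAngle * ∑ K ∈ 𝒯.elements, estimator 𝒯 F ε T u t K ^ 2) := by
  -- The constant may depend on the angle only, so the maximum covers both dimensions.
  refine ⟨fun θ => c θ ^ 2 * max (patchConstant 2 θ) (patchConstant 3 θ), ?_⟩
  intro N hN Ω ho hne hb hc 𝒯 S hS hP F hF ε hε hε1 T _ u hu t ht
  have hN0 : 0 < N := by omega
  have hθ := (𝒯.minAngle_pos hN0 hne).le
  have hsum : 0 ≤ ∑ K ∈ 𝒯.elements, estimator 𝒯 F ε T u t K ^ 2 :=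
    Finset.sum_nonneg fun _ _ => sq_nonneg _
  have hle : patchConstant N 𝒯.minAngle ≤
      max (patchConstant 2 𝒯.minAngle) (patchConstant 3 𝒯.minAngle) := by
    obtain rfl | rfl := hN
    · exact le_max_left _ _
    · exact le_max_right _ _
  have hmax := (patchConstant_nonneg N hθ).trans hle
  refine dualNorm_sq_le (mul_nonneg (mul_nonneg (sq_nonneg _) hmax) hsum) fun ψ hψ => ?_
  refine (feResidual_sq_le hN0 hb hc ho hne hS hP hF.1 hε hε1 hu ht hψ).trans ?_
  exact mul_le_mul_of_nonneg_right (mul_le_mul_of_nonneg_right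
    (mul_le_mul_of_nonneg_left hle (sq_nonneg _)) hsum) (sq_nonneg _)
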